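/- Let $(\Omega,\mathcal F,(\mathcal F_t)_{t\ge 0},\mathbb P)$ be a filtered probability space satisfying the usual hypotheses, $(\mathbf E,\mathcal E,m)$ a $\sigma$-finite measure space, and $N(dz,dt)$ an $(\mathcal F_t)$-Poisson random measure on $[0,\infty)\times\mathbf E$ with intensity $m(dz)\,dt$; put $\tilde N(dz,dt)=N(dz,dt)-m(dz)\,dt$. Let $d\ge 1$, $T>0$, $\Pi_T=[0,T)\times\mathbb R^d$, and assume: 1. $f:\mathbb R\to\mathbb R$ is $C^2$, nondecreasing, Lipschitz with constant $c_f$, and $f(0)=0$. 2. $\vec v:[0,T]\times\mathbb R^d\to\mathbb R^d$ is $C^1$, $\operatorname{div}_x\vec v=0$ and $|\vec v|\le V<\infty$ on $\Pi_T$. 3. $\eta:\mathbb R\times\mathbf E\to\mathbb R$ is measurable in $z$, and there are $0<\lambda^*<1$, $C^*>0$ and $h_1\in L^2(\mathbf E,m)$ with $0\le h_1\le 1$ such that $|\eta(a;z)-\eta(b;z)|\le\lambda^*|a-b|h_1(z)$, $|\eta(a;z)|\le C^*h_1(z)$ and $\eta(0;z)=0$ for all $a,b\in\mathbb R$, $z\in\mathbf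 E$. Put $c_\eta=\int_{\mathbf E}h_1^2\,dm$. 4. $u_0$ is an $\mathcal F_0$-measurable $L^2(\mathbb R^d)$-valued random variable with $\mathbb E\|u_0\|_{2}^2<\infty$. Let $\mathcal T$ be an admissible mesh of $\mathbb R^d$: a family of pairwise disjoint connected polygonal sets $K$ (each contained in the closure of its interior and with boundary contained in finitely many hyperplanes) whose closures cover $\mathbb R^d$, with $h=\sup_{K\in\mathcal T}\operatorname{diam}K<\infty$, such that for some constant $\alpha>0$ one has $\alpha h^d\le|K|$ and $|\partial K|\le\alpha^{-1}h^{d-1}$ for all $K\in\mathcal T$, and such that the interface $\sigma=K|L=\overline K\cap\overline L$ of any two neighbours (distinct $K,L\in\mathcal T$ with $|K|L|>0$) is contained in a hyperplane, with a unit normal $n_{K,\sigma}$ that is outward to $K$ at almost every point of $\sigma$. Here $|K|$ is $d$-dimensional and $|\partial K|$, $|\sigma|$ are $(d-1)$-dimensional Lebesgue measure. Let $\Delta t=T/N$ with $N\in\mathbb N$, $N\ge 1$, let $t_n=n\Delta t$, and assume the CFL condition $$\Delta t\le\frac{\alpha^2h}{c_fV}\qquad(\text{no restriction if } c_fV=0).$$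 Let $(u_K^n)_{K\in\mathcal T,\,0\le n\le N}$ be given by the upwind finite volume scheme: almost surely, $u_K^0=\frac1{|K|}\int_Ku_0\,dx$ and, for $0\le n<N$, $$\frac{|K|}{\Delta t}(u_K^{n+1}-u_K^n)+\sum_{\sigma=K|L}|\sigma|\,(\vec v\cdot n_{K,\sigma})\,f(u_\sigma^n)=\frac{|K|}{\Delta t}\int_{t_n}^{t_{n+1}}\!\!\int_{\mathbf E}\eta(u_K^n;z)\,\tilde N(dz,dt),$$ the sum being over the interfaces of $K$ with its neighbours $L$, where $\vec v\cdot n_{K,\sigma}=\frac1{\Delta t|\sigma|}\int_{t_n}^{t_{n+1}}\int_\sigma\vec v(t,x)\cdot n_{K,\sigma}\,d\nu(x)\,dt$, $\nu$ is $(d-1)$-dimensional Lebesgue measure, and $u_\sigma^n=u_K^n$ if $\vec v\cdot n_{K,\sigma}\ge0$, $u_\sigma^n=u_L^n$ otherwise. Alternatively, let upwinding be done pointwise on $\sigma$, that is, let the flux term be $|\sigma|\{(\vec v\cdot n_{K,\sigma})^+f(u_K^n)-(\vec v\cdot n_{K,\sigma})^-f(u_L^n)\}$ (for all $n$, $K$,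 $\sigma$), where $(\vec v\cdot n_{K,\sigma})^\pm=\frac1{\Delta t|\sigma|}\int_{t_n}^{t_{n+1}}\int_\sigma(\vec v(t,x)\cdot n_{K,\sigma})^\pm\,d\nu(x)\,dt$. In either case the approximate solution $u^h(t,x)=u_K^n$ for $x\in K$, $t\in[t_n,t_{n+1})$ satisfies $$\|u^h\|^2_{L^\infty(0,T;L^2(\Omega\times\mathbb R^d))}\le e^{c_\eta T}\,\mathbb E\big[\|u_0\|_2^2\big]\qquad\text{and}\qquad\|u^h\|^2_{L^2(\Omega\times\Pi_T)}\le T\,e^{c_\eta T}\,\mathbb E\big[\|u_0\|_2^2\big].$$ -/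

import Mathlib

open MeasureTheory ProbabilityTheory Filter Topology
open scoped NNReal ENNReal

namespace UpwindFV

noncomputable section

/-! ### Poisson random measures and the stochastic integral -/

/-- `Nm` is a Poisson random measure on `Θ` with intensity measure `ρ`. A Poisson variable with
infinite mean is, as usual, one that is almost surely infinite. -/
structure IsPoissonRandomMeasure {Ω Θ : Type*} [MeasurableSpace Ω] [MeasurableSpace Θ]
    (P : Measure Ω) (ρ : Measure Θ) (Nm : Ω → Measure Θ) : Prop where
  measurable : ∀ B, MeasurableSet B → Measurable (fun ω => Nm ω B)
  law : ∀ B, MeasurableSet B → ρ B ≠ ∞ →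
    P.map (fun ω => Nm ω B) = (poissonMeasure (ρ B).toNNReal).map (fun k : ℕ => (k : ℝ≥0∞))
  law_top : ∀ B, MeasurableSet B → ρ B = ∞ → ∀ᵐ ω ∂P, Nm ω B = ∞
  indep : ∀ (k : ℕ) (B : Fin k → Set Θ), (∀ i, MeasurableSet (B i)) →
    Pairwise (Function.onFun Disjoint B) → iIndepFun (fun i ω => Nm ω (B i)) P

/-- `Nm` is a Poisson random measure on `[0,∞) × E` (time and mark) with intensity `dt ⊗ m`,
relative to the filtration `ℱ`: its restriction to `[0,t] × E` is `ℱ t`-measurable and its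
restriction to `(t,∞) × E` is independent of `ℱ t`. -/
structure IsFiltrationPoisson {Ω E : Type*} {mΩ : MeasurableSpace Ω} [MeasurableSpace E]
    (P : Measure Ω) (ℱ : Filtration ℝ≥0 mΩ) (m : Measure E) (Nm : Ω → Measure (ℝ × E)) :
    Prop where
  poisson : IsPoissonRandomMeasure P ((volume.restrict (Set.Ici (0 : ℝ))).prod m) Nm
  adapted : ∀ (t : ℝ≥0) (B : Set (ℝ × E)), MeasurableSet B →
    B ⊆ Set.Icc (0 : ℝ) t ×ˢ Set.univ → Measurable[ℱ t] (fun ω => Nm ω B)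
  indep_future : ∀ t : ℝ≥0,
    Indep (⨆ B : {B : Set (ℝ × E) // MeasurableSet B ∧ B ⊆ Set.Ioi (t : ℝ) ×ˢ Set.univ},
      MeasurableSpace.comap (fun ω => Nm ω B.1) inferInstance) (ℱ t) P

/-- The usual hypotheses on a filtered probability space. -/
structure UsualHypotheses {Ω : Type*} {mΩ : MeasurableSpace Ω} (P : Measure Ω)
    (ℱ : Filtration ℝ≥0 mΩ) : Prop where
  rightContinuous : ℱ.IsRightContinuous
  null_mem : ∀ s : Set Ω, P s = 0 → MeasurableSet[ℱ 0] s

/-- A simple predictable function on `(a,b]`: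
`∑ i j, ξ i j · 1_{(τ i, τ (i+1)]}(t) · 1_{A j}(z)`, where `a = τ 0 ≤ ⋯ ≤ τ p = b`, each `ξ i j` is
bounded and `ℱ (τ i)`-measurable, and the `A j` are disjoint sets of finite measure. -/
structure SimplePredictable {Ω E : Type*} {mΩ : MeasurableSpace Ω} [MeasurableSpace E]
    (ℱ : Filtration ℝ≥0 mΩ) (m : Measure E) (a b : ℝ≥0) where
  p : ℕ
  q : ℕ
  τ : ℕ → ℝ≥0
  τ_mono : Monotone τ
  τ_zero : τ 0 = a
  τ_last : τ p = b
  A : Fin q → Set E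
  A_meas : ∀ j, MeasurableSet (A j)
  A_disj : Pairwise (Function.onFun Disjoint A)
  A_fin : ∀ j, m (A j) ≠ ∞
  ξ : Fin p → Fin q → Ω → ℝ
  ξ_meas : ∀ (i : Fin p) (j : Fin q), Measurable[ℱ (τ i)] (ξ i j)
  ξ_bdd : ∃ C : ℝ, ∀ i j ω, |ξ i j ω| ≤ C

namespace SimplePredictable

variable {Ω E : Type*} {mΩ : MeasurableSpace Ω} [MeasurableSpace E]
  {ℱ : Filtration ℝ≥0 mΩ} {m : Measure E} {a b : ℝ≥0}

/-- The simple function itself. -/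
def toFun (S : SimplePredictable ℱ m a b) (ω : Ω) (t : ℝ) (z : E) : ℝ :=
  ∑ i : Fin S.p, ∑ j : Fin S.q,
    S.ξ i j ω * (Set.Ioc (S.τ i : ℝ) (S.τ (i + 1))).indicator 1 t * (S.A j).indicator 1 z

/-- Its integral with respect to the compensated measure `Nm(dz,dt) - m(dz) dt`. -/
def integral (S : SimplePredictable ℱ m a b) (Nm : Ω → Measure (ℝ × E)) (ω : Ω) : ℝ :=
  ∑ i : Fin S.p, ∑ j : Fin S.q,
    S.ξ i j ω * ((Nm ω (Set.Ioc (S.τ i : ℝ) (S.τ (i + 1)) ×ˢ S.A j)).toReal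
      - ((S.τ (i + 1) : ℝ) - S.τ i) * (m (S.A j)).toReal)

end SimplePredictable

/-- `I` is (a version of) the stochastic integral `∫_a^b ∫_E ζ(t,z) Ñ(dz,dt)` with respect to the
compensated measure: `ζ` is an `L²(Ω × (a,b] × E)`-limit of simple predictable functions whose
integrals converge to `I` in `L²(Ω)`. -/
def IsStochIntegral {Ω E : Type*} {mΩ : MeasurableSpace Ω} [MeasurableSpace E]
    (P : Measure Ω) (ℱ : Filtration ℝ≥0 mΩ) (m : Measure E) (Nm : Ω → Measure (ℝ × E))
    (a b : ℝ≥0) (ζ : Ω → ℝ → E → ℝ) (I : Ω → ℝ) : Prop :=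
  MemLp I 2 P ∧ ∃ S : ℕ → SimplePredictable ℱ m a b,
    Tendsto (fun k => eLpNorm (fun y : Ω × (ℝ × E) =>
        (S k).toFun y.1 y.2.1 y.2.2 - ζ y.1 y.2.1 y.2.2) 2
        (P.prod ((volume.restrict (Set.Ioc (a : ℝ) b)).prod m))) atTop (𝓝 0) ∧
    Tendsto (fun k => eLpNorm (fun ω => (S k).integral Nm ω - I ω) 2 P) atTop (𝓝 0)

/-! ### Admissible meshes -/

/-- A (not necessarily convex, open or closed) polygonal set: it has no lower-dimensional parts,
and its boundary lies in finitely many hyperplanes. -/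
def IsPolygonal {d : ℕ} (K : Set (EuclideanSpace ℝ (Fin d))) : Prop :=
  K ⊆ closure (interior K) ∧
  ∃ S : Finset (EuclideanSpace ℝ (Fin d) × ℝ), (∀ p ∈ S, p.1 ≠ 0) ∧
    frontier K ⊆ ⋃ p ∈ S, {x | inner ℝ p.1 x = p.2}

/-- The common interface `K|L` of two control volumes. -/
def interface {d : ℕ} (K L : Set (EuclideanSpace ℝ (Fin d))) : Set (EuclideanSpace ℝ (Fin d)) :=
  closure K ∩ closure L

/-- The `(d-1)`-dimensional Lebesgue measure on subsets of `ℝ^d`. -/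
def surface (d : ℕ) : Measure (EuclideanSpace ℝ (Fin d)) :=
  Measure.euclideanHausdorffMeasure (d - 1)

/-- `n` is the unit normal to the flat interface of `K` and `L` (which lies in a hyperplane),
outward to `K`. -/
def IsOutwardNormal {d : ℕ} (K L : Set (EuclideanSpace ℝ (Fin d)))
    (n : EuclideanSpace ℝ (Fin d)) : Prop :=
  ‖n‖ = 1 ∧ (∃ c : ℝ, ∀ x ∈ interface K L, inner ℝ n x = c) ∧
  ∀ᵐ x ∂((surface d).restrict (interface K L)), ∀ᶠ ε : ℝ in 𝓝[>] 0,
    x - ε • n ∈ K ∧ x + ε • n ∉ K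

/-- An admissible mesh of `ℝ^d`, with control volumes indexed by `ι`. -/
structure AdmissibleMesh (d : ℕ) (ι : Type*) where
  /-- the control volumes -/
  cell : ι → Set (EuclideanSpace ℝ (Fin d))
  /-- the constant in the regularity condition -/
  α : ℝ
  /-- `normal K L` is the unit normal to the interface of `K` and `L`, outward to `K` -/
  normal : ι → ι → EuclideanSpace ℝ (Fin d)
  disjoint : Pairwise (Function.onFun Disjoint cell)
  polygonal : ∀ K, IsPolygonal (cell K)
  connected : ∀ K, IsConnected (cell K)
  cover : ⋃ K, closure (cell K) = Set.univ
  flat : ∀ K L, K ≠ L → 0 < surface d (interface (cell K) (cell L)) →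
    IsOutwardNormal (cell K) (cell L) (normal K L)
  size_finite : ⨆ K, Metric.ediam (cell K) ≠ ∞
  α_pos : 0 < α
  volume_ge : ∀ K,
    ENNReal.ofReal (α * (⨆ K, Metric.ediam (cell K)).toReal ^ d) ≤ volume (cell K)
  boundary_le : ∀ K, surface d (frontier (cell K)) ≤
    ENNReal.ofReal (1 / α * (⨆ K, Metric.ediam (cell K)).toReal ^ (d - 1))

namespace AdmissibleMesh

variable {d : ℕ} {ι : Type*} (𝒯 : AdmissibleMesh d ι)

/-- The size `h = sup {diam K}` of the mesh. -/
def size : ℝ := (⨆ K, Metric.ediam (𝒯.cell K)).toReal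

/-- The set `𝒩(K)` of neighbours of `K`. -/
def neighbors (K : ι) : Set ι :=
  {L | L ≠ K ∧ 0 < surface d (interface (𝒯.cell K) (𝒯.cell L))}

/-- `|K|`. -/
def vol (K : ι) : ℝ := volume.real (𝒯.cell K)

/-- `|σ|` for the interface `σ = K|L`. -/
def area (K L : ι) : ℝ := (surface d).real (interface (𝒯.cell K) (𝒯.cell L))

/-- The mean of `g (v(t,x)·n_{K,σ})` over `[n Δt, (n+1) Δt] × σ`, for `σ = K|L`. -/
def normalMean (v : ℝ → EuclideanSpace ℝ (Fin d) → EuclideanSpace ℝ (Fin d)) (Δt : ℝ)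
    (g : ℝ → ℝ) (n : ℕ) (K L : ι) : ℝ :=
  1 / (Δt * 𝒯.area K L) * ∫ t in (n * Δt)..((n + 1) * Δt),
    ∫ x in interface (𝒯.cell K) (𝒯.cell L), g (inner ℝ (v t x) (𝒯.normal K L)) ∂(surface d)

/-- The upwind flux `|σ| (v·n_{K,σ}) f(u_σ)` through `σ = K|L`, where `v·n_{K,σ}` is the mean normal
velocity on `σ` over the time step and `u_σ` is the upstream value: `u_K` if `v·n_{K,σ} ≥ 0` and
`u_L` otherwise. -/
def upwindFlux (v : ℝ → EuclideanSpace ℝ (Fin d) → EuclideanSpace ℝ (Fin d)) (Δt : ℝ)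
    (f : ℝ → ℝ) (n : ℕ) (K L : ι) (uK uL : ℝ) : ℝ :=
  𝒯.area K L * 𝒯.normalMean v Δt id n K L *
    f (if 0 ≤ 𝒯.normalMean v Δt id n K L then uK else uL)

/-- The variant in which upwinding is done pointwise on `σ`:
`|σ| ((v·n_{K,σ})⁺ f(u_K) - (v·n_{K,σ})⁻ f(u_L))`, where `(v·n_{K,σ})^±` are the means of the positive
and negative parts of the normal velocity. -/
def splitUpwindFlux (v : ℝ → EuclideanSpace ℝ (Fin d) → EuclideanSpace ℝ (Fin d)) (Δt : ℝ)
    (f : ℝ → ℝ) (n : ℕ) (K L : ι) (uK uL : ℝ) : ℝ :=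
  𝒯.area K L * (𝒯.normalMean v Δt (fun s => max s 0) n K L * f uK
    - 𝒯.normalMean v Δt (fun s => max (-s) 0) n K L * f uL)

/-- The piecewise constant function equal to `u n K` on `[n Δt, (n+1) Δt) × K`. -/
def approx {Ω : Type*} (Δt : ℝ) (u : ℕ → ι → Ω → ℝ) (t : ℝ) (x : EuclideanSpace ℝ (Fin d))
    (ω : Ω) : ℝ :=
  ∑ᶠ K, (𝒯.cell K).indicator (fun _ => u ⌊t / Δt⌋₊ K ω) x

end AdmissibleMesh

/-- The random variables `u n K` (`n ≤ N`) satisfy the finite volume scheme with numerical flux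
`F n K L (u_K) (u_L)`, initial value `u₀`, time step `Δt` and noise coefficient `η`. -/
structure IsSchemeSolution {Ω E ι : Type*} {mΩ : MeasurableSpace Ω} [MeasurableSpace E] {d : ℕ}
    (P : Measure Ω) (ℱ : Filtration ℝ≥0 mΩ) (m : Measure E) (Nm : Ω → Measure (ℝ × E))
    (𝒯 : AdmissibleMesh d ι) (Δt : ℝ≥0) (N : ℕ) (F : ℕ → ι → ι → ℝ → ℝ → ℝ)
    (η : ℝ → E → ℝ) (u₀ : Ω → Lp ℝ 2 (volume : Measure (EuclideanSpace ℝ (Fin d))))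
    (u : ℕ → ι → Ω → ℝ) : Prop where
  initial : ∀ K, ∀ᵐ ω ∂P, u 0 K ω = 1 / 𝒯.vol K * ∫ x in 𝒯.cell K, u₀ ω x
  step : ∀ n < N, ∀ K, ∃ I : Ω → ℝ,
    IsStochIntegral P ℱ m Nm (n * Δt) ((n + 1) * Δt) (fun ω _ z => η (u n K ω) z) I ∧
    ∀ᵐ ω ∂P, 𝒯.vol K / Δt * (u (n + 1) K ω - u n K ω)
        + ∑ᶠ L ∈ 𝒯.neighbors K, F n K L (u n K ω) (u n L ω)
      = 𝒯.vol K / Δt * I ω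

/-- The divergence of a vector field on `ℝ^d`. -/
def divergence {d : ℕ} (w : EuclideanSpace ℝ (Fin d) → EuclideanSpace ℝ (Fin d))
    (x : EuclideanSpace ℝ (Fin d)) : ℝ :=
  ∑ i, fderiv ℝ w x (EuclideanSpace.single i 1) i

/-- The norm of `L^∞(0,T; L²(Ω × ℝ^d))`, as an extended real. -/
def normLinftyL2 {Ω : Type*} [MeasurableSpace Ω] {d : ℕ} (P : Measure Ω) (T : ℝ)
    (w : ℝ → EuclideanSpace ℝ (Fin d) → Ω → ℝ) : ℝ≥0∞ :=
  essSup (fun t => eLpNorm (fun y : Ω × EuclideanSpace ℝ (Fin d) => w t y.2 y.1) 2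
    (P.prod volume)) (volume.restrict (Set.Ioo 0 T))

end

end UpwindFV

/-! The quantity to control is the energy `∑ |K| E[(u_K^n)²]`, which is the squared norm of the
approximate solution at any time of the step `[t_n, t_{n+1})`. If one step multiplies it by at most
`1 + Δt c_η`, and averaging `u₀` over cells does not increase the norm (`tsum_mean_sq_le`), then
both bounds follow from `(1 + Δt c_η)^n ≤ e^{c_η T}`.

In one step (`step_estimates`) the new value is `D_K + I_K`, with `D_K` the deterministic upwind
update and `I_K` the noise. `D_K` is determined by the past up to a null set, and `I_K` is
orthogonal to the past, so second moments add. By the Itô isometry for the compensated Poisson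
measure and `|η(a;z)| ≤ |a| h₁(z)`, the noise contributes at most `Δt c_η E[u_K²]`
(`noise_estimate`).

It remains that the upwind update does not increase the discrete `L²` norm, path by path
(`tsum_energy_le`). Both fluxes have the form `b_LK f(u_K) - b_KL f(u_L)` with `b ≥ 0`. Since `v` is
divergence free, inflow equals outflow on each cell, so the update is `u_K - (Δt/|K|) ∑ b_KL (f(u_K)
- f(u_L))`. Let `Φ` be the antiderivative of `s f'(s)`. Then `u (f(u) - f(w)) = Φ(u) - Φ(w) + ψ`,
where `ψ = ∫_w^u (f(s) - f(w)) ds ≥ (f(u) - f(w))² / (2 c_f)`. Under the CFL condition `ψ` absorbs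
the quadratic term of the expanded square, and the differences of `Φ` cancel in the sum over the
mesh, again because inflow equals outflow.

The balance of inflow and outflow needs the divergence theorem on cells that are merely polygonal
(`integral_divergence_cell`). The difference quotient in direction `e` of the translated indicator
function of a cell is supported in thin prisms over the boundary; slicing by hyperplanes turns it in
the limit into a surface integral of the jump (`integral_fderiv_eq_integral_jump`). Near almost
every boundary point the cell occupies some of the two sides of a hyperplane, and the covering and
disjointness of the mesh identify the jump with the outward normals of the interfaces. -/

namespace UpwindFV

/-! ### Slicing by hyperplanes -/

section Slicing

variable {d : ℕ}

/-- The hyperplane `{x | ⟪n, x⟫ = c}`. -/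
def hyperplane (n : EuclideanSpace ℝ (Fin d)) (c : ℝ) : Set (EuclideanSpace ℝ (Fin d)) :=
  {x | inner ℝ n x = c}

theorem isClosed_hyperplane (n : EuclideanSpace ℝ (Fin d)) (c : ℝ) :
    IsClosed (hyperplane n c) :=
  isClosed_eq (by fun_prop) continuous_const

theorem surface_translate (A : Set (EuclideanSpace ℝ (Fin d))) (w : EuclideanSpace ℝ (Fin d)) :
    surface d ((fun y => y + w) ⁻¹' A) = surface d A := by
  unfold surface
  exact measure_preimage_add_right _ w A

/-- Slicing of the volume by the translates of a hyperplane in a transversal direction `e`. -/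
theorem volume_eq_lintegral_slice {n : EuclideanSpace ℝ (Fin d)} (hn : ‖n‖ = 1) (c : ℝ)
    {e : EuclideanSpace ℝ (Fin d)} (he : inner ℝ n e ≠ 0)
    {B : Set (EuclideanSpace ℝ (Fin d))} (hB : MeasurableSet B) :
    volume B = ENNReal.ofReal |inner ℝ n e| *
      ∫⁻ r : ℝ, surface d (hyperplane n c ∩ {y | y + r • e ∈ B}) := by
  have hn0 : n ≠ 0 := by rintro rfl; simp at hn
  have h := EuclideanGeometry.euclideanHausdorffMeasure_eq_lintegral (c • n) hn0 hB
  rw [InnerProductSpace.euclideanHausdorffMeasure_eq_volume, finrank_euclideanSpace_fin] at h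
  have hne : ‖n‖ₑ = 1 := by rw [← ofReal_norm, hn]; simp
  rw [h, hne, one_mul]
  set F : ℝ → ℝ≥0∞ := fun r => surface d (hyperplane n c ∩ {y | y + r • e ∈ B}) with hF
  -- Moving back along `r • e` with `r = s / ⟪n, e⟫` takes the orthogonal slice at height `s` to the
  -- base hyperplane. The substitution `s ↦ r` then produces the factor `|⟪n, e⟫|`.
  have key : ∀ s : ℝ, Measure.euclideanHausdorffMeasure (d - 1)
      (B ∩ AffineSubspace.mk' (s • n +ᵥ c • n) (ℝ ∙ n)ᗮ) = F ((inner ℝ n e)⁻¹ * s) := by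
    intro s
    change surface d _ = surface d _
    rw [← surface_translate _ (((inner ℝ n e)⁻¹ * s) • e)]
    congr 1
    ext y
    have hnn : inner ℝ n n = (1 : ℝ) := by rw [real_inner_self_eq_norm_sq, hn]; norm_num
    simp only [Set.mem_preimage, Set.mem_inter_iff, SetLike.mem_coe, AffineSubspace.mem_mk',
      hyperplane, Set.mem_ofPred_eq, Submodule.mem_orthogonal_singleton_iff_inner_right,
      vsub_eq_sub, vadd_eq_add, inner_sub_right, inner_add_right, inner_smul_right, hnn]
    have : (inner ℝ n e)⁻¹ * s * inner ℝ n e = s := by field_simp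
    rw [this]
    constructor
    · rintro ⟨h1, h2⟩; exact ⟨by linarith, h1⟩
    · rintro ⟨h1, h2⟩; exact ⟨h2, by linarith⟩
  simp_rw [key]
  have hmap := Real.map_volume_mul_left (inv_ne_zero he)
  let Φ : ℝ ≃ᵐ ℝ := (Homeomorph.mulLeft₀ _ (inv_ne_zero he)).toMeasurableEquiv
  have hΦ : ∫⁻ s, F ((inner ℝ n e)⁻¹ * s) = ∫⁻ r, F r ∂(Measure.map Φ volume) :=
    (MeasureTheory.lintegral_map_equiv F Φ).symm
  have hΦ' : Measure.map Φ volume = ENNReal.ofReal |inner ℝ n e| • (volume : Measure ℝ) := by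
    have : (Φ : ℝ → ℝ) = ((inner ℝ n e)⁻¹ * ·) := rfl
    rw [this, hmap, inv_inv]
  rw [hΦ, hΦ', lintegral_smul_measure, smul_eq_mul]

theorem volume_hyperplane {n : EuclideanSpace ℝ (Fin d)} (hn : n ≠ 0) (c : ℝ) :
    volume (hyperplane n c) = 0 := by
  have := Measure.addHaar_affineSubspace (volume : Measure (EuclideanSpace ℝ (Fin d)))
    (AffineSubspace.mk' ((c / ‖n‖ ^ 2) • n) (ℝ ∙ n)ᗮ) (by
      intro h
      have h2 : (ℝ ∙ n)ᗮ = ⊤ := by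
        rw [← AffineSubspace.direction_mk' ((c / ‖n‖ ^ 2) • n) (ℝ ∙ n)ᗮ, h,
          AffineSubspace.direction_top]
      have h3 : n ∈ (ℝ ∙ n)ᗮ := by rw [h2]; trivial
      rw [Submodule.mem_orthogonal_singleton_iff_inner_right] at h3
      exact hn (inner_self_eq_zero.1 h3))
  refine measure_mono_null ?_ this
  intro x hx
  have hn' : ‖n‖ ^ 2 ≠ 0 := by simpa using hn
  simp only [SetLike.mem_coe, AffineSubspace.mem_mk', vsub_eq_sub,
    Submodule.mem_orthogonal_singleton_iff_inner_right, inner_sub_right, inner_smul_right,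
    real_inner_self_eq_norm_sq]
  rw [hyperplane, Set.mem_ofPred_eq] at hx
  rw [hx]; field_simp; ring

/-- Two hyperplanes whose intersection is not negligible have parallel normals. -/
theorem surface_hyperplane_inter {n n' : EuclideanSpace ℝ (Fin d)} (hn : ‖n‖ = 1)
    (hn' : ‖n'‖ = 1) (h1 : n ≠ n') (h2 : n ≠ -n') (c c' : ℝ) :
    surface d (hyperplane n c ∩ hyperplane n' c') = 0 := by
  set a := inner ℝ n n' with ha
  -- `e` is the part of `n` orthogonal to `n'`. The second hyperplane is invariant under translation
  -- by `e`, so all its slices have the same surface measure; its volume is `0`, so this constant,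
  -- integrated over all of `ℝ`, must be `0`.
  set e := n - a • n' with he
  have hn'n' : inner ℝ n' n' = (1 : ℝ) := by rw [real_inner_self_eq_norm_sq, hn']; norm_num
  have hnn : inner ℝ n n = (1 : ℝ) := by rw [real_inner_self_eq_norm_sq, hn]; norm_num
  have hn'e : inner ℝ n' e = 0 := by
    rw [he, inner_sub_right, inner_smul_right, hn'n', real_inner_comm, ha]; ring
  have hne : inner ℝ n e ≠ 0 := by
    intro h0
    have hee : inner ℝ e e = 0 := by
      nth_rw 1 [he]
      rw [inner_sub_left, inner_smul_left, h0, hn'e]; simp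
    have he0 : n = a • n' := sub_eq_zero.1 (inner_self_eq_zero.1 hee)
    have ha1 : |a| = 1 := by
      have := congrArg norm he0
      rw [norm_smul, hn, hn', Real.norm_eq_abs, mul_one] at this
      exact this.symm
    rcases abs_eq (zero_le_one) |>.1 ha1 with h | h
    · exact h1 (by rw [he0, h, one_smul])
    · exact h2 (by rw [he0, h, neg_one_smul])
  have hs := volume_eq_lintegral_slice hn c hne (isClosed_hyperplane n' c').measurableSet
  rw [volume_hyperplane (by rintro rfl; simp at hn')] at hs
  have : ∀ r : ℝ, {y | y + r • e ∈ hyperplane n' c'} = hyperplane n' c' := by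
    intro r; ext y
    simp [hyperplane, inner_add_right, inner_smul_right, hn'e]
  simp only [this, lintegral_const, Real.volume_univ] at hs
  rcases mul_eq_zero.1 hs.symm with h | h
  · simp [hne] at h
  · rcases mul_eq_zero.1 h with h | h
    · exact h
    · simp at h

/-- The prism with base `A` spanned by the vector `e`. -/
def prism (A : Set (EuclideanSpace ℝ (Fin d))) (e : EuclideanSpace ℝ (Fin d)) :
    Set (EuclideanSpace ℝ (Fin d)) :=
  {x | ∃ y ∈ A, ∃ r ∈ Set.Icc (0 : ℝ) 1, y + r • e = x}

theorem isCompact_prism {A : Set (EuclideanSpace ℝ (Fin d))} (hA : IsCompact A)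
    (e : EuclideanSpace ℝ (Fin d)) : IsCompact (prism A e) := by
  have : prism A e = (fun p : EuclideanSpace ℝ (Fin d) × ℝ => p.1 + p.2 • e) ''
      (A ×ˢ Set.Icc (0 : ℝ) 1) := by
    ext x
    simp only [prism, Set.mem_ofPred_eq, Set.mem_image, Set.mem_prod, Prod.exists]
    constructor
    · rintro ⟨y, hy, r, hr, rfl⟩; exact ⟨y, r, ⟨hy, hr⟩, rfl⟩
    · rintro ⟨y, r, ⟨hy, hr⟩, rfl⟩; exact ⟨y, hy, r, hr, rfl⟩
  rw [this]
  exact (hA.prod isCompact_Icc).image (by fun_prop)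

/-- The volume on a prism in terms of the surface measure on its base. -/
theorem volume_restrict_prism {n : EuclideanSpace ℝ (Fin d)} (hn : ‖n‖ = 1) {c : ℝ}
    {e : EuclideanSpace ℝ (Fin d)} (he : inner ℝ n e ≠ 0)
    {A : Set (EuclideanSpace ℝ (Fin d))} (hA : IsCompact A) (hAH : A ⊆ hyperplane n c)
    (hAfin : surface d A ≠ ∞) :
    volume.restrict (prism A e) = ENNReal.ofReal |inner ℝ n e| •
      Measure.map (fun p : EuclideanSpace ℝ (Fin d) × ℝ => p.1 + p.2 • e)
        (((surface d).restrict A).prod (volume.restrict (Set.Icc (0 : ℝ) 1))) := by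
  have : IsFiniteMeasure ((surface d).restrict A) := ⟨by simpa using hAfin.lt_top⟩
  have hΦ : Measurable (fun p : EuclideanSpace ℝ (Fin d) × ℝ => p.1 + p.2 • e) := by fun_prop
  ext B hB
  rw [Measure.restrict_apply hB, Measure.smul_apply, Measure.map_apply hΦ hB,
    Measure.prod_apply_symm (hΦ hB), smul_eq_mul,
    volume_eq_lintegral_slice hn c he (hB.inter (isCompact_prism hA e).measurableSet),
    ← lintegral_indicator measurableSet_Icc]
  congr 1
  refine lintegral_congr fun r => ?_
  -- As `⟪n, e⟫ ≠ 0`, a point of the prism determines its height `r`, and hence its foot in `A`.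
  have hset : hyperplane n c ∩ {y | y + r • e ∈ B ∩ prism A e} =
      {y | r ∈ Set.Icc (0 : ℝ) 1 ∧ y ∈ A ∧ y + r • e ∈ B} := by
    ext y
    constructor
    · rintro ⟨hy, hyB, y', hy', r', hr', h⟩
      have h1 : inner ℝ n (y' + r' • e) = inner ℝ n (y + r • e) := by rw [h]
      simp only [inner_add_right, inner_smul_right] at h1
      rw [show inner ℝ n y' = c from hAH hy', show inner ℝ n y = c from hy] at h1
      have hr : r' = r := mul_right_cancel₀ he (by linarith)
      subst hr
      have : y' = y := by simpa using h
      subst this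
      exact ⟨hr', hy', hyB⟩
    · rintro ⟨hr, hy, hyB⟩
      exact ⟨hAH hy, hyB, y, hy, r, hr, rfl⟩
  rw [hset]
  by_cases hr : r ∈ Set.Icc (0 : ℝ) 1
  · rw [Set.indicator_of_mem hr, Measure.restrict_apply (by
      exact hB.preimage (by fun_prop))]
    congr 1
    ext y
    simp only [hr, true_and, Set.mem_ofPred_eq, Set.mem_inter_iff, Set.mem_preimage]
    tauto
  · rw [Set.indicator_of_notMem hr]
    simp [hr]

end Slicing

/-! ### The divergence theorem for polygonal sets -/

section Divergence

variable {d : ℕ}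

/-- Difference quotients of the translates of an integral converge to the integral of the
directional derivative. -/
theorem tendsto_integral_translate_sub {O : Set (EuclideanSpace ℝ (Fin d))}
    (hO : MeasurableSet O) (hOb : Bornology.IsBounded O) (e : EuclideanSpace ℝ (Fin d))
    {g : EuclideanSpace ℝ (Fin d) → ℝ} (hg : ContDiff ℝ 1 g) :
    Tendsto (fun t : ℝ => t⁻¹ * ∫ x, g x *
        (O.indicator (fun _ => (1 : ℝ)) (x - t • e) - O.indicator (fun _ => (1 : ℝ)) x))
      (𝓝[>] 0) (𝓝 (∫ x in O, fderiv ℝ g x e)) := by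
  have hgc : Continuous g := hg.continuous
  have hcomp : IsCompact (Metric.cthickening ‖e‖ (closure O)) :=
    (hOb.isCompact_closure).cthickening
  have hOfin : volume O ≠ ∞ := hOb.measure_lt_top.ne
  have hmem : ∀ x ∈ O, ∀ t : ℝ, |t| ≤ 1 → x + t • e ∈ Metric.cthickening ‖e‖ (closure O) := by
    intro x hx t ht
    refine Metric.mem_cthickening_of_dist_le _ x _ _ (subset_closure hx) ?_
    rw [dist_eq_norm, add_sub_cancel_left, norm_smul, Real.norm_eq_abs]
    exact mul_le_of_le_one_left (norm_nonneg _) ht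
  have hdc : Continuous (fun x => fderiv ℝ g x e) :=
    (hg.continuous_fderiv one_ne_zero).clm_apply continuous_const
  obtain ⟨M, hM⟩ := hcomp.exists_bound_of_continuousOn hdc.continuousOn
  obtain ⟨M', hM'⟩ := hcomp.exists_bound_of_continuousOn hgc.continuousOn
  have hint : ∀ t : ℝ, |t| ≤ 1 → IntegrableOn (fun x => g (x + t • e)) O := by
    intro t ht
    refine IntegrableOn.of_bound hOfin.lt_top (Continuous.aestronglyMeasurable (by fun_prop)) M' ?_
    exact (ae_restrict_iff' hO).2 (ae_of_all _ fun x hx => hM' _ (hmem x hx t ht))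
  have hder : HasDerivAt (fun t : ℝ => ∫ x in O, g (x + t • e))
      (∫ x in O, fderiv ℝ g (x + (0 : ℝ) • e) e) 0 := by
    refine (hasDerivAt_integral_of_dominated_loc_of_deriv_le (𝕜 := ℝ) (μ := volume.restrict O)
      (F := fun t x => g (x + t • e)) (F' := fun t x => fderiv ℝ g (x + t • e) e) (bound := fun _ => M)
      (Metric.ball_mem_nhds (0 : ℝ) one_pos) ?_ (hint 0 (by simp)) ?_ ?_ ?_ ?_).2
    · exact Eventually.of_forall fun t => Continuous.aestronglyMeasurable (by fun_prop)
    · exact (hdc.comp (by fun_prop)).aestronglyMeasurable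
    · refine (ae_restrict_iff' hO).2 (ae_of_all _ fun x hx t ht => hM _ (hmem x hx t ?_))
      simpa using (mem_ball_zero_iff.1 ht).le
    · exact integrableOn_const hOfin
    · refine ae_of_all _ fun x t _ => ?_
      have h1 : HasDerivAt (fun t : ℝ => x + t • e) e t := by
        simpa using ((hasDerivAt_id t).smul_const e).const_add x
      exact ((hg.differentiable one_ne_zero _).hasFDerivAt).comp_hasDerivAt t h1
  have hlim := hder.tendsto_slope_zero_right
  simp only [zero_smul, add_zero, zero_add, smul_eq_mul] at hlim
  refine hlim.congr' ?_
  have hsmall : Set.Ioo (0 : ℝ) 1 ∈ 𝓝[>] (0 : ℝ) := Ioo_mem_nhdsGT one_pos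
  filter_upwards [hsmall] with t ht
  congr 1
  have ht1 : |t| ≤ 1 := by rw [abs_of_pos ht.1]; exact ht.2.le
  -- Translation invariance moves the shift from `g` to the indicator function.
  have e1 : ∫ x in O, g (x + t • e) =
      ∫ x, g x * O.indicator (fun _ => (1 : ℝ)) (x - t • e) := by
    rw [← integral_add_right_eq_self
      (fun x => g x * O.indicator (fun _ => (1 : ℝ)) (x - t • e)) (t • e), ← integral_indicator hO]
    congr 1; ext x
    by_cases hx : x ∈ O <;> simp [hx]
  have e2 : ∫ x in O, g x = ∫ x, g x * O.indicator (fun _ => (1 : ℝ)) x := by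
    rw [← integral_indicator hO]
    congr 1; ext x
    by_cases hx : x ∈ O <;> simp [hx]
  have i1 : Integrable (fun x => g x * O.indicator (fun _ => (1 : ℝ)) (x - t • e)) := by
    have : Integrable (fun x => O.indicator (fun x => g (x + t • e)) (x - t • e)) :=
      ((integrable_indicator_iff hO).2 (hint t ht1)).comp_sub_right (t • e)
    refine this.congr (ae_of_all _ fun x => ?_)
    by_cases hx : x - t • e ∈ O <;> simp [hx]
  have i2 : Integrable (fun x => g x * O.indicator (fun _ => (1 : ℝ)) x) := by
    have : Integrable (O.indicator (fun x => g (x + (0 : ℝ) • e))) :=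
      (integrable_indicator_iff hO).2 (hint 0 (by simp))
    refine this.congr (ae_of_all _ fun x => ?_)
    by_cases hx : x ∈ O <;> simp [hx]
  rw [e1, e2, ← integral_sub i1 i2]
  simp only [mul_sub]

/-- Off the frontier, the space is the disjoint union of two open sets, the interior and the
exterior. -/
theorem _root_.IsPreconnected.subset_interior_or_subset_compl_closure {X : Type*}
    [TopologicalSpace X] {s O : Set X} (hs : IsPreconnected s) (h : Disjoint s (frontier O)) :
    s ⊆ interior O ∨ s ⊆ (closure O)ᶜ := by
  refine hs.subset_or_subset isOpen_interior isClosed_closure.isOpen_compl ?_ ?_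
  · exact Set.disjoint_compl_right_iff_subset.2 (interior_subset.trans subset_closure)
  · intro x hx
    by_contra hcon
    simp only [Set.mem_union, Set.mem_compl_iff, not_or, not_not] at hcon
    exact Set.disjoint_left.1 h hx ⟨hcon.2, hcon.1⟩

/-- If the indicator function of `O` changes between the end points of a segment, then the segment
meets the frontier. -/
theorem exists_mem_prism {κ : Type*} {O Fr : Set (EuclideanSpace ℝ (Fin d))}
    (hfr : frontier O ⊆ Fr) {H : κ → Set (EuclideanSpace ℝ (Fin d))} (hFr : Fr ⊆ ⋃ i, H i)
    {e x : EuclideanSpace ℝ (Fin d)}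
    (hx : O.indicator (fun _ => (1 : ℝ)) (x - e) - O.indicator (fun _ => (1 : ℝ)) x ≠ 0) :
    ∃ i, x ∈ prism (Fr ∩ H i) e := by
  have hconn : IsPreconnected (segment ℝ (x - e) x) := (convex_segment _ _).isPreconnected
  have hmeet : (segment ℝ (x - e) x ∩ frontier O).Nonempty := by
    rw [← Set.not_disjoint_iff_nonempty_inter]
    intro hdisj
    rcases hconn.subset_interior_or_subset_compl_closure hdisj with h | h
    · have h1 := interior_subset (h (left_mem_segment ℝ _ _))
      have h2 := interior_subset (h (right_mem_segment ℝ _ _))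
      simp [h1, h2] at hx
    · have h1 : x - e ∉ O := fun h' => h (left_mem_segment ℝ _ _) (subset_closure h')
      have h2 : x ∉ O := fun h' => h (right_mem_segment ℝ _ _) (subset_closure h')
      simp [h1, h2] at hx
  obtain ⟨y, ⟨a, b, ha, hb, hab, rfl⟩, hy⟩ := hmeet
  obtain ⟨i, hi⟩ := Set.mem_iUnion.1 (hFr (hfr hy))
  refine ⟨i, _, ⟨hfr hy, hi⟩, a, ⟨ha, by linarith⟩, ?_⟩
  have : b = 1 - a := by linarith
  subst this
  module

/-- The divergence theorem in a fixed direction `e`, for a bounded set `O` whose frontier lies in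
finitely many hyperplanes. On the frontier, `J` is the jump of the indicator function of `O` in
direction `e`, times the cosine of the angle with the normal. -/
theorem integral_fderiv_eq_integral_jump {κ : Type*} [Fintype κ]
    {n : κ → EuclideanSpace ℝ (Fin d)} {c : κ → ℝ} (hn : ∀ i, ‖n i‖ = 1)
    (hdist : ∀ i j, i ≠ j → surface d (hyperplane (n i) (c i) ∩ hyperplane (n j) (c j)) = 0)
    {O Fr : Set (EuclideanSpace ℝ (Fin d))} (hO : MeasurableSet O)
    (hOb : Bornology.IsBounded O) (hFrc : IsCompact Fr) (hfr : frontier O ⊆ Fr)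
    (hFr : Fr ⊆ ⋃ i, hyperplane (n i) (c i)) (hfin : surface d Fr ≠ ∞)
    (e : EuclideanSpace ℝ (Fin d)) (J : EuclideanSpace ℝ (Fin d) → ℝ)
    (hJ0 : ∀ i, inner ℝ (n i) e = 0 →
      ∀ᵐ y ∂(surface d).restrict (Fr ∩ hyperplane (n i) (c i)), J y = 0)
    (hJ : ∀ i, inner ℝ (n i) e ≠ 0 →
      ∀ᵐ y ∂(surface d).restrict (Fr ∩ hyperplane (n i) (c i)), ∃ a b : ℝ,
        (∀ᶠ ε in 𝓝[>] (0 : ℝ), O.indicator (fun _ => (1 : ℝ)) (y - ε • e) = a ∧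
          O.indicator (fun _ => (1 : ℝ)) (y + ε • e) = b) ∧
        |inner ℝ (n i) e| * (a - b) = J y)
    {g : EuclideanSpace ℝ (Fin d) → ℝ} (hg : ContDiff ℝ 1 g)
    (hgJ : IntegrableOn (fun y => g y * J y) Fr (surface d)) :
    ∫ x in O, fderiv ℝ g x e = ∫ y in Fr, g y * J y ∂(surface d) := by
  classical
  have hgc : Continuous g := hg.continuous
  set A : κ → Set (EuclideanSpace ℝ (Fin d)) := fun i => Fr ∩ hyperplane (n i) (c i) with hA
  have hAc : ∀ i, IsCompact (A i) := fun i => hFrc.inter_right (isClosed_hyperplane _ _)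
  have hAfin : ∀ i, surface d (A i) ≠ ∞ := fun i =>
    ((measure_mono Set.inter_subset_left).trans_lt hfin.lt_top).ne
  have hAfin' : ∀ i, IsFiniteMeasure ((surface d).restrict (A i)) := fun i =>
    ⟨by simpa using (hAfin i).lt_top⟩
  set one : EuclideanSpace ℝ (Fin d) → ℝ := O.indicator (fun _ => (1 : ℝ)) with hone
  have hone_meas : Measurable one := measurable_const.indicator hO
  set W : ℝ → EuclideanSpace ℝ (Fin d) → ℝ := fun t x => one (x - t • e) - one x with hW
  have hW_le : ∀ t x, |W t x| ≤ 1 := by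
    intro t x
    by_cases h1 : x - t • e ∈ O <;> by_cases h2 : x ∈ O <;> simp [hW, hone, h1, h2]
  -- Prisms over different hyperplanes may overlap. Dividing by the number of prisms through `x`
  -- shares the integrand equally among them, so that the sum over prisms is exact for every `t`.
  set cnt : ℝ → EuclideanSpace ℝ (Fin d) → ℝ := fun t x =>
    ∑ i, (prism (A i) (t • e)).indicator (fun _ => (1 : ℝ)) x with hcnt
  set Q : ℝ → EuclideanSpace ℝ (Fin d) → ℝ := fun t x => g x * (W t x / cnt t x) with hQ
  have hcnt_meas : ∀ t, Measurable (cnt t) := fun t => Finset.measurable_sum _ fun i _ =>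
    measurable_const.indicator (isCompact_prism (hAc i) _).measurableSet
  have hQ_meas : ∀ t, Measurable (Q t) := fun t =>
    hgc.measurable.mul (((hone_meas.comp (by fun_prop)).sub hone_meas).div (hcnt_meas t))
  have hcnt_ge : ∀ t i x, x ∈ prism (A i) (t • e) → 1 ≤ cnt t x := by
    intro t i x hx
    have := Finset.single_le_sum (f := fun i =>
      (prism (A i) (t • e)).indicator (fun _ => (1 : ℝ)) x)
      (fun j _ => Set.indicator_nonneg (fun _ _ => zero_le_one) x) (Finset.mem_univ i)
    simpa [hx] using this
  have hQ_le : ∀ t i x, x ∈ prism (A i) (t • e) → |Q t x| ≤ |g x| := by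
    intro t i x hx
    have h1 := hcnt_ge t i x hx
    rw [hQ, abs_mul, abs_div, abs_of_pos (by linarith : 0 < cnt t x)]
    refine mul_le_of_le_one_right (abs_nonneg _) ?_
    rw [div_le_one (by linarith)]
    exact (hW_le t x).trans h1
  have hsplit : ∀ t x, g x * W t x =
      ∑ i, (prism (A i) (t • e)).indicator (Q t) x := by
    intro t x
    have h1 : ∀ i, (prism (A i) (t • e)).indicator (Q t) x =
        Q t x * (prism (A i) (t • e)).indicator (fun _ => (1 : ℝ)) x := by
      intro i
      by_cases hx : x ∈ prism (A i) (t • e) <;> simp [hx]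
    simp_rw [h1]
    rw [← Finset.mul_sum]
    change _ = g x * (W t x / cnt t x) * cnt t x
    by_cases hw : W t x = 0
    · simp [hw]
    · obtain ⟨i, hi⟩ := exists_mem_prism hfr hFr hw
      have := hcnt_ge t i x hi
      have : cnt t x ≠ 0 := by linarith
      field_simp
  have hQ_int : ∀ t i, IntegrableOn (Q t) (prism (A i) (t • e)) := by
    intro t i
    have hc := isCompact_prism (hAc i) (t • e)
    refine Integrable.mono (hgc.continuousOn.integrableOn_compact hc)
      (hQ_meas t).aestronglyMeasurable ?_
    exact (ae_restrict_iff' hc.measurableSet).2 (ae_of_all _ fun x hx => by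
      simpa using hQ_le t i x hx)
  have hsum : ∀ t, ∫ x, g x * W t x = ∑ i, ∫ x in prism (A i) (t • e), Q t x := by
    intro t
    simp_rw [hsplit t]
    rw [integral_finsetSum _ fun i _ =>
      (integrable_indicator_iff (isCompact_prism (hAc i) _).measurableSet).2 (hQ_int t i)]
    exact Finset.sum_congr rfl fun i _ =>
      integral_indicator (isCompact_prism (hAc i) _).measurableSet
  -- the contribution of each hyperplane
  have hterm : ∀ i, Tendsto (fun t : ℝ => t⁻¹ * ∫ x in prism (A i) (t • e), Q t x) (𝓝[>] 0)
      (𝓝 (∫ y in A i, g y * J y ∂(surface d))) := by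
    intro i
    by_cases hie : inner ℝ (n i) e = 0
    · have hz : ∫ y in A i, g y * J y ∂(surface d) = 0 := by
        refine integral_eq_zero_of_ae ?_
        filter_upwards [hJ0 i hie] with y hy
        simp [hy]
      rw [hz]
      refine tendsto_const_nhds.congr fun t => ?_
      -- A direction parallel to the hyperplane keeps the prism inside it.
      have hnull : volume (prism (A i) (t • e)) = 0 := by
        refine measure_mono_null ?_ (volume_hyperplane (n := n i) (c := c i) (by
          intro h0; have := hn i; simp [h0] at this))
        rintro x ⟨y, hy, r, -, rfl⟩
        have : inner ℝ (n i) y = c i := hy.2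
        simp [hyperplane, inner_add_right, inner_smul_right, hie, this]
      rw [Measure.restrict_eq_zero.2 hnull]
      simp
    · set μ := ((surface d).restrict (A i)).prod (volume.restrict (Set.Icc (0 : ℝ) 1)) with hμ
      -- In the coordinates (foot, relative height) the prism has Jacobian `t |⟪n i, e⟫|`, whose `t`
      -- cancels the difference quotient. The domain of integration no longer depends on `t`.
      have hchange : ∀ t : ℝ, 0 < t → t⁻¹ * ∫ x in prism (A i) (t • e), Q t x =
          ∫ p, |inner ℝ (n i) e| * Q t (p.1 + p.2 • t • e) ∂μ := by
        intro t ht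
        have hte : inner ℝ (n i) (t • e) ≠ 0 := by
          rw [inner_smul_right]; exact mul_ne_zero ht.ne' hie
        rw [volume_restrict_prism (hn i) hte (hAc i) Set.inter_subset_right (hAfin i),
          integral_smul_measure, integral_map (by fun_prop)
            (hQ_meas t).aestronglyMeasurable, integral_const_mul,
          ENNReal.toReal_ofReal (abs_nonneg _), smul_eq_mul, inner_smul_right, abs_mul,
          abs_of_pos ht, ← hμ]
        field_simp
      have hrhs : ∫ y in A i, g y * J y ∂(surface d) =
          ∫ p : EuclideanSpace ℝ (Fin d) × ℝ, g p.1 * J p.1 ∂μ := by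
        rw [hμ, integral_fun_fst (fun y => g y * J y)]
        simp
      rw [hrhs]
      have hcomp : IsCompact (Metric.cthickening ‖e‖ Fr) := hFrc.cthickening
      obtain ⟨M, hM⟩ := hcomp.exists_bound_of_continuousOn hgc.continuousOn
      have hsmall : Set.Ioo (0 : ℝ) 1 ∈ 𝓝[>] (0 : ℝ) := Ioo_mem_nhdsGT one_pos
      have hlim : Tendsto (fun t : ℝ => ∫ p, |inner ℝ (n i) e| * Q t (p.1 + p.2 • t • e) ∂μ)
          (𝓝[>] 0) (𝓝 (∫ p : EuclideanSpace ℝ (Fin d) × ℝ, g p.1 * J p.1 ∂μ)) := by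
        refine tendsto_integral_filter_of_dominated_convergence
          (fun _ => |inner ℝ (n i) e| * M) ?_ ?_ (integrable_const _) ?_
        · exact Eventually.of_forall fun t =>
            (((hQ_meas t).comp (by fun_prop)).const_mul _).aestronglyMeasurable
        · filter_upwards [hsmall] with t ht
          filter_upwards [Measure.quasiMeasurePreserving_fst.ae
              (ae_restrict_mem (hAc i).measurableSet),
            Measure.quasiMeasurePreserving_snd.ae (ae_restrict_mem measurableSet_Icc)]
          rintro ⟨y, r⟩ hy hr
          dsimp only at hy hr
          rw [Real.norm_eq_abs, abs_mul, abs_abs]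
          refine mul_le_mul_of_nonneg_left ?_ (abs_nonneg _)
          refine (hQ_le t i _ ⟨y, hy, r, hr, rfl⟩).trans (hM _ ?_)
          refine Metric.mem_cthickening_of_dist_le _ y _ _ hy.1 ?_
          rw [dist_eq_norm, add_sub_cancel_left, norm_smul, norm_smul, Real.norm_eq_abs,
            Real.norm_eq_abs, ← mul_assoc]
          refine mul_le_of_le_one_left (norm_nonneg _) ?_
          rw [abs_of_nonneg hr.1, abs_of_pos ht.1]
          exact mul_le_one₀ hr.2 ht.1.le ht.2.le
        -- Almost every foot lies on no other hyperplane, so the prisms over the others are out of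
        -- reach for small `t`.
        · have hgood : ∀ᵐ y ∂(surface d).restrict (A i), (∃ a b : ℝ,
              (∀ᶠ ε in 𝓝[>] (0 : ℝ), one (y - ε • e) = a ∧ one (y + ε • e) = b) ∧
              |inner ℝ (n i) e| * (a - b) = J y) ∧ y ∈ A i ∧
              ∀ j, j ≠ i → y ∉ hyperplane (n j) (c j) := by
            refine (hJ i hie).and ((ae_restrict_mem (hAc i).measurableSet).and ?_)
            rw [ae_all_iff]
            intro j
            by_cases hji : j = i
            · exact ae_of_all _ fun y h => absurd hji h
            · rw [ae_restrict_iff' (hAc i).measurableSet]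
              refine measure_mono_null ?_ (hdist i j (Ne.symm hji))
              intro y hy
              simp only [Set.mem_compl_iff, Set.mem_ofPred_eq, not_forall, not_not] at hy
              obtain ⟨h1, -, h3⟩ := hy
              exact ⟨h1.2, h3⟩
          have hgood' : ∀ᵐ p ∂μ, ((∃ a b : ℝ,
              (∀ᶠ ε in 𝓝[>] (0 : ℝ), one (p.1 - ε • e) = a ∧ one (p.1 + ε • e) = b) ∧
              |inner ℝ (n i) e| * (a - b) = J p.1) ∧ p.1 ∈ A i ∧
              ∀ j, j ≠ i → p.1 ∉ hyperplane (n j) (c j)) ∧ p.2 ∈ Set.Ioo (0 : ℝ) 1 := by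
            have hr : ∀ᵐ r ∂(volume.restrict (Set.Icc (0 : ℝ) 1)), r ∈ Set.Ioo (0 : ℝ) 1 := by
              rw [← restrict_Ioo_eq_restrict_Icc]
              exact ae_restrict_mem measurableSet_Ioo
            exact (Measure.quasiMeasurePreserving_fst.ae hgood).and
              (Measure.quasiMeasurePreserving_snd.ae hr)
          filter_upwards [hgood'] with p hp
          obtain ⟨y, r⟩ := p
          obtain ⟨⟨⟨a, b, hab, habJ⟩, hyA, hyj⟩, hr⟩ := hp
          dsimp only at *
          have hscale : ∀ q : ℝ, 0 < q → Tendsto (fun t : ℝ => q * t) (𝓝[>] 0) (𝓝[>] 0) := by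
            intro q hq
            refine tendsto_nhdsWithin_iff.2 ⟨?_, ?_⟩
            · have : Tendsto (fun t : ℝ => q * t) (𝓝 0) (𝓝 (q * 0)) :=
                (continuous_const.mul continuous_id).tendsto 0
              rw [mul_zero] at this
              exact this.mono_left nhdsWithin_le_nhds
            · filter_upwards [self_mem_nhdsWithin] with t ht using mul_pos hq ht
          have hcnt1 : ∀ j, j ≠ i → ∀ᶠ t in 𝓝[>] (0 : ℝ),
              y + r • t • e ∉ prism (A j) (t • e) := by
            intro j hj
            -- `A j` is closed, so a ball around `y` avoids it, while any foot `y'` in `A j` of a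
            -- prism through the point would be within `t ‖e‖` of `y`.
            have hyAj : y ∈ (A j)ᶜ := fun h => hyj j hj h.2
            obtain ⟨δ, hδ, hball⟩ := Metric.isOpen_iff.1 (hAc j).isClosed.isOpen_compl y hyAj
            have h0 : Tendsto (fun t : ℝ => t * ‖e‖) (𝓝[>] 0) (𝓝 0) := by
              have : Tendsto (fun t : ℝ => t * ‖e‖) (𝓝 0) (𝓝 (0 * ‖e‖)) :=
                (continuous_id.mul continuous_const).tendsto 0
              rw [zero_mul] at this
              exact this.mono_left nhdsWithin_le_nhds
            filter_upwards [h0.eventually (gt_mem_nhds hδ), self_mem_nhdsWithin] with t ht ht0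
            rintro ⟨y', hy', r', hr', h⟩
            refine (hball (a := y') ?_) hy'
            have : y' - y = ((r - r') * t) • e := by
              have : y' - y = r • t • e - r' • t • e := by
                rw [sub_eq_sub_iff_add_eq_add, h, add_comm]
              rw [this, smul_smul, smul_smul, ← sub_smul, sub_mul]
            rw [Metric.mem_ball, dist_eq_norm, this, norm_smul, Real.norm_eq_abs, abs_mul,
              abs_of_pos (show 0 < t from ht0)]
            refine lt_of_le_of_lt ?_ ht
            refine mul_le_mul_of_nonneg_right ?_ (norm_nonneg _)
            refine mul_le_of_le_one_left (le_of_lt ht0) ?_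
            rw [abs_le]
            constructor <;> linarith [hr.1, hr.2, hr'.1, hr'.2]
          have hcnt2 : ∀ᶠ t in 𝓝[>] (0 : ℝ), ∀ j, j ≠ i →
              y + r • t • e ∉ prism (A j) (t • e) := by
            rw [eventually_all]
            intro j
            by_cases hj : j = i
            · exact Eventually.of_forall fun t h => absurd hj h
            · filter_upwards [hcnt1 j hj] with t ht _ using ht
          have hgt : Tendsto (fun t : ℝ => |inner ℝ (n i) e| * (g (y + r • t • e) * (a - b)))
              (𝓝[>] 0) (𝓝 (|inner ℝ (n i) e| * (g (y + r • (0 : ℝ) • e) * (a - b)))) := by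
            have : Continuous (fun t : ℝ =>
                |inner ℝ (n i) e| * (g (y + r • t • e) * (a - b))) := by fun_prop
            exact (this.tendsto 0).mono_left nhdsWithin_le_nhds
          have hval : |inner ℝ (n i) e| * (g (y + r • (0 : ℝ) • e) * (a - b)) = g y * J y := by
            rw [← habJ]; simp; ring
          rw [hval] at hgt
          refine hgt.congr' ?_
          filter_upwards [(hscale r hr.1).eventually hab,
            (hscale (1 - r) (by linarith [hr.2])).eventually hab, hcnt2] with t h1 h2 h3
          -- As `0 < r < 1`, the translated point `y - ((1 - r) t) • e` and the point `y + (r t) •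
          -- e` lie on opposite sides of `y`; the indicator takes its one-sided values `a` and `b`
          -- there.
          have hx1 : one (y + r • t • e - t • e) = a := by
            rw [← h2.1]; congr 1; module
          have hx2 : one (y + r • t • e) = b := by
            rw [← h1.2]; congr 1; module
          have hx3 : cnt t (y + r • t • e) = 1 := by
            rw [hcnt]
            dsimp only
            rw [Finset.sum_eq_single i]
            · rw [Set.indicator_of_mem]
              exact ⟨y, hyA, r, ⟨hr.1.le, hr.2.le⟩, rfl⟩
            · intro j _ hj
              rw [Set.indicator_of_notMem (h3 j hj)]
            · simp
          simp only [hQ, hW, hx1, hx2, hx3, div_one]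
      refine hlim.congr' ?_
      filter_upwards [self_mem_nhdsWithin] with t ht
      exact (hchange t ht).symm
  have hlim1 := tendsto_integral_translate_sub hO hOb e hg
  have hlim2 : Tendsto (fun t : ℝ => t⁻¹ * ∫ x, g x * W t x) (𝓝[>] 0)
      (𝓝 (∑ i, ∫ y in A i, g y * J y ∂(surface d))) := by
    simp_rw [hsum, Finset.mul_sum]
    exact tendsto_finsetSum _ fun i _ => hterm i
  rw [tendsto_nhds_unique hlim1 hlim2]
  have hunion : Fr = ⋃ i, A i := by
    rw [hA, ← Set.inter_iUnion]
    exact (Set.inter_eq_left.2 hFr).symm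
  have hae : Pairwise (Function.onFun (AEDisjoint (surface d)) A) := by
    intro i j hij
    refine measure_mono_null ?_ (hdist i j hij)
    intro x hx
    exact ⟨hx.1.2, hx.2.2⟩
  rw [hunion, integral_iUnion_ae (fun i => (hAc i).measurableSet.nullMeasurableSet) hae
    (by rwa [← hunion]), tsum_fintype]

end Divergence

/-! ### Geometry of admissible meshes -/

section Mesh

variable {d : ℕ}

/-- The hyperplanes are indexed as sets, which identifies proportional equations. Two different ones
are then either parallel, hence disjoint, or transversal, hence with negligible intersection. -/
theorem IsPolygonal.exists_hyperplanes {K : Set (EuclideanSpace ℝ (Fin d))}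
    (hK : IsPolygonal K) :
    ∃ (κ : Type) (_ : Fintype κ) (n : κ → EuclideanSpace ℝ (Fin d)) (c : κ → ℝ),
      (∀ i, ‖n i‖ = 1) ∧
      (∀ i j, i ≠ j → surface d (hyperplane (n i) (c i) ∩ hyperplane (n j) (c j)) = 0) ∧
      frontier K ⊆ ⋃ i, hyperplane (n i) (c i) := by
  classical
  obtain ⟨-, S, hS, hfr⟩ := hK
  let HS : Finset (Set (EuclideanSpace ℝ (Fin d))) := S.image fun p => hyperplane p.1 p.2
  have hch : ∀ H : HS, ∃ q : EuclideanSpace ℝ (Fin d) × ℝ, ‖q.1‖ = 1 ∧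
      hyperplane q.1 q.2 = (H : Set (EuclideanSpace ℝ (Fin d))) := by
    rintro ⟨H, hH⟩
    obtain ⟨p, hp, rfl⟩ := Finset.mem_image.1 hH
    have hp0 : ‖p.1‖ ≠ 0 := norm_ne_zero_iff.2 (hS p hp)
    refine ⟨(‖p.1‖⁻¹ • p.1, ‖p.1‖⁻¹ * p.2), ?_, ?_⟩
    · rw [norm_smul, norm_inv, norm_norm, inv_mul_cancel₀ hp0]
    · ext x
      simp only [hyperplane, Set.mem_ofPred_eq, real_inner_smul_left]
      constructor
      · intro h; exact mul_left_cancel₀ (inv_ne_zero hp0) h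
      · intro h; rw [h]
  choose q hq1 hq2 using hch
  refine ⟨HS, inferInstance, fun i => (q i).1, fun i => (q i).2, hq1, ?_, ?_⟩
  · intro i j hij
    by_cases h1 : (q i).1 = (q j).1
    · have : hyperplane (q i).1 (q i).2 ∩ hyperplane (q j).1 (q j).2 = ∅ := by
        ext x
        simp only [Set.mem_inter_iff, Set.mem_empty_iff_false, iff_false, not_and]
        intro hx hx'
        refine hij (Subtype.ext ?_)
        rw [← hq2 i, ← hq2 j, h1]
        rw [h1] at hx
        rw [show (q i).2 = (q j).2 from hx.symm.trans hx']
      rw [this, measure_empty]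
    by_cases h2 : (q i).1 = -(q j).1
    · have : hyperplane (q i).1 (q i).2 ∩ hyperplane (q j).1 (q j).2 = ∅ := by
        ext x
        simp only [Set.mem_inter_iff, Set.mem_empty_iff_false, iff_false, not_and]
        intro hx hx'
        refine hij (Subtype.ext ?_)
        rw [← hq2 i, ← hq2 j, h2]
        have hc : (q i).2 = -(q j).2 := by
          rw [h2] at hx
          simp only [hyperplane, Set.mem_ofPred_eq, inner_neg_left] at hx hx'
          linarith
        ext z
        simp only [hyperplane, Set.mem_ofPred_eq, inner_neg_left, hc, neg_inj]
      rw [this, measure_empty]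
    exact surface_hyperplane_inter (hq1 i) (hq1 j) h1 h2 _ _
  · intro x hx
    obtain ⟨p, hp⟩ := Set.mem_iUnion.1 (hfr hx)
    obtain ⟨hpS, hpx⟩ := Set.mem_iUnion.1 hp
    refine Set.mem_iUnion.2 ⟨⟨hyperplane p.1 p.2, Finset.mem_image_of_mem _ hpS⟩, ?_⟩
    rw [hq2]
    exact hpx

theorem interface_comm (K L : Set (EuclideanSpace ℝ (Fin d))) : interface K L = interface L K :=
  Set.inter_comm _ _

theorem isClosed_interface (K L : Set (EuclideanSpace ℝ (Fin d))) : IsClosed (interface K L) :=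
  isClosed_closure.inter isClosed_closure

namespace AdmissibleMesh

variable {ι : Type*} (𝒯 : AdmissibleMesh d ι)

theorem ediam_le (K : ι) : Metric.ediam (𝒯.cell K) ≤ ENNReal.ofReal 𝒯.size := by
  rw [size, ENNReal.ofReal_toReal 𝒯.size_finite]
  exact le_iSup (fun K => Metric.ediam (𝒯.cell K)) K

theorem isBounded_cell (K : ι) : Bornology.IsBounded (𝒯.cell K) :=
  Metric.isBounded_iff_ediam_ne_top.2 ((𝒯.ediam_le K).trans_lt ENNReal.ofReal_lt_top).ne

theorem isCompact_closure_cell (K : ι) : IsCompact (closure (𝒯.cell K)) :=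
  (𝒯.isBounded_cell K).isCompact_closure

theorem isCompact_frontier_cell (K : ι) : IsCompact (frontier (𝒯.cell K)) :=
  (𝒯.isCompact_closure_cell K).of_isClosed_subset isClosed_frontier frontier_subset_closure

theorem surface_frontier_ne_top (K : ι) : surface d (frontier (𝒯.cell K)) ≠ ∞ :=
  ((𝒯.boundary_le K).trans_lt ENNReal.ofReal_lt_top).ne

theorem interior_cell_nonempty (K : ι) : (interior (𝒯.cell K)).Nonempty := by
  obtain ⟨x, hx⟩ := (𝒯.connected K).nonempty
  exact closure_nonempty_iff.1 ⟨x, (𝒯.polygonal K).1 hx⟩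

theorem volume_frontier_cell (K : ι) : volume (frontier (𝒯.cell K)) = 0 := by
  obtain ⟨κ, _, n, c, hn, -, hfr⟩ := (𝒯.polygonal K).exists_hyperplanes
  refine measure_mono_null hfr ((measure_iUnion_null_iff).2 fun i => volume_hyperplane ?_ _)
  intro h0
  have := hn i
  simp [h0] at this

theorem interior_cell_ae_eq (K : ι) :
    (interior (𝒯.cell K) : Set (EuclideanSpace ℝ (Fin d))) =ᵐ[volume] 𝒯.cell K :=
  interior_ae_eq_of_null_frontier (𝒯.volume_frontier_cell K)

/-- A cell may contain an arbitrary part of its boundary, so it need not be Borel; but the boundary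
is null. -/
theorem nullMeasurableSet_cell (K : ι) : NullMeasurableSet (𝒯.cell K) :=
  isOpen_interior.measurableSet.nullMeasurableSet.congr (𝒯.interior_cell_ae_eq K)

theorem volume_cell_ne_top (K : ι) : volume (𝒯.cell K) ≠ ∞ :=
  (𝒯.isBounded_cell K).measure_lt_top.ne

theorem vol_pos (K : ι) : 0 < 𝒯.vol K := by
  refine ENNReal.toReal_pos ?_ (𝒯.volume_cell_ne_top K)
  rw [← measure_congr (𝒯.interior_cell_ae_eq K)]
  exact (isOpen_interior.measure_pos _ (𝒯.interior_cell_nonempty K)).ne'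

theorem size_pos (hd : 1 ≤ d) (K : ι) : 0 < 𝒯.size := by
  have : Nonempty (Fin d) := ⟨⟨0, hd⟩⟩
  have hpos : 0 < Metric.ediam (𝒯.cell K) := by
    rw [pos_iff_ne_zero, Ne, Metric.ediam_eq_zero_iff]
    intro hsub
    have hvol := (isOpen_interior.measure_pos volume (𝒯.interior_cell_nonempty K))
    have h0 : volume (interior (𝒯.cell K)) = 0 :=
      (hsub.anti interior_subset).measure_zero volume
    exact hvol.ne' h0
  exact ENNReal.ofReal_pos.1 (hpos.trans_le (𝒯.ediam_le K))

theorem pairwise_disjoint_interior :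
    Pairwise (Function.onFun Disjoint fun K => interior (𝒯.cell K)) :=
  fun _ _ h => (𝒯.disjoint h).mono interior_subset interior_subset

/-- Cells that reach the ball lie in the ball enlarged by `h`, and disjoint sets of volume at least
`α h^d` fit there only finitely often. Local finiteness and countability of the mesh rest on this.
-/
theorem finite_inter_ball (hd : 1 ≤ d) (x : EuclideanSpace ℝ (Fin d)) (r : ℝ) :
    {K | (closure (𝒯.cell K) ∩ Metric.ball x r).Nonempty}.Finite := by
  rcases isEmpty_or_nonempty ι with h | ⟨⟨K₀⟩⟩
  · exact Set.toFinite _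
  set B := Metric.ball x (r + 𝒯.size)
  have hsub : ∀ K, (closure (𝒯.cell K) ∩ Metric.ball x r).Nonempty → 𝒯.cell K ⊆ B := by
    rintro K ⟨y, hy, hyr⟩ z hz
    have h1 : edist z y ≤ ENNReal.ofReal 𝒯.size := by
      refine (Metric.edist_le_ediam_of_mem (subset_closure hz) hy).trans ?_
      rw [Metric.ediam_closure]
      exact 𝒯.ediam_le K
    rw [edist_dist, ENNReal.ofReal_le_ofReal_iff (𝒯.size_pos hd K₀).le] at h1
    rw [Metric.mem_ball] at hyr ⊢
    linarith [dist_triangle z y x]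
  have hfin := Measure.finite_const_le_meas_of_disjoint_iUnion
    (volume.restrict B) (As := fun K => interior (𝒯.cell K))
    (ε := ENNReal.ofReal (𝒯.α * 𝒯.size ^ d))
    (ENNReal.ofReal_pos.2 (mul_pos 𝒯.α_pos (pow_pos (𝒯.size_pos hd K₀) _)))
    (fun K => isOpen_interior.measurableSet) 𝒯.pairwise_disjoint_interior
    ((measure_mono (Set.subset_univ _)).trans_lt (by
      simpa using Metric.isBounded_ball.measure_lt_top)).ne
  refine hfin.subset fun K hK => ?_
  rw [Set.mem_ofPred_eq, Measure.restrict_apply isOpen_interior.measurableSet,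
    Set.inter_eq_left.2 (interior_subset.trans (hsub K hK)),
    measure_congr (𝒯.interior_cell_ae_eq K)]
  exact 𝒯.volume_ge K

theorem locallyFinite_closure_cell (hd : 1 ≤ d) :
    LocallyFinite fun K => closure (𝒯.cell K) := fun x =>
  ⟨Metric.ball x 1, Metric.ball_mem_nhds x one_pos, 𝒯.finite_inter_ball hd x 1⟩

theorem countable_index (𝒯 : AdmissibleMesh d ι) (hd : 1 ≤ d) : Countable ι := by
  rw [← Set.countable_univ_iff]
  exact (𝒯.locallyFinite_closure_cell hd).countable_univ fun K =>
    (𝒯.connected K).nonempty.closure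

theorem mem_neighbors_symm {K L : ι} (h : L ∈ 𝒯.neighbors K) : K ∈ 𝒯.neighbors L :=
  ⟨h.1.symm, by rw [interface_comm]; exact h.2⟩

theorem finite_neighbors (hd : 1 ≤ d) (K : ι) : (𝒯.neighbors K).Finite := by
  obtain ⟨x, r, hr⟩ : ∃ x : EuclideanSpace ℝ (Fin d), ∃ r,
      closure (𝒯.cell K) ⊆ Metric.ball x r := by
    obtain ⟨r, hr⟩ := (𝒯.isCompact_closure_cell K).isBounded.subset_ball 0
    exact ⟨0, r, hr⟩
  refine (𝒯.finite_inter_ball hd x r).subset fun L hL => ?_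
  obtain ⟨y, hy⟩ := nonempty_of_measure_ne_zero hL.2.ne'
  exact ⟨y, hy.2, hr hy.1⟩

theorem interface_subset_frontier {K L : ι} (h : L ≠ K) :
    interface (𝒯.cell K) (𝒯.cell L) ⊆ frontier (𝒯.cell K) := by
  rintro x ⟨hK, hL⟩
  refine ⟨hK, fun hi => ?_⟩
  obtain ⟨y, hy, hyL⟩ := mem_closure_iff.1 hL _ isOpen_interior hi
  exact Set.disjoint_left.1 (𝒯.disjoint h) hyL (interior_subset hy)

theorem isCompact_interface (K L : ι) : IsCompact (interface (𝒯.cell K) (𝒯.cell L)) :=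
  (𝒯.isCompact_closure_cell K).inter_right isClosed_closure

theorem surface_interface_ne_top {K L : ι} (h : L ≠ K) :
    surface d (interface (𝒯.cell K) (𝒯.cell L)) ≠ ∞ :=
  ((measure_mono (𝒯.interface_subset_frontier h)).trans_lt
    (𝒯.surface_frontier_ne_top K).lt_top).ne

theorem area_pos {K L : ι} (h : L ∈ 𝒯.neighbors K) : 0 < 𝒯.area K L :=
  ENNReal.toReal_pos h.2.ne' (𝒯.surface_interface_ne_top h.1)

theorem area_comm (K L : ι) : 𝒯.area K L = 𝒯.area L K := by
  rw [area, area, interface_comm]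

theorem isOutwardNormal {K L : ι} (h : L ∈ 𝒯.neighbors K) :
    IsOutwardNormal (𝒯.cell K) (𝒯.cell L) (𝒯.normal K L) :=
  𝒯.flat K L h.1.symm h.2

theorem exists_interface_subset_hyperplane {K L : ι} (h : L ∈ 𝒯.neighbors K) :
    ∃ c, interface (𝒯.cell K) (𝒯.cell L) ⊆ hyperplane (𝒯.normal K L) c :=
  (𝒯.isOutwardNormal h).2.1

theorem ae_outward {K L : ι} (h : L ∈ 𝒯.neighbors K) :
    ∀ᵐ x ∂(surface d), x ∈ interface (𝒯.cell K) (𝒯.cell L) → ∀ᶠ ε : ℝ in 𝓝[>] 0,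
      x - ε • 𝒯.normal K L ∈ 𝒯.cell K ∧ x + ε • 𝒯.normal K L ∉ 𝒯.cell K :=
  (ae_restrict_iff' (isClosed_interface _ _).measurableSet).1 (𝒯.isOutwardNormal h).2.2

/-- The interface is not negligible and lies in both hyperplanes, so the normals are parallel. If
they were equal, a step backwards from a common good point would land in both cells. -/
theorem normal_symm {K L : ι} (h : L ∈ 𝒯.neighbors K) : 𝒯.normal L K = -𝒯.normal K L := by
  have h' := 𝒯.mem_neighbors_symm h
  obtain ⟨c, hc⟩ := 𝒯.exists_interface_subset_hyperplane h
  obtain ⟨c', hc'⟩ := 𝒯.exists_interface_subset_hyperplane h'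
  rw [interface_comm] at hc'
  by_contra hne
  have heq : 𝒯.normal L K = 𝒯.normal K L := by
    by_contra hne'
    have h0 := surface_hyperplane_inter (𝒯.isOutwardNormal h').1 (𝒯.isOutwardNormal h).1
      hne' hne c' c
    exact h.2.ne' (measure_mono_null (Set.subset_inter hc' hc) h0)
  have hae := (𝒯.ae_outward h).and (𝒯.ae_outward h')
  have : ∃ x ∈ interface (𝒯.cell K) (𝒯.cell L),
      (∀ᶠ ε : ℝ in 𝓝[>] 0, x - ε • 𝒯.normal K L ∈ 𝒯.cell K ∧
        x + ε • 𝒯.normal K L ∉ 𝒯.cell K) ∧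
      (∀ᶠ ε : ℝ in 𝓝[>] 0, x - ε • 𝒯.normal L K ∈ 𝒯.cell L ∧
        x + ε • 𝒯.normal L K ∉ 𝒯.cell L) := by
    by_contra hcon
    refine h.2.ne' (measure_mono_null ?_ hae)
    intro x hx hx'
    exact hcon ⟨x, hx, hx'.1 hx, hx'.2 (by rwa [interface_comm])⟩
  obtain ⟨x, -, h1, h2⟩ := this
  obtain ⟨ε, h1, h2⟩ := (h1.and h2).exists
  rw [heq] at h2
  exact Set.disjoint_left.1 (𝒯.disjoint h.1) h2.1 h1.1

/-- On an overlap of positive measure the two normals are parallel. If equal, a step outwards lands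
in both `L` and `L'`; if opposite, the same point is both inside and outside `K`. -/
theorem surface_interface_inter {K L L' : ι} (h : L ∈ 𝒯.neighbors K) (h' : L' ∈ 𝒯.neighbors K)
    (hne : L ≠ L') :
    surface d (interface (𝒯.cell K) (𝒯.cell L) ∩ interface (𝒯.cell K) (𝒯.cell L')) = 0 := by
  obtain ⟨c, hc⟩ := 𝒯.exists_interface_subset_hyperplane h
  obtain ⟨c', hc'⟩ := 𝒯.exists_interface_subset_hyperplane h'
  by_contra hpos
  have hae := ((𝒯.ae_outward h).and (𝒯.ae_outward h')).and
    ((𝒯.ae_outward (𝒯.mem_neighbors_symm h)).and (𝒯.ae_outward (𝒯.mem_neighbors_symm h')))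
  have : ∃ x ∈ interface (𝒯.cell K) (𝒯.cell L) ∩ interface (𝒯.cell K) (𝒯.cell L'),
      ((∀ᶠ ε : ℝ in 𝓝[>] 0, x - ε • 𝒯.normal K L ∈ 𝒯.cell K ∧
        x + ε • 𝒯.normal K L ∉ 𝒯.cell K) ∧
      (∀ᶠ ε : ℝ in 𝓝[>] 0, x - ε • 𝒯.normal K L' ∈ 𝒯.cell K ∧
        x + ε • 𝒯.normal K L' ∉ 𝒯.cell K)) ∧
      ((∀ᶠ ε : ℝ in 𝓝[>] 0, x - ε • 𝒯.normal L K ∈ 𝒯.cell L ∧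
        x + ε • 𝒯.normal L K ∉ 𝒯.cell L) ∧
      (∀ᶠ ε : ℝ in 𝓝[>] 0, x - ε • 𝒯.normal L' K ∈ 𝒯.cell L' ∧
        x + ε • 𝒯.normal L' K ∉ 𝒯.cell L')) := by
    by_contra hcon
    refine hpos (measure_mono_null ?_ hae)
    rintro x ⟨hx, hx'⟩ ⟨⟨h1, h2⟩, h3, h4⟩
    exact hcon ⟨x, ⟨hx, hx'⟩, ⟨h1 hx, h2 hx'⟩, h3 (by rwa [interface_comm]),
      h4 (by rwa [interface_comm])⟩
  obtain ⟨x, -, ⟨h1, h2⟩, h3, h4⟩ := this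
  obtain ⟨ε, ⟨h1, h2⟩, h3, h4⟩ := ((h1.and h2).and (h3.and h4)).exists
  rw [𝒯.normal_symm h] at h3
  rw [𝒯.normal_symm h'] at h4
  by_cases e1 : 𝒯.normal K L = 𝒯.normal K L'
  · rw [← e1] at h4
    exact Set.disjoint_left.1 (𝒯.disjoint hne) h3.1 h4.1
  by_cases e2 : 𝒯.normal K L = -𝒯.normal K L'
  · rw [e2] at h1
    exact h1.2 (by simpa [sub_eq_add_neg] using h2.1)
  have h0 := surface_hyperplane_inter (𝒯.isOutwardNormal h).1 (𝒯.isOutwardNormal h').1 e1 e2 c c'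
  exact hpos (measure_mono_null (Set.inter_subset_inter hc hc') h0)

end AdmissibleMesh

end Mesh

/-! ### The divergence theorem on a control volume -/

section CellDivergence

variable {d : ℕ}

theorem eventually_mem_halfBall {n y w : EuclideanSpace ℝ (Fin d)} {c δ : ℝ} (hδ : 0 < δ)
    (hy : y ∈ hyperplane n c) (hw : 0 < inner ℝ n w) :
    ∀ᶠ ε : ℝ in 𝓝[>] 0, y + ε • w ∈ Metric.ball y δ ∩ {x | c < inner ℝ n x} := by
  have hcont : Tendsto (fun ε : ℝ => y + ε • w) (𝓝[>] 0) (𝓝 y) := by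
    have : Continuous (fun ε : ℝ => y + ε • w) := by fun_prop
    have h := this.tendsto 0
    rw [zero_smul, add_zero] at h
    exact h.mono_left nhdsWithin_le_nhds
  filter_upwards [hcont (Metric.ball_mem_nhds y hδ), self_mem_nhdsWithin] with ε h1 h2
  refine ⟨h1, ?_⟩
  have hy' : inner ℝ n y = c := hy
  simp only [Set.mem_ofPred_eq, inner_add_right, inner_smul_right, hy']
  have : 0 < ε * inner ℝ n w := mul_pos h2 hw
  linarith

theorem eventually_mem_halfBall_neg {n y w : EuclideanSpace ℝ (Fin d)} {c δ : ℝ} (hδ : 0 < δ)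
    (hy : y ∈ hyperplane n c) (hw : 0 < inner ℝ n w) :
    ∀ᶠ ε : ℝ in 𝓝[>] 0, y - ε • w ∈ Metric.ball y δ ∩ {x | inner ℝ n x < c} := by
  have hy' : y ∈ hyperplane (-n) (-c) := by
    simp only [hyperplane, Set.mem_ofPred_eq, inner_neg_left, neg_inj]
    exact hy
  filter_upwards [eventually_mem_halfBall (w := -w) hδ hy' (by simpa using hw)] with ε h
  simpa [sub_eq_add_neg] using h

theorem convex_halfBall_gt (n y : EuclideanSpace ℝ (Fin d)) (c δ : ℝ) :
    Convex ℝ (Metric.ball y δ ∩ {x | c < inner ℝ n x}) :=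
  (convex_ball y δ).inter (convex_halfSpace_gt (innerSL ℝ n).toLinearMap.isLinear c)

theorem convex_halfBall_lt (n y : EuclideanSpace ℝ (Fin d)) (c δ : ℝ) :
    Convex ℝ (Metric.ball y δ ∩ {x | inner ℝ n x < c}) :=
  (convex_ball y δ).inter (convex_halfSpace_lt (innerSL ℝ n).toLinearMap.isLinear c)

namespace AdmissibleMesh

variable {ι : Type*} (𝒯 : AdmissibleMesh d ι)

/-- The neighbours of a control volume, as a finite set. -/
noncomputable def neighborFinset (hd : 1 ≤ d) (K : ι) : Finset ι :=
  (𝒯.finite_neighbors hd K).toFinset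

theorem mem_neighborFinset (hd : 1 ≤ d) {K L : ι} :
    L ∈ 𝒯.neighborFinset hd K ↔ L ∈ 𝒯.neighbors K :=
  Set.Finite.mem_toFinset _

/-- The component in direction `e` of the outward normal on the boundary of `K`. -/
noncomputable def boundaryNormal (hd : 1 ≤ d) (K : ι) (e y : EuclideanSpace ℝ (Fin d)) : ℝ :=
  ∑ L ∈ 𝒯.neighborFinset hd K,
    (interface (𝒯.cell K) (𝒯.cell L)).indicator (fun _ => inner ℝ (𝒯.normal K L) e) y

/-- A point of the boundary of `K` where the mesh looks like two half spaces, as far as `K` and the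
hyperplane `⟪n, x⟫ = c` are concerned. -/
structure IsRegularPoint (K : ι) (n : EuclideanSpace ℝ (Fin d)) (c : ℝ)
    (y : EuclideanSpace ℝ (Fin d)) : Prop where
  mem_frontier : y ∈ frontier (𝒯.cell K)
  mem_hyperplane : y ∈ hyperplane n c
  neighbor : ∀ L, L ≠ K → y ∈ interface (𝒯.cell K) (𝒯.cell L) → L ∈ 𝒯.neighbors K
  normal : ∀ L ∈ 𝒯.neighbors K, y ∈ interface (𝒯.cell K) (𝒯.cell L) →
    𝒯.normal K L = n ∨ 𝒯.normal K L = -n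
  outward : ∀ L ∈ 𝒯.neighbors K, y ∈ interface (𝒯.cell K) (𝒯.cell L) →
    ∀ᶠ ε : ℝ in 𝓝[>] 0, y - ε • 𝒯.normal K L ∈ 𝒯.cell K ∧ y + ε • 𝒯.normal K L ∉ 𝒯.cell K
  unique : ∀ L ∈ 𝒯.neighbors K, ∀ L' ∈ 𝒯.neighbors K, y ∈ interface (𝒯.cell K) (𝒯.cell L) →
    y ∈ interface (𝒯.cell K) (𝒯.cell L') → L = L'

variable {𝒯}

theorem IsRegularPoint.neg {K : ι} {n : EuclideanSpace ℝ (Fin d)} {c : ℝ}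
    {y : EuclideanSpace ℝ (Fin d)} (h : 𝒯.IsRegularPoint K n c y) :
    𝒯.IsRegularPoint K (-n) (-c) y where
  mem_frontier := h.mem_frontier
  mem_hyperplane := by
    simp only [hyperplane, Set.mem_ofPred_eq, inner_neg_left, neg_inj]
    exact h.mem_hyperplane
  neighbor := h.neighbor
  normal L hL hy := by rw [neg_neg]; exact (h.normal L hL hy).symm
  outward := h.outward
  unique := h.unique

/-- The points `y + ε • n` are covered by the closures of other cells. By local finiteness their
union is closed, so `y` itself lies in the closure of some `L ≠ K`. Regularity makes `L` the only
neighbour at `y`, with normal `n` or `-n`, and the position of `K` excludes `-n`. -/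
theorem IsRegularPoint.boundaryNormal_eq (hd : 1 ≤ d) {K : ι} {n : EuclideanSpace ℝ (Fin d)}
    (hn : ‖n‖ = 1) {c : ℝ} {y : EuclideanSpace ℝ (Fin d)} (h : 𝒯.IsRegularPoint K n c y) {δ : ℝ}
    (hδ : 0 < δ)
    (hin : Metric.ball y δ ∩ {x | inner ℝ n x < c} ⊆ interior (𝒯.cell K))
    (hout : Metric.ball y δ ∩ {x | c < inner ℝ n x} ⊆ (closure (𝒯.cell K))ᶜ)
    (e : EuclideanSpace ℝ (Fin d)) : 𝒯.boundaryNormal hd K e y = inner ℝ n e := by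
  have hnn : 0 < inner ℝ n n := by rw [real_inner_self_eq_norm_sq, hn]; norm_num
  have hev := eventually_mem_halfBall hδ h.mem_hyperplane hnn
  have hclosed : IsClosed (⋃ L : {L // L ≠ K}, closure (𝒯.cell L)) :=
    ((𝒯.locallyFinite_closure_cell hd).comp_injective Subtype.val_injective).isClosed_iUnion
      fun _ => isClosed_closure
  have hmem : y ∈ ⋃ L : {L // L ≠ K}, closure (𝒯.cell L) := by
    refine hclosed.mem_of_tendsto (b := 𝓝[>] (0 : ℝ)) (f := fun ε : ℝ => y + ε • n) ?_ ?_
    · have : Continuous (fun ε : ℝ => y + ε • n) := by fun_prop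
      have h := this.tendsto 0
      rw [zero_smul, add_zero] at h
      exact h.mono_left nhdsWithin_le_nhds
    · filter_upwards [hev] with ε hε
      have hcov : y + ε • n ∈ ⋃ L, closure (𝒯.cell L) := by rw [𝒯.cover]; trivial
      obtain ⟨L, hL⟩ := Set.mem_iUnion.1 hcov
      refine Set.mem_iUnion.2 ⟨⟨L, ?_⟩, hL⟩
      rintro rfl
      exact hout hε hL
  obtain ⟨⟨L, hLK⟩, hyL⟩ := Set.mem_iUnion.1 hmem
  have hyI : y ∈ interface (𝒯.cell K) (𝒯.cell L) :=
    ⟨frontier_subset_closure h.mem_frontier, hyL⟩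
  have hLN := h.neighbor L hLK hyI
  have hnormal : 𝒯.normal K L = n := by
    rcases h.normal L hLN hyI with h1 | h1
    · exact h1
    · exfalso
      obtain ⟨ε, h2, h3⟩ := ((h.outward L hLN hyI).and hev).exists
      rw [h1, smul_neg, sub_neg_eq_add] at h2
      exact hout h3 (subset_closure h2.1)
  rw [boundaryNormal, Finset.sum_eq_single L]
  · rw [Set.indicator_of_mem hyI, hnormal]
  · intro L' hL' hne
    rw [Set.indicator_of_notMem]
    intro hy'
    exact hne (h.unique L' ((𝒯.mem_neighborFinset hd).1 hL') L hLN hy' hyI)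
  · intro hcon
    exact absurd ((𝒯.mem_neighborFinset hd).2 hLN) hcon

/-- An interface through `y` would have `K` on exactly one side. This covers slits (both sides in
`K`) and the case of neither side. -/
theorem IsRegularPoint.boundaryNormal_eq_zero (hd : 1 ≤ d) {K : ι}
    {n : EuclideanSpace ℝ (Fin d)} {c : ℝ} {y : EuclideanSpace ℝ (Fin d)}
    (h : 𝒯.IsRegularPoint K n c y)
    (hside : ∀ᶠ ε : ℝ in 𝓝[>] 0, (y - ε • n ∈ 𝒯.cell K ↔ y + ε • n ∈ 𝒯.cell K))
    (e : EuclideanSpace ℝ (Fin d)) : 𝒯.boundaryNormal hd K e y = 0 := by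
  refine Finset.sum_eq_zero fun L hL => Set.indicator_of_notMem (fun hyI => ?_) _
  have hLN := (𝒯.mem_neighborFinset hd).1 hL
  obtain ⟨ε, h2, h3⟩ := ((h.outward L hLN hyI).and hside).exists
  rcases h.normal L hLN hyI with h1 | h1
  · rw [h1] at h2
    exact h2.2 (h3.1 h2.1)
  · rw [h1, smul_neg, sub_neg_eq_add, ← sub_eq_add_neg] at h2
    exact h2.2 (h3.2 h2.1)

variable (𝒯)

/-- The mesh is countable, so it suffices to discard a null set for each cell or pair of cells:
negligible contacts, interfaces transversal to the hyperplane, bad points for the outward normal,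
and overlaps of interfaces. -/
theorem ae_isRegularPoint (hd : 1 ≤ d) (K : ι) {n : EuclideanSpace ℝ (Fin d)} (hn : ‖n‖ = 1)
    (c : ℝ) :
    ∀ᵐ y ∂(surface d).restrict (frontier (𝒯.cell K) ∩ hyperplane n c),
      𝒯.IsRegularPoint K n c y := by
  have := 𝒯.countable_index hd
  have hms : MeasurableSet (frontier (𝒯.cell K) ∩ hyperplane n c) :=
    (isClosed_frontier.inter (isClosed_hyperplane _ _)).measurableSet
  have h1 : ∀ᵐ y ∂(surface d), ∀ L, L ≠ K → y ∈ interface (𝒯.cell K) (𝒯.cell L) →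
      L ∈ 𝒯.neighbors K := by
    rw [ae_all_iff]
    intro L
    by_cases hL : L ≠ K ∧ L ∉ 𝒯.neighbors K
    · have h0 : surface d (interface (𝒯.cell K) (𝒯.cell L)) = 0 := by
        by_contra hpos
        exact hL.2 ⟨hL.1, pos_iff_ne_zero.2 hpos⟩
      filter_upwards [measure_eq_zero_iff_ae_notMem.1 h0] with y hy _ hy'
      exact absurd hy' hy
    · exact ae_of_all _ fun y hne _ => by
        by_contra hcon
        exact hL ⟨hne, hcon⟩
  have h2 : ∀ᵐ y ∂(surface d), ∀ L, y ∈ hyperplane n c → L ∈ 𝒯.neighbors K →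
      y ∈ interface (𝒯.cell K) (𝒯.cell L) → 𝒯.normal K L = n ∨ 𝒯.normal K L = -n := by
    rw [ae_all_iff]
    intro L
    by_cases hL : L ∈ 𝒯.neighbors K
    · by_cases hor : 𝒯.normal K L = n ∨ 𝒯.normal K L = -n
      · exact ae_of_all _ fun _ _ _ _ => hor
      · obtain ⟨c', hc'⟩ := 𝒯.exists_interface_subset_hyperplane hL
        push Not at hor
        have h0 := surface_hyperplane_inter (𝒯.isOutwardNormal hL).1 hn hor.1 hor.2 c' c
        filter_upwards [measure_eq_zero_iff_ae_notMem.1 h0] with y hy h3 _ h4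
        exact absurd ⟨hc' h4, h3⟩ hy
    · exact ae_of_all _ fun _ _ h => absurd h hL
  have h3 : ∀ᵐ y ∂(surface d), ∀ L, L ∈ 𝒯.neighbors K →
      y ∈ interface (𝒯.cell K) (𝒯.cell L) → ∀ᶠ ε : ℝ in 𝓝[>] 0,
      y - ε • 𝒯.normal K L ∈ 𝒯.cell K ∧ y + ε • 𝒯.normal K L ∉ 𝒯.cell K := by
    rw [ae_all_iff]
    intro L
    by_cases hL : L ∈ 𝒯.neighbors K
    · filter_upwards [𝒯.ae_outward hL] with y hy _ using hy
    · exact ae_of_all _ fun _ h => absurd h hL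
  have h4 : ∀ᵐ y ∂(surface d), ∀ L, ∀ L', L ∈ 𝒯.neighbors K → L' ∈ 𝒯.neighbors K →
      y ∈ interface (𝒯.cell K) (𝒯.cell L) →
      y ∈ interface (𝒯.cell K) (𝒯.cell L') → L = L' := by
    rw [ae_all_iff]
    intro L
    rw [ae_all_iff]
    intro L'
    by_cases hL : L ∈ 𝒯.neighbors K ∧ L' ∈ 𝒯.neighbors K ∧ L ≠ L'
    · filter_upwards [measure_eq_zero_iff_ae_notMem.1
        (𝒯.surface_interface_inter hL.1 hL.2.1 hL.2.2)] with y hy _ _ h5 h6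
      exact absurd ⟨h5, h6⟩ hy
    · refine ae_of_all _ fun y h5 h6 _ _ => ?_
      by_contra hne
      exact hL ⟨h5, h6, hne⟩
  filter_upwards [ae_restrict_mem hms, ae_restrict_of_ae h1, ae_restrict_of_ae h2,
    ae_restrict_of_ae h3, ae_restrict_of_ae h4] with y hy h1 h2 h3 h4
  exact ⟨hy.1, hy.2, h1, fun L => h2 L hy.2, h3, fun L hL L' => h4 L L' hL⟩

theorem integrableOn_mul_indicator (K : ι) {g : EuclideanSpace ℝ (Fin d) → ℝ}
    (hg : Continuous g) (L : ι) (a : ℝ) :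
    IntegrableOn (fun y => g y * (interface (𝒯.cell K) (𝒯.cell L)).indicator (fun _ => a) y)
      (frontier (𝒯.cell K)) (surface d) := by
  have : IsFiniteMeasure ((surface d).restrict (frontier (𝒯.cell K))) :=
    ⟨by simpa using (𝒯.surface_frontier_ne_top K).lt_top⟩
  obtain ⟨M, hM⟩ := (𝒯.isCompact_frontier_cell K).exists_bound_of_continuousOn hg.continuousOn
  refine IntegrableOn.of_bound (𝒯.surface_frontier_ne_top K).lt_top
    (hg.measurable.mul (measurable_const.indicator
      (isClosed_interface _ _).measurableSet)).aestronglyMeasurable (M * |a|) ?_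
  refine (ae_restrict_iff' isClosed_frontier.measurableSet).2 (ae_of_all _ fun y hy => ?_)
  rw [norm_mul]
  refine mul_le_mul (hM y hy) ?_ (norm_nonneg _) ((norm_nonneg _).trans (hM y hy))
  by_cases h : y ∈ interface (𝒯.cell K) (𝒯.cell L) <;> simp [h]

theorem integral_mul_boundaryNormal (hd : 1 ≤ d) (K : ι) {g : EuclideanSpace ℝ (Fin d) → ℝ}
    (hg : Continuous g) (e : EuclideanSpace ℝ (Fin d)) :
    IntegrableOn (fun y => g y * 𝒯.boundaryNormal hd K e y) (frontier (𝒯.cell K)) (surface d) ∧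
    ∫ y in frontier (𝒯.cell K), g y * 𝒯.boundaryNormal hd K e y ∂(surface d) =
      ∑ L ∈ 𝒯.neighborFinset hd K,
        ∫ y in interface (𝒯.cell K) (𝒯.cell L), g y * inner ℝ (𝒯.normal K L) e ∂(surface d) := by
  simp only [boundaryNormal, Finset.mul_sum]
  refine ⟨integrable_finsetSum _ fun L _ => 𝒯.integrableOn_mul_indicator K hg L _, ?_⟩
  rw [integral_finsetSum _ fun L _ => 𝒯.integrableOn_mul_indicator K hg L _]
  refine Finset.sum_congr rfl fun L hL => ?_
  have hm := (isClosed_interface (𝒯.cell K) (𝒯.cell L)).measurableSet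
  have hsub := 𝒯.interface_subset_frontier ((𝒯.mem_neighborFinset hd).1 hL).1
  have : ∀ y, g y * (interface (𝒯.cell K) (𝒯.cell L)).indicator
      (fun _ => inner ℝ (𝒯.normal K L) e) y =
      (interface (𝒯.cell K) (𝒯.cell L)).indicator
        (fun y => g y * inner ℝ (𝒯.normal K L) e) y := by
    intro y
    by_cases h : y ∈ interface (𝒯.cell K) (𝒯.cell L) <;> simp [h]
  simp_rw [this]
  rw [integral_indicator hm, Measure.restrict_restrict hm, Set.inter_eq_left.2 hsub]

/-- The divergence theorem on a control volume, in a fixed direction. -/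
theorem integral_fderiv_cell (hd : 1 ≤ d) (K : ι) {g : EuclideanSpace ℝ (Fin d) → ℝ}
    (hg : ContDiff ℝ 1 g) (e : EuclideanSpace ℝ (Fin d)) :
    ∫ x in interior (𝒯.cell K), fderiv ℝ g x e = ∑ L ∈ 𝒯.neighborFinset hd K,
        ∫ y in interface (𝒯.cell K) (𝒯.cell L), g y * inner ℝ (𝒯.normal K L) e ∂(surface d) := by
  obtain ⟨κ, _, n, c, hn, hdist, hfr⟩ := (𝒯.polygonal K).exists_hyperplanes
  obtain ⟨hint, heq⟩ := 𝒯.integral_mul_boundaryNormal hd K hg.continuous e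
  rw [← heq]
  -- Almost every `y` has a ball that meets no other hyperplane. Its open half balls are convex and
  -- miss the frontier, so each is entirely inside or entirely outside the cell.
  have hball : ∀ i, ∀ᵐ y ∂(surface d).restrict
      (frontier (𝒯.cell K) ∩ hyperplane (n i) (c i)), ∃ δ > 0,
      (Metric.ball y δ ∩ {x | inner ℝ (n i) x < c i} ⊆ interior (𝒯.cell K) ∨
        Metric.ball y δ ∩ {x | inner ℝ (n i) x < c i} ⊆ (closure (𝒯.cell K))ᶜ) ∧
      (Metric.ball y δ ∩ {x | c i < inner ℝ (n i) x} ⊆ interior (𝒯.cell K) ∨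
        Metric.ball y δ ∩ {x | c i < inner ℝ (n i) x} ⊆ (closure (𝒯.cell K))ᶜ) := by
    intro i
    have hae : ∀ᵐ y ∂(surface d), ∀ j, j ≠ i → y ∈ hyperplane (n i) (c i) →
        y ∉ hyperplane (n j) (c j) := by
      rw [ae_all_iff]
      intro j
      by_cases hji : j = i
      · exact ae_of_all _ fun _ h => absurd hji h
      · filter_upwards [measure_eq_zero_iff_ae_notMem.1 (hdist i j (Ne.symm hji))]
          with y hy _ h1 h2
        exact hy ⟨h1, h2⟩
    filter_upwards [ae_restrict_of_ae hae, ae_restrict_mem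
      (isClosed_frontier.inter (isClosed_hyperplane (n i) (c i))).measurableSet] with y hy hymem
    have hopen : IsOpen (⋃ j : {j // j ≠ i}, hyperplane (n j) (c j))ᶜ :=
      (isClosed_iUnion_of_finite fun j => isClosed_hyperplane _ _).isOpen_compl
    have hyo : y ∈ (⋃ j : {j // j ≠ i}, hyperplane (n j) (c j))ᶜ := by
      intro hcon
      obtain ⟨⟨j, hj⟩, hyj⟩ := Set.mem_iUnion.1 hcon
      exact hy j hj hymem.2 hyj
    obtain ⟨δ, hδ, hsub⟩ := Metric.isOpen_iff.1 hopen y hyo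
    have hon : ∀ x ∈ Metric.ball y δ, x ∈ frontier (𝒯.cell K) → inner ℝ (n i) x = c i := by
      intro x hx hxf
      obtain ⟨j, hj⟩ := Set.mem_iUnion.1 (hfr hxf)
      by_cases hji : j = i
      · subst hji; exact hj
      · exact absurd (Set.mem_iUnion.2 ⟨⟨j, hji⟩, hj⟩) (hsub hx)
    refine ⟨δ, hδ, ?_, ?_⟩
    · refine (convex_halfBall_lt _ _ _ _).isPreconnected.subset_interior_or_subset_compl_closure ?_
      rw [Set.disjoint_left]
      rintro x ⟨hx, hx'⟩ hxf
      exact (ne_of_lt hx') (hon x hx hxf)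
    · refine (convex_halfBall_gt _ _ _ _).isPreconnected.subset_interior_or_subset_compl_closure ?_
      rw [Set.disjoint_left]
      rintro x ⟨hx, hx'⟩ hxf
      exact (ne_of_gt hx') (hon x hx hxf)
  -- the value of the normal in terms of the sides of the hyperplane that belong to the cell
  have hside : ∀ i, ∀ᵐ y ∂(surface d).restrict
      (frontier (𝒯.cell K) ∩ hyperplane (n i) (c i)), y ∈ hyperplane (n i) (c i) ∧
      ∃ δ > 0, ∃ a b : ℝ,
      (∀ x ∈ Metric.ball y δ ∩ {x | inner ℝ (n i) x < c i},
        (interior (𝒯.cell K)).indicator (fun _ => (1 : ℝ)) x = a) ∧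
      (∀ x ∈ Metric.ball y δ ∩ {x | c i < inner ℝ (n i) x},
        (interior (𝒯.cell K)).indicator (fun _ => (1 : ℝ)) x = b) ∧
      𝒯.boundaryNormal hd K e y = inner ℝ (n i) e * (a - b) := by
    intro i
    have hnn : 0 < inner ℝ (n i) (n i) := by rw [real_inner_self_eq_norm_sq, hn i]; norm_num
    filter_upwards [hball i, 𝒯.ae_isRegularPoint hd K (hn i) (c i)] with y ⟨δ, hδ, hlt, hgt⟩ hreg
    have hp := eventually_mem_halfBall hδ hreg.mem_hyperplane hnn
    have hm := eventually_mem_halfBall_neg hδ hreg.mem_hyperplane hnn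
    have hout : ∀ S : Set (EuclideanSpace ℝ (Fin d)), S ⊆ (closure (𝒯.cell K))ᶜ → ∀ x ∈ S,
        (interior (𝒯.cell K)).indicator (fun _ => (1 : ℝ)) x = 0 := fun S hS x hx =>
      Set.indicator_of_notMem (fun h => hS hx (subset_closure (interior_subset h))) _
    have hin : ∀ S : Set (EuclideanSpace ℝ (Fin d)), S ⊆ interior (𝒯.cell K) → ∀ x ∈ S,
        (interior (𝒯.cell K)).indicator (fun _ => (1 : ℝ)) x = 1 := fun S hS x hx =>
      Set.indicator_of_mem (hS hx) _
    refine ⟨hreg.mem_hyperplane, δ, hδ, ?_⟩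
    rcases hlt with hlt | hlt <;> rcases hgt with hgt | hgt
    · refine ⟨1, 1, hin _ hlt, hin _ hgt, ?_⟩
      rw [hreg.boundaryNormal_eq_zero hd]
      · ring
      · filter_upwards [hp, hm] with ε h1 h2
        exact iff_of_true (interior_subset (hlt h2)) (interior_subset (hgt h1))
    · refine ⟨1, 0, hin _ hlt, hout _ hgt, ?_⟩
      rw [hreg.boundaryNormal_eq hd (hn i) hδ hlt hgt]
      ring
    -- The cell lies on the positive side, so the outward normal is `-n i`; the regular point is
    -- read with reversed orientation.
    · refine ⟨0, 1, hout _ hlt, hin _ hgt, ?_⟩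
      rw [hreg.neg.boundaryNormal_eq hd (by rw [norm_neg, hn i]) hδ, inner_neg_left]
      · ring
      · simpa [inner_neg_left] using hgt
      · simpa [inner_neg_left] using hlt
    · refine ⟨0, 0, hout _ hlt, hout _ hgt, ?_⟩
      rw [hreg.boundaryNormal_eq_zero hd]
      · ring
      · filter_upwards [hp, hm] with ε h1 h2
        exact iff_of_false (fun h => hlt h2 (subset_closure h))
          (fun h => hgt h1 (subset_closure h))
  refine integral_fderiv_eq_integral_jump hn hdist isOpen_interior.measurableSet
    ((𝒯.isBounded_cell K).subset interior_subset) (𝒯.isCompact_frontier_cell K)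
    frontier_interior_subset hfr (𝒯.surface_frontier_ne_top K) e _ ?_ ?_ hg hint
  · intro i hi
    filter_upwards [hside i] with y ⟨_, δ, _, a, b, _, _, h⟩
    rw [h, hi, zero_mul]
  · intro i hi
    filter_upwards [hside i] with y ⟨hy, δ, hδ, a, b, ha, hb, h⟩
    -- The sides were labelled by `n i`, the jump is taken along `e`; if `⟪n i, e⟫ < 0` the
    -- one-sided values are exchanged, which matches the absolute value.
    rcases lt_or_gt_of_ne hi with hneg | hpos
    · have hpos' : 0 < inner ℝ (n i) (-e) := by rw [inner_neg_right]; linarith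
      refine ⟨b, a, ?_, ?_⟩
      · filter_upwards [eventually_mem_halfBall hδ hy hpos',
          eventually_mem_halfBall_neg hδ hy hpos'] with ε h1 h2
        rw [smul_neg, ← sub_eq_add_neg] at h1
        rw [smul_neg, sub_neg_eq_add] at h2
        exact ⟨hb _ h1, ha _ h2⟩
      · rw [h, abs_of_neg hneg]; ring
    · refine ⟨a, b, ?_, ?_⟩
      · filter_upwards [eventually_mem_halfBall hδ hy hpos,
          eventually_mem_halfBall_neg hδ hy hpos] with ε h1 h2
        exact ⟨ha _ h2, hb _ h1⟩
      · rw [h, abs_of_pos hpos]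

/-- The divergence theorem on a control volume. -/
theorem integral_divergence_cell (hd : 1 ≤ d) (K : ι)
    {w : EuclideanSpace ℝ (Fin d) → EuclideanSpace ℝ (Fin d)} (hw : ContDiff ℝ 1 w) :
    ∑ L ∈ 𝒯.neighborFinset hd K, ∫ y in interface (𝒯.cell K) (𝒯.cell L),
        inner ℝ (w y) (𝒯.normal K L) ∂(surface d) =
      ∫ x in interior (𝒯.cell K), divergence w x := by
  have hwi : ∀ i, ContDiff ℝ 1 fun x => w x i := fun i => by
    exact (EuclideanSpace.proj (𝕜 := ℝ) i).contDiff.comp hw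
  have hfd : ∀ i x, fderiv ℝ w x (EuclideanSpace.single i 1) i =
      fderiv ℝ (fun x => w x i) x (EuclideanSpace.single i 1) := by
    intro i x
    have h1 := (hw.differentiable one_ne_zero x).hasFDerivAt
    have h2 := (EuclideanSpace.proj (𝕜 := ℝ) i).hasFDerivAt.comp x h1
    have h3 : fderiv ℝ (fun x => w x i) x = _ := h2.fderiv
    rw [h3]
    rfl
  have hdiv : ∀ x, divergence w x = ∑ i, fderiv ℝ (fun x => w x i) x (EuclideanSpace.single i 1) :=
    fun x => Finset.sum_congr rfl fun i _ => hfd i x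
  simp_rw [hdiv]
  have hb : Bornology.IsBounded (interior (𝒯.cell K)) :=
    (𝒯.isBounded_cell K).subset interior_subset
  rw [integral_finsetSum]
  · simp_rw [𝒯.integral_fderiv_cell hd K (hwi _)]
    rw [Finset.sum_comm]
    refine Finset.sum_congr rfl fun L hL => ?_
    have hfin := 𝒯.surface_interface_ne_top ((𝒯.mem_neighborFinset hd).1 hL).1
    rw [← integral_finsetSum]
    · refine integral_congr_ae (ae_of_all _ fun y => ?_)
      simp [PiLp.inner_apply, mul_comm]
    · intro i _
      have : IsFiniteMeasure ((surface d).restrict (interface (𝒯.cell K) (𝒯.cell L))) :=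
        ⟨by simpa using hfin.lt_top⟩
      obtain ⟨M, hM⟩ := (𝒯.isCompact_interface K L).exists_bound_of_continuousOn
        (f := fun y => w y i * inner ℝ (𝒯.normal K L) (EuclideanSpace.single i 1))
        ((hwi i).continuous.mul continuous_const).continuousOn
      exact IntegrableOn.of_bound hfin.lt_top
        ((hwi i).continuous.mul continuous_const).measurable.aestronglyMeasurable M
        ((ae_restrict_iff' (isClosed_interface _ _).measurableSet).2 (ae_of_all _ hM))
  · intro i _
    have hc : Continuous fun x => fderiv ℝ (fun x => w x i) x (EuclideanSpace.single i 1) :=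
      ((hwi i).continuous_fderiv one_ne_zero).clm_apply continuous_const
    exact (hc.continuousOn.integrableOn_compact hb.isCompact_closure).mono_set subset_closure

end AdmissibleMesh

end CellDivergence

/-! ### Deterministic stability of the upwind scheme -/

section Potential

/-- The antiderivative `Φ` of `s ↦ s f'(s)` that vanishes at `0`. -/
noncomputable def potential (f : ℝ → ℝ) (u : ℝ) : ℝ := u * f u - ∫ s in (0 : ℝ)..u, f s

variable {f : ℝ → ℝ} {c : ℝ≥0}

theorem potential_zero (f : ℝ → ℝ) : potential f 0 = 0 := by simp [potential]

/-- The right side is the numerical dissipation between the values `a` and `b`: nonnegative because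
`f` is nondecreasing, and large enough to dominate `(f a - f b)²`. -/
theorem mul_sub_potential_sub (hf : Continuous f) (a b : ℝ) :
    a * (f a - f b) - (potential f a - potential f b) = ∫ s in b..a, (f s - f b) := by
  have hi : ∀ x y, IntervalIntegrable f volume x y := fun x y => hf.intervalIntegrable x y
  rw [intervalIntegral.integral_sub (hi _ _) (by simp), intervalIntegral.integral_const,
    potential, potential, ← intervalIntegral.integral_interval_sub_left (hi 0 a) (hi 0 b),
    smul_eq_mul]
  ring

/-- The difference of the two sides, as a function of `a`, vanishes at `b` and has derivative `2 (f
a - f b) (c - f' a)`. As `0 ≤ f' ≤ c`, this is nonnegative to the right of `b` and nonpositive to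
the left, so `b` is a minimum. -/
theorem sq_sub_le_integral (hf : ContDiff ℝ 1 f) (hmono : Monotone f) (hlip : LipschitzWith c f)
    (a b : ℝ) : (f a - f b) ^ 2 ≤ 2 * c * ∫ s in b..a, (f s - f b) := by
  have hfc := hf.continuous
  have hc : Continuous fun s => f s - f b := hfc.sub continuous_const
  set φ : ℝ → ℝ := fun a => 2 * c * (∫ s in b..a, (f s - f b)) - (f a - f b) ^ 2 with hφ
  have hder : ∀ x, HasDerivAt φ (2 * (f x - f b) * (c - deriv f x)) x := by
    intro x
    have h1 : HasDerivAt (fun a => ∫ s in b..a, (f s - f b)) (f x - f b) x :=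
      intervalIntegral.integral_hasDerivAt_right (hc.intervalIntegrable _ _)
        (hc.stronglyMeasurableAtFilter _ _) hc.continuousAt
    have h2 : HasDerivAt f (deriv f x) x := (hf.differentiable one_ne_zero x).hasDerivAt
    have h3 := (h1.const_mul (2 * (c : ℝ))).sub ((h2.sub_const (f b)).pow 2)
    refine h3.congr_deriv ?_
    simp
    ring
  have hd : ∀ x, deriv f x ≤ c := fun x =>
    (le_abs_self _).trans (norm_deriv_le_of_lipschitz hlip)
  have hφb : φ b = 0 := by simp [hφ]
  have hφc : Continuous φ := continuous_iff_continuousAt.2 fun x => (hder x).continuousAt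
  have key : 0 ≤ φ a := by
    rw [← hφb]
    rcases le_total b a with hba | hab
    · have hm : MonotoneOn φ (Set.Ici b) := by
        refine monotoneOn_of_deriv_nonneg (convex_Ici b) hφc.continuousOn
          (fun x _ => (hder x).differentiableAt.differentiableWithinAt) fun x hx => ?_
        rw [interior_Ici] at hx
        rw [(hder x).deriv]
        have := hmono (le_of_lt hx)
        have := hd x
        exact mul_nonneg (by linarith) (by linarith)
      exact hm Set.self_mem_Ici hba hba
    · have hm : AntitoneOn φ (Set.Iic b) := by
        refine antitoneOn_of_deriv_nonpos (convex_Iic b) hφc.continuousOn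
          (fun x _ => (hder x).differentiableAt.differentiableWithinAt) fun x hx => ?_
        rw [interior_Iic] at hx
        rw [(hder x).deriv]
        have := hmono (le_of_lt hx)
        have := hd x
        exact mul_nonpos_of_nonpos_of_nonneg (by linarith) (by linarith)
      exact hm hab Set.self_mem_Iic hab
  simp only [hφ] at key
  linarith

theorem integral_sub_nonneg (hmono : Monotone f) (a b : ℝ) :
    0 ≤ ∫ s in b..a, (f s - f b) := by
  rcases le_total b a with hba | hab
  · exact intervalIntegral.integral_nonneg hba fun s hs => sub_nonneg.2 (hmono hs.1)
  · rw [intervalIntegral.integral_symm, ← intervalIntegral.integral_neg]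
    exact intervalIntegral.integral_nonneg hab fun s hs => by
      have := hmono hs.2
      linarith

theorem potential_nonneg (hf : Continuous f) (hmono : Monotone f) (u : ℝ) :
    0 ≤ potential f u := by
  have h := integral_sub_nonneg hmono 0 u
  rw [← mul_sub_potential_sub hf, potential_zero] at h
  linarith

/-- Nonnegative dissipation between `u` and `0` gives `Φ u ≤ u f(u)`. The bound serves to make the
total potential on the mesh finite, so that it can be cancelled. -/
theorem potential_le (hf : Continuous f) (hmono : Monotone f) (hlip : LipschitzWith c f)
    (hf0 : f 0 = 0) (u : ℝ) : potential f u ≤ c * u ^ 2 := by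
  have h := integral_sub_nonneg hmono u 0
  rw [← mul_sub_potential_sub hf, potential_zero, hf0] at h
  have h1 : |f u| ≤ c * |u| := by
    have := hlip.dist_le_mul u 0
    simpa [Real.dist_eq, hf0] using this
  have h2 : u * f u ≤ |u| * |f u| := by rw [← abs_mul]; exact le_abs_self _
  have h3 : |u| * |f u| ≤ |u| * (c * |u|) := mul_le_mul_of_nonneg_left h1 (abs_nonneg _)
  have h4 : |u| * (c * |u|) = c * u ^ 2 := by rw [← sq_abs u]; ring
  linarith

/-- Energy balance of one step of the upwind scheme on one control volume. -/
theorem cell_energy_le {ι : Type*} (hf : ContDiff ℝ 1 f) (hmono : Monotone f)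
    (hlip : LipschitzWith c f) {Δt m : ℝ} (hΔt : 0 ≤ Δt) (hm : 0 < m) (s : Finset ι)
    {b : ι → ℝ} (hb : ∀ L ∈ s, 0 ≤ b L) (hcfl : Δt * c * ∑ L ∈ s, b L ≤ m) (u : ℝ) (v : ι → ℝ) :
    m * (u - Δt / m * ∑ L ∈ s, b L * (f u - f (v L))) ^ 2
        + ∑ L ∈ s, 2 * Δt * b L * potential f u ≤
      m * u ^ 2 + ∑ L ∈ s, 2 * Δt * b L * potential f (v L) := by
  set S := ∑ L ∈ s, b L * (f u - f (v L)) with hS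
  set ψ : ι → ℝ := fun L => u * (f u - f (v L)) - (potential f u - potential f (v L)) with hψ
  have hψ0 : ∀ L, 0 ≤ ψ L := fun L => by
    simp only [hψ]
    rw [mul_sub_potential_sub hf.continuous]
    exact integral_sub_nonneg hmono _ _
  have hψ1 : ∀ L, (f u - f (v L)) ^ 2 ≤ 2 * c * ψ L := fun L => by
    simp only [hψ]
    rw [mul_sub_potential_sub hf.continuous]
    exact sq_sub_le_integral hf hmono hlip _ _
  have hB : 0 ≤ ∑ L ∈ s, b L := Finset.sum_nonneg hb
  -- Cauchy–Schwarz with weights `b`. Together with `hψ1` it bounds `S²` by `2 c (∑ b) ∑ b ψ`, and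
  -- the CFL condition is exactly what lets `Δt² S² / m` be absorbed by `2 Δt ∑ b ψ`.
  have hCS : S ^ 2 ≤ (∑ L ∈ s, b L) * ∑ L ∈ s, b L * (f u - f (v L)) ^ 2 := by
    refine Finset.sum_sq_le_sum_mul_sum_of_sq_le_mul s hb
      (fun L hL => mul_nonneg (hb L hL) (sq_nonneg _)) fun L _ => le_of_eq ?_
    ring
  have h2 : ∑ L ∈ s, b L * (f u - f (v L)) ^ 2 ≤ 2 * c * ∑ L ∈ s, b L * ψ L := by
    rw [Finset.mul_sum]
    refine Finset.sum_le_sum fun L hL => ?_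
    have := mul_le_mul_of_nonneg_left (hψ1 L) (hb L hL)
    linarith
  have hψs : 0 ≤ ∑ L ∈ s, b L * ψ L :=
    Finset.sum_nonneg fun L hL => mul_nonneg (hb L hL) (hψ0 L)
  have h3 : Δt ^ 2 * S ^ 2 ≤ m * (2 * Δt * ∑ L ∈ s, b L * ψ L) := by
    calc Δt ^ 2 * S ^ 2 ≤ Δt ^ 2 * ((∑ L ∈ s, b L) * (2 * c * ∑ L ∈ s, b L * ψ L)) :=
          mul_le_mul_of_nonneg_left (hCS.trans (mul_le_mul_of_nonneg_left h2 hB)) (sq_nonneg _)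
      _ = (Δt * c * ∑ L ∈ s, b L) * (2 * Δt * ∑ L ∈ s, b L * ψ L) := by ring
      _ ≤ m * (2 * Δt * ∑ L ∈ s, b L * ψ L) :=
          mul_le_mul_of_nonneg_right hcfl (by positivity)
  have h4 : m * (u - Δt / m * S) ^ 2 = m * u ^ 2 - 2 * Δt * u * S + Δt ^ 2 * S ^ 2 / m := by
    field_simp
    ring
  have h5 : Δt ^ 2 * S ^ 2 / m ≤ 2 * Δt * ∑ L ∈ s, b L * ψ L := by
    rw [div_le_iff₀ hm]
    linarith
  have h6 : 2 * Δt * ∑ L ∈ s, b L * ψ L = 2 * Δt * u * S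
      - ∑ L ∈ s, 2 * Δt * b L * potential f u + ∑ L ∈ s, 2 * Δt * b L * potential f (v L) := by
    rw [hS, Finset.mul_sum, Finset.mul_sum, ← Finset.sum_sub_distrib, ← Finset.sum_add_distrib]
    refine Finset.sum_congr rfl fun L _ => ?_
    simp only [hψ]
    ring
  linarith

/-- One deterministic step of the upwind scheme does not increase the `L²` norm. -/
theorem tsum_energy_le {ι : Type*} (hf : ContDiff ℝ 1 f) (hmono : Monotone f)
    (hlip : LipschitzWith c f) (hf0 : f 0 = 0) {Δt : ℝ} (hΔt : 0 ≤ Δt) {m : ι → ℝ}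
    (hm : ∀ K, 0 < m K) (s : ι → Finset ι) (hs : ∀ K L, L ∈ s K ↔ K ∈ s L)
    {b : ι → ι → ℝ} (hb : ∀ K, ∀ L ∈ s K, 0 ≤ b K L)
    (hcons : ∀ K, ∑ L ∈ s K, b K L = ∑ L ∈ s K, b L K)
    (hcfl : ∀ K, Δt * c * ∑ L ∈ s K, b K L ≤ m K) (u : ι → ℝ) :
    ∑' K, ENNReal.ofReal (m K *
        (u K - Δt / m K * ∑ L ∈ s K, b K L * (f (u K) - f (u L))) ^ 2) ≤
      ∑' K, ENNReal.ofReal (m K * u K ^ 2) := by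
  classical
  set Φ := potential f with hΦdef
  have hΦ : ∀ x, 0 ≤ Φ x := potential_nonneg hf.continuous hmono
  set X : ι → ℝ≥0∞ := fun K => ENNReal.ofReal (∑ L ∈ s K, 2 * Δt * b K L * Φ (u K)) with hX
  set Y : ι → ℝ≥0∞ := fun K => ENNReal.ofReal (∑ L ∈ s K, 2 * Δt * b K L * Φ (u L)) with hY
  have hX0 : ∀ K, 0 ≤ ∑ L ∈ s K, 2 * Δt * b K L * Φ (u K) := fun K =>
    Finset.sum_nonneg fun L hL => mul_nonneg (mul_nonneg (by positivity) (hb K L hL)) (hΦ _)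
  have hY0 : ∀ K, ∀ L ∈ s K, 0 ≤ 2 * Δt * b K L * Φ (u L) := fun K L hL =>
    mul_nonneg (mul_nonneg (by positivity) (hb K L hL)) (hΦ _)
  -- Exchanging the order of summation collects all the terms with `Φ (u L)`. Their total
  -- coefficient is the outflow of `L`, which by `hcons` equals its inflow.
  have hXY : ∑' K, Y K = ∑' K, X K := by
    have h1 : ∀ K, Y K = ∑' L, if L ∈ s K then ENNReal.ofReal (2 * Δt * b K L * Φ (u L)) else 0 := by
      intro K
      rw [hY]
      dsimp only
      rw [ENNReal.ofReal_sum_of_nonneg (hY0 K), tsum_eq_sum (s := s K)]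
      · exact Finset.sum_congr rfl fun L hL => by rw [if_pos hL]
      · intro L hL; rw [if_neg hL]
    simp_rw [h1]
    rw [ENNReal.tsum_comm]
    refine tsum_congr fun L => ?_
    rw [tsum_eq_sum (s := s L)]
    · rw [hX]
      dsimp only
      have h2 : ∑ K ∈ s L, 2 * Δt * b L K * Φ (u L) = ∑ K ∈ s L, 2 * Δt * b K L * Φ (u L) := by
        simp_rw [mul_assoc (2 * Δt), ← Finset.mul_sum, ← Finset.sum_mul, hcons L]
      rw [h2, ENNReal.ofReal_sum_of_nonneg fun K hK => hY0 K L ((hs L K).1 hK)]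
      exact Finset.sum_congr rfl fun K hK => by rw [if_pos ((hs L K).1 hK)]
    · intro K hK
      rw [if_neg fun h => hK ((hs L K).2 h)]
  by_cases htop : ∑' K, ENNReal.ofReal (m K * u K ^ 2) = ∞
  · rw [htop]; exact le_top
  -- In `ℝ≥0∞` a summand cancels only if it is finite: here `Φ u ≤ c u²` and the CFL condition bound
  -- the potential by twice the energy.
  have hXfin : ∑' K, X K ≠ ∞ := by
    have hle : ∑' K, X K ≤ ∑' K, 2 * ENNReal.ofReal (m K * u K ^ 2) := by
      refine ENNReal.tsum_le_tsum fun K => ?_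
      have : (2 : ℝ≥0∞) = ENNReal.ofReal 2 := by simp
      rw [this, ← ENNReal.ofReal_mul zero_le_two]
      refine ENNReal.ofReal_le_ofReal ?_
      have hB : 0 ≤ ∑ L ∈ s K, b K L := Finset.sum_nonneg (hb K)
      calc ∑ L ∈ s K, 2 * Δt * b K L * Φ (u K) = 2 * Δt * (∑ L ∈ s K, b K L) * Φ (u K) := by
            rw [Finset.mul_sum, Finset.sum_mul]
        _ ≤ 2 * Δt * (∑ L ∈ s K, b K L) * (c * u K ^ 2) :=
            mul_le_mul_of_nonneg_left (potential_le hf.continuous hmono hlip hf0 _)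
              (by positivity)
        _ = 2 * ((Δt * c * ∑ L ∈ s K, b K L) * u K ^ 2) := by ring
        _ ≤ 2 * (m K * u K ^ 2) := by
            have := mul_le_mul_of_nonneg_right (hcfl K) (sq_nonneg (u K))
            linarith
    refine (hle.trans_lt ?_).ne
    rw [ENNReal.tsum_mul_left]
    exact ENNReal.mul_lt_top (by simp) (lt_top_iff_ne_top.2 htop)
  have hmain : ∑' K, ENNReal.ofReal (m K *
        (u K - Δt / m K * ∑ L ∈ s K, b K L * (f (u K) - f (u L))) ^ 2) + ∑' K, X K ≤
      ∑' K, ENNReal.ofReal (m K * u K ^ 2) + ∑' K, X K := by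
    nth_rw 2 [← hXY]
    rw [← ENNReal.tsum_add, ← ENNReal.tsum_add]
    refine ENNReal.tsum_le_tsum fun K => ?_
    rw [hX, hY]
    dsimp only
    rw [← ENNReal.ofReal_add (mul_nonneg (hm K).le (sq_nonneg _)) (hX0 K),
      ← ENNReal.ofReal_add (mul_nonneg (hm K).le (sq_nonneg _)) (Finset.sum_nonneg (hY0 K))]
    exact ENNReal.ofReal_le_ofReal
      (cell_energy_le hf hmono hlip hΔt (hm K) (s K) (hb K) (hcfl K) (u K) u)
  exact (ENNReal.add_le_add_iff_right hXfin).1 hmain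

end Potential

/-! ### The coefficients of the numerical flux -/

section Flux

variable {d : ℕ} {ι : Type*} (𝒯 : AdmissibleMesh d ι)

namespace AdmissibleMesh

/-- The interfaces of `K` overlap in null sets and lie in its boundary. -/
theorem sum_area_le (hd : 1 ≤ d) (K : ι) :
    ∑ L ∈ 𝒯.neighborFinset hd K, 𝒯.area K L ≤ 1 / 𝒯.α * 𝒯.size ^ (d - 1) := by
  have hN : ∀ L ∈ 𝒯.neighborFinset hd K, L ∈ 𝒯.neighbors K := fun L hL =>
    (𝒯.mem_neighborFinset hd).1 hL
  have h1 : ∑ L ∈ 𝒯.neighborFinset hd K, surface d (interface (𝒯.cell K) (𝒯.cell L)) ≤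
      ENNReal.ofReal (1 / 𝒯.α * 𝒯.size ^ (d - 1)) := by
    rw [← measure_biUnion_finset₀]
    · refine (measure_mono ?_).trans (𝒯.boundary_le K)
      exact Set.iUnion₂_subset fun L hL => 𝒯.interface_subset_frontier (hN L hL).1
    · intro L hL L' hL' hne
      exact 𝒯.surface_interface_inter (hN L hL) (hN L' hL') hne
    · exact fun L _ => (isClosed_interface _ _).measurableSet.nullMeasurableSet
  have h2 : 0 ≤ 1 / 𝒯.α * 𝒯.size ^ (d - 1) :=
    mul_nonneg (one_div_nonneg.2 𝒯.α_pos.le) (pow_nonneg (𝒯.size_pos hd K).le _)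
  have h3 := ENNReal.toReal_mono ENNReal.ofReal_ne_top h1
  rw [ENNReal.toReal_ofReal h2, ENNReal.toReal_sum fun L hL =>
    𝒯.surface_interface_ne_top (hN L hL).1] at h3
  exact h3

theorem vol_ge (hd : 1 ≤ d) (K : ι) : 𝒯.α * 𝒯.size ^ d ≤ 𝒯.vol K := by
  have h := ENNReal.toReal_mono (𝒯.volume_cell_ne_top K) (𝒯.volume_ge K)
  change (ENNReal.ofReal (𝒯.α * 𝒯.size ^ d)).toReal ≤ 𝒯.vol K at h
  rwa [ENNReal.toReal_ofReal
    (mul_nonneg 𝒯.α_pos.le (pow_nonneg (𝒯.size_pos hd K).le _))] at h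

/-- The two powers of `α` in the CFL condition are spent here: one on `|∂K| ≤ α⁻¹ h^(d-1)`, the
other on `α h^d ≤ |K|`. -/
theorem cfl_cell (hd : 1 ≤ d) {Δt V : ℝ} {c : ℝ≥0} (hΔt : 0 ≤ Δt) (hV : 0 ≤ V)
    (hCFL : Δt * (c * V) ≤ 𝒯.α ^ 2 * 𝒯.size) (K : ι) {b : ι → ℝ}
    (hb : ∀ L ∈ 𝒯.neighborFinset hd K, b L ≤ V * 𝒯.area K L) :
    Δt * c * ∑ L ∈ 𝒯.neighborFinset hd K, b L ≤ 𝒯.vol K := by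
  have hα := 𝒯.α_pos
  have hh := 𝒯.size_pos hd K
  calc Δt * c * ∑ L ∈ 𝒯.neighborFinset hd K, b L
      ≤ Δt * c * ∑ L ∈ 𝒯.neighborFinset hd K, V * 𝒯.area K L :=
        mul_le_mul_of_nonneg_left (Finset.sum_le_sum hb) (by positivity)
    _ = Δt * (c * V) * ∑ L ∈ 𝒯.neighborFinset hd K, 𝒯.area K L := by
        rw [← Finset.mul_sum]; ring
    _ ≤ Δt * (c * V) * (1 / 𝒯.α * 𝒯.size ^ (d - 1)) :=
        mul_le_mul_of_nonneg_left (𝒯.sum_area_le hd K) (by positivity)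
    _ ≤ 𝒯.α ^ 2 * 𝒯.size * (1 / 𝒯.α * 𝒯.size ^ (d - 1)) :=
        mul_le_mul_of_nonneg_right hCFL (by positivity)
    _ = 𝒯.α * 𝒯.size ^ d := by
        obtain ⟨k, rfl⟩ : ∃ k, d = k + 1 := ⟨d - 1, by omega⟩
        rw [Nat.add_sub_cancel]
        field_simp
        ring
    _ ≤ 𝒯.vol K := 𝒯.vol_ge hd K

/-- The surface integral of `g (v·n_{K,σ})` over the interface of `K` and `L`. -/
noncomputable def interfaceIntegral
    (v : ℝ → EuclideanSpace ℝ (Fin d) → EuclideanSpace ℝ (Fin d)) (g : ℝ → ℝ) (K L : ι)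
    (t : ℝ) : ℝ :=
  ∫ x in interface (𝒯.cell K) (𝒯.cell L), g (inner ℝ (v t x) (𝒯.normal K L)) ∂(surface d)

variable {v : ℝ → EuclideanSpace ℝ (Fin d) → EuclideanSpace ℝ (Fin d)} {T : ℝ}

theorem continuousOn_interfaceIntegral (hT : 0 ≤ T)
    (hv : ContinuousOn (Function.uncurry v) (Set.Icc 0 T ×ˢ Set.univ)) {g : ℝ → ℝ}
    (hg : Continuous g) {K L : ι} (h : L ∈ 𝒯.neighbors K) :
    ContinuousOn (𝒯.interfaceIntegral v g K L) (Set.Icc 0 T) := by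
  have hfin : IsFiniteMeasure ((surface d).restrict (interface (𝒯.cell K) (𝒯.cell L))) :=
    ⟨by simpa using (𝒯.surface_interface_ne_top h.1).lt_top⟩
  -- Freezing the time at the end points of `[0, T]` extends the integrand continuously to all
  -- times.
  have hc : Continuous fun p : ℝ × EuclideanSpace ℝ (Fin d) =>
      g (inner ℝ (v (Set.projIcc 0 T hT p.1) p.2) (𝒯.normal K L)) := by
    have h1 : Continuous fun p : ℝ × EuclideanSpace ℝ (Fin d) =>
        v (Set.projIcc 0 T hT p.1) p.2 := by
      have h2 : Continuous fun p : ℝ × EuclideanSpace ℝ (Fin d) =>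
          ((Set.projIcc 0 T hT p.1 : ℝ), p.2) :=
        (continuous_subtype_val.comp (continuous_projIcc.comp continuous_fst)).prodMk
          continuous_snd
      exact hv.comp_continuous h2 fun p => ⟨(Set.projIcc 0 T hT p.1).2, trivial⟩
    exact hg.comp (h1.inner continuous_const)
  have hcont : Continuous fun t : ℝ => ∫ x in interface (𝒯.cell K) (𝒯.cell L),
      g (inner ℝ (v (Set.projIcc 0 T hT t) x) (𝒯.normal K L))
        ∂((surface d).restrict (interface (𝒯.cell K) (𝒯.cell L))) :=
    continuous_parametric_integral_of_continuous hc (𝒯.isCompact_interface K L)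
  refine hcont.continuousOn.congr fun t ht => ?_
  rw [interfaceIntegral, Measure.restrict_restrict (isClosed_interface _ _).measurableSet,
    Set.inter_self]
  dsimp only
  rw [Set.projIcc_of_mem hT ht]

theorem abs_interfaceIntegral_le {g : ℝ → ℝ} (hg : ∀ s, |g s| ≤ |s|) {V t : ℝ}
    (hv : ∀ x, ‖v t x‖ ≤ V) {K L : ι} (h : L ∈ 𝒯.neighbors K) :
    |𝒯.interfaceIntegral v g K L t| ≤ V * 𝒯.area K L := by
  rw [← Real.norm_eq_abs]
  refine norm_setIntegral_le_of_norm_le_const (𝒯.surface_interface_ne_top h.1).lt_top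
    fun x _ => ?_
  calc ‖g (inner ℝ (v t x) (𝒯.normal K L))‖ ≤ |inner ℝ (v t x) (𝒯.normal K L)| := hg _
    _ ≤ ‖v t x‖ * ‖𝒯.normal K L‖ := abs_real_inner_le_norm _ _
    _ ≤ V := by rw [(𝒯.isOutwardNormal h).1, mul_one]; exact hv x

theorem area_mul_normalMean (Δt : ℝ) (g : ℝ → ℝ) (n : ℕ) {K L : ι} (h : L ∈ 𝒯.neighbors K) :
    𝒯.area K L * 𝒯.normalMean v Δt g n K L =
      1 / Δt * ∫ t in (n * Δt)..((n + 1) * Δt), 𝒯.interfaceIntegral v g K L t := by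
  have := (𝒯.area_pos h).ne'
  rw [normalMean]
  change _ * (_ * ∫ t in _.._, 𝒯.interfaceIntegral v g K L t) = _
  by_cases hΔ : Δt = 0
  · simp [hΔ]
  · field_simp

theorem normalMean_symm (Δt : ℝ) (g : ℝ → ℝ) (n : ℕ) {K L : ι} (h : L ∈ 𝒯.neighbors K) :
    𝒯.normalMean v Δt g n L K = 𝒯.normalMean v Δt (fun s => g (-s)) n K L := by
  rw [normalMean, normalMean, interface_comm, 𝒯.normal_symm h, 𝒯.area_comm]
  simp only [inner_neg_right]

theorem contDiff_slice (hv : ContDiffOn ℝ 1 (Function.uncurry v) (Set.Icc 0 T ×ˢ Set.univ))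
    {t : ℝ} (ht : t ∈ Set.Icc 0 T) : ContDiff ℝ 1 (v t) := by
  have h1 : ContDiff ℝ 1 fun x : EuclideanSpace ℝ (Fin d) => (t, x) := by fun_prop
  exact hv.comp_contDiff h1 fun x => ⟨ht, trivial⟩

section Step

variable {V Δt : ℝ} {n : ℕ}

theorem abs_area_mul_normalMean_le (hΔt : 0 < Δt) (hnT : (n + 1) * Δt ≤ T)
    {g : ℝ → ℝ} (hg : ∀ s, |g s| ≤ |s|)
    (hv : ∀ t ∈ Set.Ico 0 T, ∀ x, ‖v t x‖ ≤ V) {K L : ι} (h : L ∈ 𝒯.neighbors K) :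
    |𝒯.area K L * 𝒯.normalMean v Δt g n K L| ≤ V * 𝒯.area K L := by
  rw [𝒯.area_mul_normalMean Δt g n h, abs_mul, abs_of_pos (one_div_pos.2 hΔt)]
  have hn0 : 0 ≤ n * Δt := by positivity
  have hle : (n : ℝ) * Δt ≤ (n + 1) * Δt := by nlinarith
  have hb : ‖∫ t in (n * Δt)..((n + 1) * Δt), 𝒯.interfaceIntegral v g K L t‖ ≤
      V * 𝒯.area K L * |(n + 1) * Δt - n * Δt| := by
    refine intervalIntegral.norm_integral_le_of_norm_le_const_ae ?_
    -- The bound on `v` holds on `[0, T)` only; the last time step reaches `T`, a null set of times.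
    have hne : ∀ᵐ t : ℝ, t ≠ T := by
      rw [ae_iff]; simp
    filter_upwards [hne] with t htT ht
    rw [Set.uIoc_of_le hle] at ht
    exact 𝒯.abs_interfaceIntegral_le hg
      (hv t ⟨hn0.trans ht.1.le, lt_of_le_of_ne (ht.2.trans hnT) htT⟩) h
  have h2 : |((n : ℝ) + 1) * Δt - n * Δt| = Δt := by
    rw [show ((n : ℝ) + 1) * Δt - n * Δt = Δt by ring, abs_of_pos hΔt]
  rw [h2] at hb
  calc 1 / Δt * _ ≤ 1 / Δt * (V * 𝒯.area K L * Δt) :=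
        mul_le_mul_of_nonneg_left hb (one_div_pos.2 hΔt).le
    _ = V * 𝒯.area K L := by field_simp

theorem intervalIntegrable_interfaceIntegral (hΔt : 0 < Δt) (hnT : (n + 1) * Δt ≤ T)
    (hv : ContinuousOn (Function.uncurry v) (Set.Icc 0 T ×ˢ Set.univ)) {g : ℝ → ℝ}
    (hg : Continuous g) {K L : ι} (h : L ∈ 𝒯.neighbors K) :
    IntervalIntegrable (𝒯.interfaceIntegral v g K L) volume (n * Δt) ((n + 1) * Δt) := by
  have hn0 : 0 ≤ n * Δt := by positivity
  have hle : (n : ℝ) * Δt ≤ (n + 1) * Δt := by nlinarith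
  refine ContinuousOn.intervalIntegrable ?_
  rw [Set.uIcc_of_le hle]
  exact (𝒯.continuousOn_interfaceIntegral (hn0.trans (hle.trans hnT)) hv hg h).mono
    (Set.Icc_subset_Icc hn0 hnT)

/-- At each time before `T` the total flux of `v` out of the cell vanishes by the divergence
theorem; averaging over the time step preserves this. -/
theorem sum_area_mul_normalMean (hd : 1 ≤ d) (hΔt : 0 < Δt) (hnT : (n + 1) * Δt ≤ T)
    (hv : ContDiffOn ℝ 1 (Function.uncurry v) (Set.Icc 0 T ×ˢ Set.univ))
    (hdiv : ∀ t ∈ Set.Ico 0 T, ∀ x, divergence (v t) x = 0) (K : ι) :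
    ∑ L ∈ 𝒯.neighborFinset hd K, 𝒯.area K L * 𝒯.normalMean v Δt id n K L = 0 := by
  have hN : ∀ L ∈ 𝒯.neighborFinset hd K, L ∈ 𝒯.neighbors K := fun L hL =>
    (𝒯.mem_neighborFinset hd).1 hL
  rw [Finset.sum_congr rfl fun L hL => 𝒯.area_mul_normalMean Δt id n (hN L hL), ← Finset.mul_sum,
    ← intervalIntegral.integral_finsetSum fun L hL =>
      𝒯.intervalIntegrable_interfaceIntegral hΔt hnT hv.continuousOn continuous_id (hN L hL)]
  have hn0 : 0 ≤ n * Δt := by positivity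
  have hle : (n : ℝ) * Δt ≤ (n + 1) * Δt := by nlinarith
  rw [intervalIntegral.integral_zero_ae, mul_zero]
  have hne : ∀ᵐ t : ℝ, t ≠ T := by
    rw [ae_iff]; simp
  filter_upwards [hne] with t htT ht
  rw [Set.uIoc_of_le hle] at ht
  have htI : t ∈ Set.Ico 0 T := ⟨hn0.trans ht.1.le, lt_of_le_of_ne (ht.2.trans hnT) htT⟩
  have := 𝒯.integral_divergence_cell hd K (contDiff_slice hv (Set.Ico_subset_Icc_self htI))
  simp only [hdiv t htI, integral_zero] at this
  exact this

/-- Both numerical fluxes are of the form `b_{L,K} f(u_K) - b_{K,L} f(u_L)`, with nonnegative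
coefficients `b` that are conservative. -/
theorem exists_flux_coefficients (hd : 1 ≤ d) (hΔt : 0 < Δt) (hnT : (n + 1) * Δt ≤ T)
    (hv : ContDiffOn ℝ 1 (Function.uncurry v) (Set.Icc 0 T ×ˢ Set.univ))
    (hdiv : ∀ t ∈ Set.Ico 0 T, ∀ x, divergence (v t) x = 0)
    (hv_bdd : ∀ t ∈ Set.Ico 0 T, ∀ x, ‖v t x‖ ≤ V) (f : ℝ → ℝ)
    {F : ℕ → ι → ι → ℝ → ℝ → ℝ} (hF : F = 𝒯.upwindFlux v Δt f ∨ F = 𝒯.splitUpwindFlux v Δt f) :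
    ∃ b : ι → ι → ℝ,
      (∀ K, ∀ L ∈ 𝒯.neighborFinset hd K, 0 ≤ b K L) ∧
      (∀ K, ∀ L ∈ 𝒯.neighborFinset hd K, b K L ≤ V * 𝒯.area K L) ∧
      (∀ K, ∑ L ∈ 𝒯.neighborFinset hd K, b K L = ∑ L ∈ 𝒯.neighborFinset hd K, b L K) ∧
      ∀ K, ∀ L ∈ 𝒯.neighborFinset hd K, ∀ x y, F n K L x y = b L K * f x - b K L * f y := by
  have hN : ∀ K, ∀ L ∈ 𝒯.neighborFinset hd K, L ∈ 𝒯.neighbors K := fun K L hL =>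
    (𝒯.mem_neighborFinset hd).1 hL
  have hsum := 𝒯.sum_area_mul_normalMean hd hΔt hnT hv hdiv
  rcases hF with rfl | rfl
  · set M := 𝒯.normalMean v Δt id n with hM
    have hsymm : ∀ K, ∀ L ∈ 𝒯.neighborFinset hd K, M L K = -M K L := by
      intro K L hL
      rw [hM, 𝒯.normalMean_symm Δt id n (hN K L hL), normalMean, normalMean]
      simp only [id, integral_neg, intervalIntegral.integral_neg, mul_neg]
    have hba : ∀ K, ∀ L ∈ 𝒯.neighborFinset hd K,
        𝒯.area L K * max (-M L K) 0 = 𝒯.area K L * max (M K L) 0 := by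
      intro K L hL
      rw [hsymm K L hL, neg_neg, 𝒯.area_comm]
    -- `b K L` is the inflow into `K` from `L`. Antisymmetry of the mean normal velocity makes `b L
    -- K` the outflow, so outflow minus inflow is the net flux through the interface.
    refine ⟨fun K L => 𝒯.area K L * max (-M K L) 0, ?_, ?_, ?_, ?_⟩
    · exact fun K L hL => mul_nonneg (𝒯.area_pos (hN K L hL)).le (le_max_right _ _)
    · intro K L hL
      have hpos := 𝒯.area_pos (hN K L hL)
      have h1 := 𝒯.abs_area_mul_normalMean_le (g := id) hΔt hnT (fun s => le_rfl) hv_bdd (hN K L hL)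
      rw [abs_mul, abs_of_pos hpos] at h1
      refine le_trans (mul_le_mul_of_nonneg_left ?_ hpos.le) h1
      exact max_le (neg_le_abs _) (abs_nonneg _)
    · intro K
      rw [Finset.sum_congr rfl (hba K), eq_comm, ← sub_eq_zero, ← Finset.sum_sub_distrib]
      refine Eq.trans (Finset.sum_congr rfl fun L _ => ?_) (hsum K)
      dsimp only
      rcases le_total 0 (M K L) with h | h
      · rw [max_eq_left h, max_eq_right (by linarith)]; ring
      · rw [max_eq_right h, max_eq_left (by linarith)]; ring
    · intro K L hL x y
      dsimp only
      rw [hba K L hL, upwindFlux]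
      change 𝒯.area K L * M K L * f (if 0 ≤ M K L then x else y) = _
      split_ifs with h
      · rw [max_eq_left h, max_eq_right (by linarith)]; ring
      · rw [max_eq_right (by linarith), max_eq_left (by linarith)]; ring
  · set M := 𝒯.normalMean v Δt (fun s => max (-s) 0) n with hM
    have hba : ∀ K, ∀ L ∈ 𝒯.neighborFinset hd K,
        𝒯.area L K * M L K = 𝒯.area K L * 𝒯.normalMean v Δt (fun s => max s 0) n K L := by
      intro K L hL
      rw [hM, 𝒯.normalMean_symm Δt _ n (hN K L hL), 𝒯.area_comm]
      simp only [neg_neg]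
    refine ⟨fun K L => 𝒯.area K L * M K L, ?_, ?_, ?_, ?_⟩
    · intro K L hL
      dsimp only
      rw [hM, 𝒯.area_mul_normalMean Δt _ n (hN K L hL)]
      refine mul_nonneg (one_div_pos.2 hΔt).le (intervalIntegral.integral_nonneg (by nlinarith) ?_)
      exact fun t _ => integral_nonneg fun x => le_max_right _ _
    · intro K L hL
      refine (le_abs_self _).trans (𝒯.abs_area_mul_normalMean_le hΔt hnT ?_ hv_bdd (hN K L hL))
      intro s
      rw [abs_of_nonneg (le_max_right _ _)]
      exact max_le (neg_le_abs _) (abs_nonneg _)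
    · intro K
      rw [Finset.sum_congr rfl (hba K), eq_comm, ← sub_eq_zero, ← Finset.sum_sub_distrib]
      refine Eq.trans (Finset.sum_congr rfl fun L hL => ?_) (hsum K)
      have hi := fun (g : ℝ → ℝ) (hg : Continuous g) =>
        𝒯.intervalIntegrable_interfaceIntegral hΔt hnT hv.continuousOn hg (hN K L hL)
      dsimp only
      -- With pointwise upwinding, `s⁺ - s⁻ = s` is used under the integrals, so integrability in
      -- time and on the interface is required before subtracting.
      rw [hM, 𝒯.area_mul_normalMean Δt _ n (hN K L hL), 𝒯.area_mul_normalMean Δt _ n (hN K L hL),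
        𝒯.area_mul_normalMean Δt _ n (hN K L hL), ← mul_sub,
        ← intervalIntegral.integral_sub (hi _ (by fun_prop)) (hi _ (by fun_prop))]
      congr 1
      refine intervalIntegral.integral_congr fun t ht => ?_
      rw [Set.uIcc_of_le (by nlinarith)] at ht
      have hn0 : 0 ≤ n * Δt := by positivity
      have hcv : Continuous (v t) :=
        (contDiff_slice hv ⟨hn0.trans ht.1, ht.2.trans hnT⟩).continuous
      have hfin : IsFiniteMeasure ((surface d).restrict (interface (𝒯.cell K) (𝒯.cell L))) :=
        ⟨by simpa using (𝒯.surface_interface_ne_top (hN K L hL).1).lt_top⟩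
      have hint : ∀ g : ℝ → ℝ, Continuous g → Integrable
          (fun x => g (inner ℝ (v t x) (𝒯.normal K L)))
          ((surface d).restrict (interface (𝒯.cell K) (𝒯.cell L))) := by
        intro g hg
        have hc : Continuous fun x => g (inner ℝ (v t x) (𝒯.normal K L)) := by fun_prop
        obtain ⟨B, hB⟩ := (𝒯.isCompact_interface K L).exists_bound_of_continuousOn
          hc.continuousOn
        exact Integrable.of_bound hc.measurable.aestronglyMeasurable B
          ((ae_restrict_iff' (isClosed_interface _ _).measurableSet).2 (ae_of_all _ hB))
      simp only [interfaceIntegral]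
      rw [← integral_sub (hint (fun s => max s 0) (by fun_prop))
        (hint (fun s => max (-s) 0) (by fun_prop))]
      refine integral_congr_ae (ae_of_all _ fun x => ?_)
      dsimp only [id]
      rcases le_total 0 (inner ℝ (v t x) (𝒯.normal K L)) with h | h
      · rw [max_eq_left h, max_eq_right (by linarith)]; ring
      · rw [max_eq_right h, max_eq_left (by linarith)]; ring
    · intro K L hL x y
      dsimp only
      rw [hba K L hL, splitUpwindFlux, hM]
      ring

end Step

end AdmissibleMesh

end Flux

/-! ### Square integrable functions -/

section SquareIntegrable

variable {X : Type*} {mX : MeasurableSpace X} {μ : Measure X}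

theorem eLpNorm_two_sq (f : X → ℝ) : eLpNorm f 2 μ ^ 2 = ∫⁻ x, ENNReal.ofReal (f x ^ 2) ∂μ := by
  have h := eLpNorm_nnreal_pow_eq_lintegral (μ := μ) (f := f) (p := 2) two_ne_zero
  have h2 : ((2 : ℝ≥0) : ℝ≥0∞) = 2 := rfl
  rw [h2] at h
  have h3 : ((2 : ℝ≥0) : ℝ) = (2 : ℕ) := by norm_num
  rw [h3, ENNReal.rpow_natCast] at h
  rw [h]
  refine lintegral_congr fun x => ?_
  rw [ENNReal.rpow_natCast, ← ofReal_norm, ← ENNReal.ofReal_pow (norm_nonneg _), Real.norm_eq_abs,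
    sq_abs]

theorem eLpNorm_two_sq_eq_integral {f : X → ℝ} (hf : MemLp f 2 μ) :
    eLpNorm f 2 μ ^ 2 = ENNReal.ofReal (∫ x, f x ^ 2 ∂μ) := by
  rw [eLpNorm_two_sq, ofReal_integral_eq_lintegral_ofReal hf.integrable_sq
    (ae_of_all _ fun x => sq_nonneg _)]

theorem enorm_integral_mul_le {f g : X → ℝ} (hf : AEStronglyMeasurable f μ)
    (hg : AEStronglyMeasurable g μ) :
    ‖∫ x, f x * g x ∂μ‖ₑ ≤ eLpNorm f 2 μ * eLpNorm g 2 μ := by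
  refine (enorm_integral_le_lintegral_enorm _).trans ?_
  have h := eLpNorm_smul_le_mul_eLpNorm (p := 2) (q := 2) (r := 1) hg hf
  rw [eLpNorm_one_eq_lintegral_enorm] at h
  exact h

theorem integral_sum_sq_of_orthogonal {κ : Type*} [Fintype κ] {Z : κ → X → ℝ}
    (hZ : ∀ k, MemLp (Z k) 2 μ) (horth : ∀ k l, k ≠ l → ∫ x, Z k x * Z l x ∂μ = 0) :
    ∫ x, (∑ k, Z k x) ^ 2 ∂μ = ∑ k, ∫ x, Z k x ^ 2 ∂μ := by
  classical
  have hi : ∀ k l, Integrable (fun x => Z k x * Z l x) μ := fun k l =>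
    (hZ k).integrable_mul (hZ l)
  simp_rw [sq, Finset.sum_mul_sum]
  rw [integral_finsetSum _ fun k _ => integrable_finsetSum _ fun l _ => hi k l]
  refine Finset.sum_congr rfl fun k _ => ?_
  rw [integral_finsetSum _ fun l _ => hi k l, Finset.sum_eq_single k]
  · intro l _ hl
    exact horth k l hl.symm
  · simp

/-- A subsequence converges almost everywhere, and its pointwise limit is a version of `g`
measurable for the smaller σ-algebra. -/
theorem aestronglyMeasurable_of_tendsto_eLpNorm {m' : MeasurableSpace X} (hm : m' ≤ mX)
    {f : ℕ → X → ℝ} {g : X → ℝ} (hf : ∀ k, StronglyMeasurable[m'] (f k))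
    (hg : AEStronglyMeasurable[mX] g μ)
    (h : Tendsto (fun k => eLpNorm (fun x => f k x - g x) 2 μ) atTop (𝓝 0)) :
    AEStronglyMeasurable[m'] g μ := by
  have hmeas := tendstoInMeasure_of_tendsto_eLpNorm two_ne_zero
    (fun k => ((hf k).mono hm).aestronglyMeasurable) hg h
  obtain ⟨ns, -, hns⟩ := hmeas.exists_seq_tendsto_ae
  refine ⟨fun x => limUnder atTop fun i => f (ns i) x, ?_, ?_⟩
  · exact StronglyMeasurable.limUnder fun i => hf (ns i)
  · filter_upwards [hns] with x hx
    exact hx.limUnder_eq.symm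

end SquareIntegrable

/-! ### The Itô isometry for compensated Poisson integrals -/

section PoissonMoments

/-- The identity `E[X φ(X)] = r E[φ(X + 1)]` for a Poisson variable, from `n / n! = 1 / (n - 1)!`.
Taking `φ = 1` and then `φ(n) = n` gives the first two moments. -/
theorem hasSum_poisson_shift (r : ℝ≥0) {φ : ℕ → ℝ} {a : ℝ}
    (h : HasSum (fun n : ℕ => Real.exp (-r) * r ^ n / n.factorial * φ (n + 1)) a) :
    HasSum (fun n : ℕ => Real.exp (-r) * r ^ n / n.factorial * (n * φ n)) (r * a) := by
  rw [← hasSum_nat_add_iff' 1]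
  simp only [Finset.range_one, Finset.sum_singleton, Nat.cast_zero, zero_mul, mul_zero, sub_zero]
  refine (h.mul_left (r : ℝ)).congr_fun fun n => ?_
  rw [Nat.factorial_succ]
  have : ((n : ℝ) + 1) ≠ 0 := by positivity
  push_cast
  field_simp
  ring

theorem hasSum_poisson_id (r : ℝ≥0) :
    HasSum (fun n : ℕ => Real.exp (-r) * r ^ n / n.factorial * (n : ℝ)) r := by
  have h := hasSum_poisson_shift r (φ := fun _ => 1) (a := 1)
    (by simpa using hasSum_one_poissonMeasure r)
  simpa using h

theorem hasSum_poisson_sq (r : ℝ≥0) :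
    HasSum (fun n : ℕ => Real.exp (-r) * r ^ n / n.factorial * (n : ℝ) ^ 2) (r * (r + 1)) := by
  have h := hasSum_poisson_shift r (φ := fun n => n) (a := r + 1) (by
    refine ((hasSum_poisson_id r).add (hasSum_one_poissonMeasure r)).congr_fun fun n => ?_
    push_cast; ring)
  refine h.congr_fun fun n => ?_
  ring

theorem memLp_poisson (r : ℝ≥0) : MemLp (fun k : ℕ => (k : ℝ) - r) 2 (poissonMeasure r) := by
  have h : MemLp (fun k : ℕ => (k : ℝ)) 2 (poissonMeasure r) := by
    rw [memLp_two_iff_integrable_sq .of_discrete, integrable_poissonMeasure_iff]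
    refine (hasSum_poisson_sq r).summable.congr fun n => ?_
    rw [Real.norm_of_nonneg (sq_nonneg _)]
  exact h.sub (memLp_const _)

theorem integral_poisson_sub (r : ℝ≥0) : ∫ k : ℕ, ((k : ℝ) - r) ∂(poissonMeasure r) = 0 := by
  rw [integral_poissonMeasure]
  have h := (hasSum_poisson_id r).sub ((hasSum_one_poissonMeasure r).mul_right (r : ℝ))
  rw [one_mul, sub_self] at h
  refine Eq.trans (tsum_congr fun n => ?_) h.tsum_eq
  rw [smul_eq_mul]; ring

theorem integral_poisson_sub_sq (r : ℝ≥0) :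
    ∫ k : ℕ, ((k : ℝ) - r) ^ 2 ∂(poissonMeasure r) = r := by
  rw [integral_poissonMeasure]
  have h := ((hasSum_poisson_sq r).sub ((hasSum_poisson_id r).mul_right (2 * (r : ℝ)))).add
    ((hasSum_one_poissonMeasure r).mul_right ((r : ℝ) ^ 2))
  have h2 : (r : ℝ) * (r + 1) - r * (2 * r) + 1 * r ^ 2 = r := by ring
  rw [h2] at h
  refine Eq.trans (tsum_congr fun n => ?_) h.tsum_eq
  rw [smul_eq_mul]; ring

end PoissonMoments

section ItoIsometry

variable {Ω E : Type*} {mΩ : MeasurableSpace Ω} [MeasurableSpace E] {P : Measure Ω}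
  {ℱ : Filtration ℝ≥0 mΩ} {m : Measure E} {Nm : Ω → Measure (ℝ × E)}

/-- The compensated measure of `(s,t] × A`. -/
noncomputable def increment (m : Measure E) (Nm : Ω → Measure (ℝ × E)) (s t : ℝ≥0) (A : Set E)
    (ω : Ω) : ℝ :=
  (Nm ω (Set.Ioc (s : ℝ) t ×ˢ A)).toReal - ((t : ℝ) - s) * (m A).toReal

theorem intensity_Ioc_prod [SigmaFinite m] (s t : ℝ≥0) (A : Set E) :
    ((volume.restrict (Set.Ici (0 : ℝ))).prod m) (Set.Ioc (s : ℝ) t ×ˢ A) =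
      ENNReal.ofReal ((t : ℝ) - s) * m A := by
  have h : Set.Ioc (s : ℝ) t ∩ Set.Ici 0 = Set.Ioc (s : ℝ) t :=
    Set.inter_eq_left.2 fun x hx => s.2.trans hx.1.le
  rw [Measure.prod_prod, Measure.restrict_apply measurableSet_Ioc, h, Real.volume_Ioc]

namespace IsFiltrationPoisson

variable (hNm : IsFiltrationPoisson P ℱ m Nm)
include hNm

theorem measurable_increment (s t : ℝ≥0) {A : Set E} (hA : MeasurableSet A) :
    Measurable (increment m Nm s t A) :=
  ((hNm.poisson.measurable _ (measurableSet_Ioc.prod hA)).ennreal_toReal).sub_const _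

theorem measurable_increment_filtration (s t : ℝ≥0) {A : Set E} (hA : MeasurableSet A) :
    Measurable[ℱ t] (increment m Nm s t A) := by
  refine ((hNm.adapted t _ (measurableSet_Ioc.prod hA) ?_).ennreal_toReal).sub_const _
  rintro ⟨x, z⟩ ⟨hx, -⟩
  exact ⟨⟨s.2.trans hx.1.le, hx.2⟩, trivial⟩

theorem law_increment [SigmaFinite m] {s t : ℝ≥0} (hst : s ≤ t) {A : Set E}
    (hA : MeasurableSet A) (hAm : m A ≠ ∞) :
    ∃ r : ℝ≥0, (r : ℝ) = ((t : ℝ) - s) * (m A).toReal ∧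
      P.map (increment m Nm s t A) = (poissonMeasure r).map fun k : ℕ => (k : ℝ) - r := by
  have hB : MeasurableSet (Set.Ioc (s : ℝ) t ×ˢ A) := measurableSet_Ioc.prod hA
  have hfin : ((volume.restrict (Set.Ici (0 : ℝ))).prod m) (Set.Ioc (s : ℝ) t ×ˢ A) ≠ ∞ := by
    rw [intensity_Ioc_prod]
    exact ENNReal.mul_ne_top ENNReal.ofReal_ne_top hAm
  have hlaw := hNm.poisson.law _ hB hfin
  set r := (((volume.restrict (Set.Ici (0 : ℝ))).prod m) (Set.Ioc (s : ℝ) t ×ˢ A)).toNNReal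
    with hr
  have hr' : (r : ℝ) = ((t : ℝ) - s) * (m A).toReal := by
    rw [hr, ENNReal.coe_toNNReal_eq_toReal, intensity_Ioc_prod, ENNReal.toReal_mul,
      ENNReal.toReal_ofReal (sub_nonneg.2 (NNReal.coe_le_coe.2 hst))]
  refine ⟨r, hr', ?_⟩
  have hφ : Measurable fun x : ℝ≥0∞ => x.toReal - (r : ℝ) := by fun_prop
  have h1 : increment m Nm s t A =
      (fun x : ℝ≥0∞ => x.toReal - (r : ℝ)) ∘ fun ω => Nm ω (Set.Ioc (s : ℝ) t ×ˢ A) := by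
    ext ω
    simp [increment, hr']
  rw [h1, ← Measure.map_map hφ (hNm.poisson.measurable _ hB), hlaw,
    Measure.map_map hφ .of_discrete]
  rfl

theorem memLp_increment [SigmaFinite m] {s t : ℝ≥0} (hst : s ≤ t) {A : Set E}
    (hA : MeasurableSet A) (hAm : m A ≠ ∞) : MemLp (increment m Nm s t A) 2 P := by
  obtain ⟨r, -, hlaw⟩ := hNm.law_increment hst hA hAm
  have h := memLp_poisson r
  have h1 : MemLp id 2 (P.map (increment m Nm s t A)) := by
    rw [hlaw, memLp_map_measure_iff measurable_id.aestronglyMeasurable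
      Measurable.of_discrete.aemeasurable]
    exact h
  exact (memLp_map_measure_iff measurable_id.aestronglyMeasurable
    (hNm.measurable_increment s t hA).aemeasurable).1 h1

theorem integral_increment [SigmaFinite m] {s t : ℝ≥0} (hst : s ≤ t) {A : Set E}
    (hA : MeasurableSet A) (hAm : m A ≠ ∞) : ∫ ω, increment m Nm s t A ω ∂P = 0 := by
  obtain ⟨r, -, hlaw⟩ := hNm.law_increment hst hA hAm
  have h1 := integral_map (hNm.measurable_increment s t hA).aemeasurable
    (μ := P) (f := fun x : ℝ => x) measurable_id.aestronglyMeasurable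
  rw [← h1, hlaw, integral_map (f := fun x : ℝ => x) Measurable.of_discrete.aemeasurable
    measurable_id.aestronglyMeasurable]
  exact integral_poisson_sub r

theorem integral_increment_sq [SigmaFinite m] {s t : ℝ≥0} (hst : s ≤ t) {A : Set E}
    (hA : MeasurableSet A) (hAm : m A ≠ ∞) :
    ∫ ω, increment m Nm s t A ω ^ 2 ∂P = ((t : ℝ) - s) * (m A).toReal := by
  obtain ⟨r, hr, hlaw⟩ := hNm.law_increment hst hA hAm
  have hm : Measurable fun x : ℝ => x ^ 2 := by fun_prop
  have h1 := integral_map (hNm.measurable_increment s t hA).aemeasurable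
    (μ := P) (f := fun x : ℝ => x ^ 2) hm.aestronglyMeasurable
  rw [← h1, hlaw, integral_map Measurable.of_discrete.aemeasurable hm.aestronglyMeasurable, ← hr]
  exact integral_poisson_sub_sq r

/-- A measurable function of increments after time `s` is independent of the past. -/
theorem integral_mul_future {s : ℝ≥0} {Y Z : Ω → ℝ} (hY : Measurable[ℱ s] Y)
    (hZ : Measurable[⨆ B : {B : Set (ℝ × E) // MeasurableSet B ∧
      B ⊆ Set.Ioi (s : ℝ) ×ˢ Set.univ}, MeasurableSpace.comap (fun ω => Nm ω B.1) inferInstance] Z)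
    (hZ' : Measurable Z) :
    ∫ ω, Y ω * Z ω ∂P = (∫ ω, Y ω ∂P) * ∫ ω, Z ω ∂P := by
  have hind : IndepFun Z Y P := by
    rw [IndepFun_iff_Indep]
    exact indep_of_indep_of_le (hNm.indep_future s) hZ.comap_le hY.comap_le
  exact hind.symm.integral_fun_mul_eq_mul_integral (hY.mono (ℱ.le s) le_rfl).aestronglyMeasurable
    hZ'.aestronglyMeasurable

omit hNm in
theorem _root_.UpwindFV.measurable_increment_future (s t : ℝ≥0) {A : Set E}
    (hA : MeasurableSet A) :
    Measurable[⨆ B : {B : Set (ℝ × E) // MeasurableSet B ∧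
      B ⊆ Set.Ioi (s : ℝ) ×ˢ Set.univ}, MeasurableSpace.comap (fun ω => Nm ω B.1) inferInstance]
      (increment m Nm s t A) := by
  let B : {B : Set (ℝ × E) // MeasurableSet B ∧ B ⊆ Set.Ioi (s : ℝ) ×ˢ Set.univ} :=
    ⟨Set.Ioc (s : ℝ) t ×ˢ A, measurableSet_Ioc.prod hA, fun x hx => ⟨hx.1.1, trivial⟩⟩
  have h : Measurable[⨆ B : {B : Set (ℝ × E) // MeasurableSet B ∧
      B ⊆ Set.Ioi (s : ℝ) ×ˢ Set.univ}, MeasurableSpace.comap (fun ω => Nm ω B.1) inferInstance]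
      (fun ω => Nm ω (Set.Ioc (s : ℝ) t ×ˢ A)) :=
    measurable_iff_comap_le.2 (le_iSup (fun B : {B : Set (ℝ × E) // MeasurableSet B ∧
      B ⊆ Set.Ioi (s : ℝ) ×ˢ Set.univ} =>
        MeasurableSpace.comap (fun ω => Nm ω B.1) inferInstance) B)
  exact h.ennreal_toReal.sub_const _

theorem integral_mul_increment [SigmaFinite m] {s t : ℝ≥0} (hst : s ≤ t) {A : Set E}
    (hA : MeasurableSet A) (hAm : m A ≠ ∞) {Y : Ω → ℝ} (hY : Measurable[ℱ s] Y) :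
    ∫ ω, Y ω * increment m Nm s t A ω ∂P = 0 := by
  rw [hNm.integral_mul_future hY (measurable_increment_future s t hA)
    (hNm.measurable_increment s t hA), hNm.integral_increment hst hA hAm, mul_zero]

/-- A Poisson random measure has independent values on disjoint sets, and the increments are
centred. -/
theorem integral_increment_mul_increment [SigmaFinite m] {s t : ℝ≥0} (hst : s ≤ t) {A A' : Set E}
    (hA : MeasurableSet A) (hAm : m A ≠ ∞) (hA' : MeasurableSet A') (hAA' : Disjoint A A') :
    ∫ ω, increment m Nm s t A ω * increment m Nm s t A' ω ∂P = 0 := by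
  have hi := hNm.poisson.indep 2 ![Set.Ioc (s : ℝ) t ×ˢ A, Set.Ioc (s : ℝ) t ×ˢ A'] (by
      intro i; fin_cases i
      · exact measurableSet_Ioc.prod hA
      · exact measurableSet_Ioc.prod hA') (by
      have h0 : Disjoint (Set.Ioc (s : ℝ) t ×ˢ A) (Set.Ioc (s : ℝ) t ×ˢ A') :=
        Set.Disjoint.set_prod_right hAA' _ _
      intro i j hij
      fin_cases i <;> fin_cases j <;> first | exact absurd rfl hij | exact h0 | exact h0.symm)
  have hind := hi.indepFun (i := 0) (j := 1) (by decide)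
  have hind' : IndepFun (increment m Nm s t A) (increment m Nm s t A') P :=
    hind.comp (φ := fun x : ℝ≥0∞ => x.toReal - ((t : ℝ) - s) * (m A).toReal)
      (ψ := fun x : ℝ≥0∞ => x.toReal - ((t : ℝ) - s) * (m A').toReal)
      (by fun_prop) (by fun_prop)
  rw [hind'.integral_fun_mul_eq_mul_integral
    (hNm.measurable_increment s t hA).aestronglyMeasurable
    (hNm.measurable_increment s t hA').aestronglyMeasurable, hNm.integral_increment hst hA hAm,
    zero_mul]

end IsFiltrationPoisson

namespace SimplePredictable

variable {a b : ℝ≥0} (S : SimplePredictable ℱ m a b)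

/-- The summands of the integral of a simple predictable function. -/
noncomputable def term (Nm : Ω → Measure (ℝ × E)) (k : Fin S.p × Fin S.q) (ω : Ω) : ℝ :=
  S.ξ k.1 k.2 ω * increment m Nm (S.τ k.1) (S.τ (k.1 + 1)) (S.A k.2) ω

theorem integral_eq_sum_term (ω : Ω) : S.integral Nm ω = ∑ k, S.term Nm k ω := by
  rw [Fintype.sum_prod_type]
  rfl

theorem τ_le_succ (i : ℕ) : S.τ i ≤ S.τ (i + 1) := S.τ_mono (Nat.le_succ i)

theorem τ_succ_le_last (i : Fin S.p) : S.τ (i + 1) ≤ b := by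
  conv_rhs => rw [← S.τ_last]
  exact S.τ_mono i.2

theorem le_τ (i : ℕ) : a ≤ S.τ i := by
  conv_lhs => rw [← S.τ_zero]
  exact S.τ_mono (Nat.zero_le i)

theorem measurable_ξ (i : Fin S.p) (j : Fin S.q) : Measurable (S.ξ i j) :=
  (S.ξ_meas i j).mono (ℱ.le _) le_rfl

section

variable (hNm : IsFiltrationPoisson P ℱ m Nm)
include hNm

theorem measurable_term (k : Fin S.p × Fin S.q) : Measurable[ℱ (S.τ (k.1 + 1))] (S.term Nm k) :=
  ((S.ξ_meas k.1 k.2).mono (ℱ.mono (S.τ_le_succ _)) le_rfl).mul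
    (hNm.measurable_increment_filtration _ _ (S.A_meas _))

theorem memLp_term [SigmaFinite m] (k : Fin S.p × Fin S.q) : MemLp (S.term Nm k) 2 P := by
  obtain ⟨C, hC⟩ := S.ξ_bdd
  refine (hNm.memLp_increment (S.τ_le_succ k.1) (S.A_meas k.2) (S.A_fin k.2)).of_le_mul (c := C)
    ((S.measurable_term hNm k).mono (ℱ.le _) le_rfl).aestronglyMeasurable
    (ae_of_all _ fun ω => ?_)
  rw [term, norm_mul]
  exact mul_le_mul_of_nonneg_right (hC _ _ _) (norm_nonneg _)

/-- The earlier term and the later coefficient are both known at the start of the later interval,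
whose increment is centred and independent of them. -/
theorem integral_term_mul_term_of_lt [SigmaFinite m] {k l : Fin S.p × Fin S.q}
    (h : k.1 < l.1) : ∫ ω, S.term Nm k ω * S.term Nm l ω ∂P = 0 := by
  have hY : Measurable[ℱ (S.τ l.1)] fun ω => S.term Nm k ω * S.ξ l.1 l.2 ω :=
    ((S.measurable_term hNm k).mono (ℱ.mono (S.τ_mono h)) le_rfl).mul (S.ξ_meas l.1 l.2)
  rw [← hNm.integral_mul_increment (S.τ_le_succ l.1) (S.A_meas l.2) (S.A_fin l.2) hY]
  simp only [term, mul_assoc]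

theorem integral_term_mul_term [SigmaFinite m] {k l : Fin S.p × Fin S.q} (h : k ≠ l) :
    ∫ ω, S.term Nm k ω * S.term Nm l ω ∂P = 0 := by
  rcases lt_trichotomy k.1 l.1 with hlt | heq | hgt
  · exact S.integral_term_mul_term_of_lt hNm hlt
  · obtain ⟨i, j⟩ := k
    obtain ⟨i', j'⟩ := l
    dsimp only at heq
    subst heq
    have hj : j ≠ j' := fun hj => h (by rw [hj])
    have hY : Measurable[ℱ (S.τ i)] fun ω => S.ξ i j ω * S.ξ i j' ω :=
      (S.ξ_meas i j).mul (S.ξ_meas i j')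
    -- On the same time interval, the product of the coefficients is known at its start and the
    -- product of the increments is independent of it.
    have h1 := hNm.integral_mul_future hY
      ((measurable_increment_future (m := m) (S.τ i) (S.τ (i + 1)) (S.A_meas j)).mul
        (measurable_increment_future (m := m) (S.τ i) (S.τ (i + 1)) (S.A_meas j')))
      ((hNm.measurable_increment _ _ (S.A_meas j)).mul
        (hNm.measurable_increment _ _ (S.A_meas j')))
    have h2 := hNm.integral_increment_mul_increment (S.τ_le_succ i) (S.A_meas j) (S.A_fin j)
      (S.A_meas j') (S.A_disj hj)
    simp only [Pi.mul_apply] at h1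
    rw [h2, mul_zero] at h1
    rw [← h1]
    refine integral_congr_ae (ae_of_all _ fun ω => ?_)
    simp only [term]
    ring
  · rw [← S.integral_term_mul_term_of_lt hNm hgt]
    simp only [mul_comm]

theorem integral_term_sq [SigmaFinite m] (k : Fin S.p × Fin S.q) :
    ∫ ω, S.term Nm k ω ^ 2 ∂P = (∫ ω, S.ξ k.1 k.2 ω ^ 2 ∂P) *
      (((S.τ (k.1 + 1) : ℝ) - S.τ k.1) * (m (S.A k.2)).toReal) := by
  have h1 := hNm.integral_mul_future ((S.ξ_meas k.1 k.2).pow_const 2)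
    ((measurable_increment_future (m := m) (S.τ k.1) (S.τ (k.1 + 1)) (S.A_meas k.2)).pow_const 2)
    ((hNm.measurable_increment _ _ (S.A_meas k.2)).pow_const 2)
  rw [hNm.integral_increment_sq (S.τ_le_succ k.1) (S.A_meas k.2) (S.A_fin k.2)] at h1
  rw [← h1]
  simp only [term, mul_pow]

theorem memLp_integral [SigmaFinite m] : MemLp (S.integral Nm) 2 P := by
  have : S.integral Nm = fun ω => ∑ k, S.term Nm k ω := funext S.integral_eq_sum_term
  rw [this]
  exact memLp_finsetSum _ fun k _ => S.memLp_term hNm k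

theorem stronglyMeasurable_integral : StronglyMeasurable[ℱ b] (S.integral Nm) := by
  have : S.integral Nm = fun ω => ∑ k, S.term Nm k ω := funext S.integral_eq_sum_term
  rw [this]
  refine Measurable.stronglyMeasurable ?_
  exact Finset.measurable_sum _ fun k _ =>
    (S.measurable_term hNm k).mono (ℱ.mono (S.τ_succ_le_last k.1)) le_rfl

/-- `Y` may be absorbed into the coefficients, which stay measurable at the start of their
intervals; each increment is centred given that past. -/
theorem integral_mul_eq_zero [SigmaFinite m] {Y : Ω → ℝ} (hY : MemLp Y 2 P)
    (hYm : Measurable[ℱ a] Y) : ∫ ω, Y ω * S.integral Nm ω ∂P = 0 := by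
  simp_rw [S.integral_eq_sum_term, Finset.mul_sum]
  have hi : ∀ k, Integrable (fun ω => Y ω * S.term Nm k ω) P := fun k =>
    hY.integrable_mul (S.memLp_term hNm k)
  rw [integral_finsetSum _ fun k _ => hi k]
  refine Finset.sum_eq_zero fun k _ => ?_
  have hY' : Measurable[ℱ (S.τ k.1)] fun ω => Y ω * S.ξ k.1 k.2 ω :=
    (hYm.mono (ℱ.mono (S.le_τ _)) le_rfl).mul (S.ξ_meas k.1 k.2)
  rw [← hNm.integral_mul_increment (S.τ_le_succ k.1) (S.A_meas k.2) (S.A_fin k.2) hY']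
  simp only [term, mul_assoc]

end

/-- The summands of a simple predictable function. -/
noncomputable def summand (k : Fin S.p × Fin S.q) (y : Ω × (ℝ × E)) : ℝ :=
  S.ξ k.1 k.2 y.1 * ((Set.Ioc (S.τ k.1 : ℝ) (S.τ (k.1 + 1)) ×ˢ S.A k.2).indicator 1 y.2)

theorem toFun_eq_sum_summand (y : Ω × (ℝ × E)) :
    S.toFun y.1 y.2.1 y.2.2 = ∑ k, S.summand k y := by
  rw [Fintype.sum_prod_type]
  refine Finset.sum_congr rfl fun i _ => Finset.sum_congr rfl fun j _ => ?_
  have : (Set.Ioc (S.τ i : ℝ) (S.τ (i + 1)) ×ˢ S.A j).indicator (1 : ℝ × E → ℝ) y.2 =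
      (Set.Ioc (S.τ i : ℝ) (S.τ (i + 1))).indicator 1 y.2.1 * (S.A j).indicator 1 y.2.2 := by
    by_cases h1 : y.2.1 ∈ Set.Ioc (S.τ i : ℝ) (S.τ (i + 1)) <;> by_cases h2 : y.2.2 ∈ S.A j <;>
      simp [Set.indicator, Set.mem_prod, h1, h2]
  simp only [summand, this, mul_assoc]

theorem measurable_summand (k : Fin S.p × Fin S.q) : Measurable (S.summand k) :=
  ((S.measurable_ξ k.1 k.2).comp measurable_fst).mul
    ((measurable_one.indicator (measurableSet_Ioc.prod (S.A_meas k.2))).comp measurable_snd)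

theorem summand_mul_summand {k l : Fin S.p × Fin S.q} (h : k ≠ l) (y : Ω × (ℝ × E)) :
    S.summand k y * S.summand l y = 0 := by
  by_cases hk : y.2 ∈ Set.Ioc (S.τ k.1 : ℝ) (S.τ (k.1 + 1)) ×ˢ S.A k.2
  · by_cases hl : y.2 ∈ Set.Ioc (S.τ l.1 : ℝ) (S.τ (l.1 + 1)) ×ˢ S.A l.2
    · exfalso
      have hlt : ∀ i j : Fin S.p, i < j → y.2.1 ∈ Set.Ioc (S.τ i : ℝ) (S.τ (i + 1)) →
          y.2.1 ∉ Set.Ioc (S.τ j : ℝ) (S.τ (j + 1)) := by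
        intro i j hij hi hj
        have : (S.τ (i + 1) : ℝ) ≤ S.τ j := NNReal.coe_le_coe.2 (S.τ_mono hij)
        linarith [hi.2, hj.1]
      rcases lt_trichotomy k.1 l.1 with h1 | h1 | h1
      · exact hlt _ _ h1 hk.1 hl.1
      · have h2 : k.2 ≠ l.2 := fun h2 => h (Prod.ext h1 h2)
        exact Set.disjoint_left.1 (S.A_disj h2) hk.2 hl.2
      · exact hlt _ _ h1 hl.1 hk.1
    · rw [summand, summand, Set.indicator_of_notMem hl]; simp
  · rw [summand, summand, Set.indicator_of_notMem hk]; simp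

theorem lintegral_summand_sq [SigmaFinite m] [SFinite P] (k : Fin S.p × Fin S.q) :
    ∫⁻ y, ENNReal.ofReal (S.summand k y ^ 2)
        ∂(P.prod ((volume.restrict (Set.Ioc (a : ℝ) b)).prod m)) =
      (∫⁻ ω, ENNReal.ofReal (S.ξ k.1 k.2 ω ^ 2) ∂P) *
        (ENNReal.ofReal ((S.τ (k.1 + 1) : ℝ) - S.τ k.1) * m (S.A k.2)) := by
  set B := Set.Ioc (S.τ k.1 : ℝ) (S.τ (k.1 + 1)) ×ˢ S.A k.2 with hB
  have hBm : MeasurableSet B := measurableSet_Ioc.prod (S.A_meas k.2)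
  have h1 : ∀ y : Ω × (ℝ × E), ENNReal.ofReal (S.summand k y ^ 2) =
      ENNReal.ofReal (S.ξ k.1 k.2 y.1 ^ 2) * B.indicator 1 y.2 := by
    intro y
    by_cases h : y.2 ∈ B
    · rw [summand, Set.indicator_of_mem h, Set.indicator_of_mem h]; simp
    · rw [summand, Set.indicator_of_notMem h, Set.indicator_of_notMem h]; simp
  simp_rw [h1]
  rw [lintegral_prod_mul ((S.measurable_ξ k.1 k.2).pow_const 2).ennreal_ofReal.aemeasurable
    (measurable_one.indicator hBm).aemeasurable, lintegral_indicator_one hBm, hB,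
    Measure.prod_prod, Measure.restrict_apply measurableSet_Ioc]
  congr 3
  rw [Set.inter_eq_left.2, Real.volume_Ioc]
  exact Set.Ioc_subset_Ioc (NNReal.coe_le_coe.2 (S.le_τ _))
    (NNReal.coe_le_coe.2 (S.τ_succ_le_last _))

theorem memLp_ξ [IsFiniteMeasure P] (i : Fin S.p) (j : Fin S.q) : MemLp (S.ξ i j) 2 P := by
  obtain ⟨C, hC⟩ := S.ξ_bdd
  exact MemLp.of_bound (S.measurable_ξ i j).aestronglyMeasurable C
    (ae_of_all _ fun ω => hC i j ω)

/-- The Itô isometry for simple predictable functions. -/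
theorem eLpNorm_integral [SigmaFinite m] [IsFiniteMeasure P]
    (hNm : IsFiltrationPoisson P ℱ m Nm) :
    eLpNorm (S.integral Nm) 2 P = eLpNorm (fun y : Ω × (ℝ × E) => S.toFun y.1 y.2.1 y.2.2) 2
      (P.prod ((volume.restrict (Set.Ioc (a : ℝ) b)).prod m)) := by
  have hsq : ∀ k, ENNReal.ofReal (∫ ω, S.term Nm k ω ^ 2 ∂P) =
      ∫⁻ y, ENNReal.ofReal (S.summand k y ^ 2)
        ∂(P.prod ((volume.restrict (Set.Ioc (a : ℝ) b)).prod m)) := by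
    intro k
    have hτ : 0 ≤ (S.τ (k.1 + 1) : ℝ) - S.τ k.1 :=
      sub_nonneg.2 (NNReal.coe_le_coe.2 (S.τ_le_succ _))
    rw [S.integral_term_sq hNm, S.lintegral_summand_sq, ENNReal.ofReal_mul
      (integral_nonneg fun _ => sq_nonneg _), ENNReal.ofReal_mul hτ,
      ENNReal.ofReal_toReal (S.A_fin k.2),
      ofReal_integral_eq_lintegral_ofReal (S.memLp_ξ k.1 k.2).integrable_sq
        (ae_of_all _ fun _ => sq_nonneg _)]
  have h : eLpNorm (S.integral Nm) 2 P ^ 2 =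
      eLpNorm (fun y : Ω × (ℝ × E) => S.toFun y.1 y.2.1 y.2.2) 2
      (P.prod ((volume.restrict (Set.Ioc (a : ℝ) b)).prod m)) ^ 2 := by
    rw [eLpNorm_two_sq_eq_integral (S.memLp_integral hNm), eLpNorm_two_sq]
    -- Neither side has cross terms: the terms of the integral are orthogonal, the summands of the
    -- integrand have disjoint supports. The squares agree term by term by `hsq`.
    simp_rw [S.integral_eq_sum_term, S.toFun_eq_sum_summand]
    rw [integral_sum_sq_of_orthogonal (S.memLp_term hNm) fun k l => S.integral_term_mul_term hNm,
      ENNReal.ofReal_sum_of_nonneg fun k _ => integral_nonneg fun _ => sq_nonneg _]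
    simp_rw [hsq]
    rw [← lintegral_finsetSum _ fun k _ => ((S.measurable_summand k).pow_const 2).ennreal_ofReal]
    refine lintegral_congr fun y => ?_
    rw [← ENNReal.ofReal_sum_of_nonneg fun k _ => sq_nonneg _]
    congr 1
    rw [sq, Finset.sum_mul_sum]
    refine Finset.sum_congr rfl fun k _ => ?_
    rw [Finset.sum_eq_single k]
    · rw [sq]
    · intro l _ hl
      exact S.summand_mul_summand hl.symm y
    · simp
  exact (ENNReal.pow_right_strictMono two_ne_zero).injective h

theorem measurable_toFun :
    Measurable fun y : Ω × (ℝ × E) => S.toFun y.1 y.2.1 y.2.2 := by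
  simp_rw [S.toFun_eq_sum_summand]
  exact Finset.measurable_sum _ fun k _ => S.measurable_summand k

end SimplePredictable

namespace IsStochIntegral

variable {a b : ℝ≥0} {ζ : Ω → ℝ → E → ℝ} {I : Ω → ℝ}

/-- The Itô isometry (as an inequality). -/
theorem eLpNorm_le [SigmaFinite m] [IsFiniteMeasure P] (hNm : IsFiltrationPoisson P ℱ m Nm)
    (hI : IsStochIntegral P ℱ m Nm a b ζ I)
    (hζ : AEStronglyMeasurable (fun y : Ω × (ℝ × E) => ζ y.1 y.2.1 y.2.2)
      (P.prod ((volume.restrict (Set.Ioc (a : ℝ) b)).prod m))) :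
    eLpNorm I 2 P ≤ eLpNorm (fun y : Ω × (ℝ × E) => ζ y.1 y.2.1 y.2.2) 2
      (P.prod ((volume.restrict (Set.Ioc (a : ℝ) b)).prod m)) := by
  obtain ⟨hI2, S, h1, h2⟩ := hI
  -- The bound is the limit of `‖I‖ ≤ ‖S_k.integral - I‖ + ‖S_k - ζ‖ + ‖ζ‖`, in which the isometry
  -- has been applied to `S_k`.
  have hlim := (h2.add h1).add_const
    (eLpNorm (fun y : Ω × (ℝ × E) => ζ y.1 y.2.1 y.2.2) 2
      (P.prod ((volume.restrict (Set.Ioc (a : ℝ) b)).prod m)))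
  rw [zero_add, zero_add] at hlim
  refine ge_of_tendsto' hlim fun k => ?_
  have hSI := ((S k).memLp_integral hNm).1
  have hST : AEStronglyMeasurable (fun y : Ω × (ℝ × E) => (S k).toFun y.1 y.2.1 y.2.2)
      (P.prod ((volume.restrict (Set.Ioc (a : ℝ) b)).prod m)) :=
    (S k).measurable_toFun.aestronglyMeasurable
  have e1 : eLpNorm I 2 P ≤ eLpNorm (fun ω => (S k).integral Nm ω - I ω) 2 P
      + eLpNorm ((S k).integral Nm) 2 P := by
    have h := eLpNorm_sub_le (p := 2) hSI (hSI.sub hI2.1) one_le_two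
    rw [sub_sub_cancel, add_comm] at h
    exact h
  have e2 : eLpNorm (fun y : Ω × (ℝ × E) => (S k).toFun y.1 y.2.1 y.2.2) 2
      (P.prod ((volume.restrict (Set.Ioc (a : ℝ) b)).prod m)) ≤
      eLpNorm (fun y : Ω × (ℝ × E) =>
        (S k).toFun y.1 y.2.1 y.2.2 - ζ y.1 y.2.1 y.2.2) 2
        (P.prod ((volume.restrict (Set.Ioc (a : ℝ) b)).prod m)) +
      eLpNorm (fun y : Ω × (ℝ × E) => ζ y.1 y.2.1 y.2.2) 2
        (P.prod ((volume.restrict (Set.Ioc (a : ℝ) b)).prod m)) := by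
    have h := eLpNorm_add_le (p := 2) (hST.sub hζ) hζ one_le_two
    rw [sub_add_cancel] at h
    exact h
  rw [(S k).eLpNorm_integral hNm] at e1
  rw [add_assoc]
  exact e1.trans (add_le_add_right e2 _)

theorem aestronglyMeasurable (hNm : IsFiltrationPoisson P ℱ m Nm)
    (hI : IsStochIntegral P ℱ m Nm a b ζ I) : AEStronglyMeasurable[ℱ b] I P := by
  obtain ⟨hI2, S, -, h2⟩ := hI
  exact aestronglyMeasurable_of_tendsto_eLpNorm (ℱ.le b)
    (fun k => (S k).stronglyMeasurable_integral hNm) hI2.1 h2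

/-- The stochastic integral over `(a,b]` is orthogonal to the past. -/
theorem integral_mul_eq_zero [SigmaFinite m] (hNm : IsFiltrationPoisson P ℱ m Nm)
    (hI : IsStochIntegral P ℱ m Nm a b ζ I) {Y : Ω → ℝ} (hY : MemLp Y 2 P)
    (hYm : AEStronglyMeasurable[ℱ a] Y P) : ∫ ω, Y ω * I ω ∂P = 0 := by
  obtain ⟨hI2, S, -, h2⟩ := hI
  have hz : ∀ k, ∫ ω, Y ω * (S k).integral Nm ω ∂P = 0 := by
    intro k
    have hmk := hYm.ae_eq_mk
    rw [← (S k).integral_mul_eq_zero hNm (hY.ae_eq hmk) hYm.stronglyMeasurable_mk.measurable]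
    refine integral_congr_ae ?_
    filter_upwards [hmk] with ω hω
    rw [hω]
  -- Orthogonality passes to the `L²` limit by Cauchy–Schwarz.
  have hle : ∀ k, ‖∫ ω, Y ω * I ω ∂P‖ₑ ≤
      eLpNorm Y 2 P * eLpNorm (fun ω => (S k).integral Nm ω - I ω) 2 P := by
    intro k
    have hSk := (S k).memLp_integral hNm
    have h := enorm_integral_mul_le hY.1 (hSk.1.sub hI2.1)
    have heq : ∫ ω, Y ω * ((S k).integral Nm - I) ω ∂P = -∫ ω, Y ω * I ω ∂P := by
      have i1 : Integrable (fun ω => Y ω * (S k).integral Nm ω) P := hY.integrable_mul hSk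
      have i2 : Integrable (fun ω => Y ω * I ω) P := hY.integrable_mul hI2
      simp only [Pi.sub_apply, mul_sub]
      rw [integral_sub i1 i2, hz k, zero_sub]
    rw [heq, enorm_neg] at h
    exact h
  have hlim := ENNReal.Tendsto.const_mul h2 (a := eLpNorm Y 2 P) (Or.inr hY.2.ne)
  rw [mul_zero] at hlim
  have h0 := ge_of_tendsto' hlim hle
  simpa using h0

end IsStochIntegral

end ItoIsometry

/-! ### Energy estimates for the scheme -/

section Energy

variable {Ω E ι : Type*} {mΩ : MeasurableSpace Ω} [MeasurableSpace E] {d : ℕ}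
  {P : Measure Ω} {ℱ : Filtration ℝ≥0 mΩ} {m : Measure E} {Nm : Ω → Measure (ℝ × E)}
  (𝒯 : AdmissibleMesh d ι)

/-- The energy `∑ |K| E[(u_K)²]`. -/
noncomputable def energy (P : Measure Ω) (w : ι → Ω → ℝ) : ℝ≥0∞ :=
  ∑' K, ENNReal.ofReal (𝒯.vol K) * ∫⁻ ω, ENNReal.ofReal (w K ω ^ 2) ∂P

theorem ofReal_vol (K : ι) : ENNReal.ofReal (𝒯.vol K) = volume (𝒯.cell K) :=
  ENNReal.ofReal_toReal (𝒯.volume_cell_ne_top K)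

theorem energy_eq_lintegral_tsum (hd : 1 ≤ d) {w : ι → Ω → ℝ}
    (hw : ∀ K, AEStronglyMeasurable (w K) P) :
    energy 𝒯 P w = ∫⁻ ω, ∑' K, ENNReal.ofReal (𝒯.vol K * w K ω ^ 2) ∂P := by
  have := 𝒯.countable_index hd
  have hm : ∀ K, AEMeasurable (fun ω => ENNReal.ofReal (w K ω ^ 2)) P := fun K =>
    ((hw K).aemeasurable.pow_const 2).ennreal_ofReal
  have h : ∀ K ω, ENNReal.ofReal (𝒯.vol K * w K ω ^ 2) =
      ENNReal.ofReal (𝒯.vol K) * ENNReal.ofReal (w K ω ^ 2) := fun K ω =>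
    ENNReal.ofReal_mul (𝒯.vol_pos K).le
  simp_rw [h]
  rw [lintegral_tsum fun K => (hm K).const_mul _, energy]
  exact tsum_congr fun K => (lintegral_const_mul'' _ (hm K)).symm

/-- The integral over a control volume is a continuous linear functional on `L²`. -/
theorem exists_inner_eq_setIntegral (K : ι) :
    ∃ φ : Lp ℝ 2 (volume : Measure (EuclideanSpace ℝ (Fin d))),
      ∀ g : Lp ℝ 2 (volume : Measure (EuclideanSpace ℝ (Fin d))),
        ∫ x in 𝒯.cell K, g x = inner ℝ φ g := by
  have hfin : volume (interior (𝒯.cell K)) ≠ ∞ :=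
    ((measure_mono interior_subset).trans_lt (𝒯.volume_cell_ne_top K).lt_top).ne
  refine ⟨indicatorConstLp 2 isOpen_interior.measurableSet hfin (1 : ℝ), fun g => ?_⟩
  rw [L2.inner_indicatorConstLp_one]
  exact (setIntegral_congr_set (𝒯.interior_cell_ae_eq K)).symm

/-- Cauchy–Schwarz against the constant `1` on each cell, then disjointness of the cells. -/
theorem tsum_mean_sq_le (hd : 1 ≤ d) (g : Lp ℝ 2 (volume : Measure (EuclideanSpace ℝ (Fin d)))) :
    ∑' K, ENNReal.ofReal (𝒯.vol K * (1 / 𝒯.vol K * ∫ x in 𝒯.cell K, g x) ^ 2) ≤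
      ENNReal.ofReal (‖g‖ ^ 2) := by
  have := 𝒯.countable_index hd
  have hg := Lp.memLp g
  have hcell : ∀ K, ENNReal.ofReal (𝒯.vol K * (1 / 𝒯.vol K * ∫ x in 𝒯.cell K, g x) ^ 2) ≤
      ∫⁻ x in 𝒯.cell K, ENNReal.ofReal (g x ^ 2) := by
    intro K
    have hvol := 𝒯.vol_pos K
    have h1 := enorm_integral_mul_le (μ := volume.restrict (𝒯.cell K)) (f := fun _ => (1 : ℝ))
      (g := g) aestronglyMeasurable_const hg.1.restrict
    simp only [one_mul] at h1
    have h2 : ‖∫ x in 𝒯.cell K, g x‖ₑ ^ 2 ≤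
        ENNReal.ofReal (𝒯.vol K) * ∫⁻ x in 𝒯.cell K, ENNReal.ofReal (g x ^ 2) := by
      refine (pow_le_pow_left₀ zero_le h1 2).trans ?_
      rw [mul_pow, eLpNorm_two_sq, eLpNorm_two_sq, ofReal_vol]
      simp
    have h3 : ENNReal.ofReal (𝒯.vol K * (1 / 𝒯.vol K * ∫ x in 𝒯.cell K, g x) ^ 2) =
        ENNReal.ofReal (1 / 𝒯.vol K) * ‖∫ x in 𝒯.cell K, g x‖ₑ ^ 2 := by
      rw [← ofReal_norm, ← ENNReal.ofReal_pow (norm_nonneg _),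
        ← ENNReal.ofReal_mul (by positivity), Real.norm_eq_abs, sq_abs]
      congr 1
      field_simp
    rw [h3]
    refine (mul_le_mul_right h2 _).trans ?_
    rw [← mul_assoc, ← ENNReal.ofReal_mul (by positivity), one_div_mul_cancel hvol.ne']
    simp
  have hdisj : Pairwise (Function.onFun (AEDisjoint volume) 𝒯.cell) := fun K L h =>
    (𝒯.disjoint h).aedisjoint
  calc _ ≤ ∑' K, ∫⁻ x in 𝒯.cell K, ENNReal.ofReal (g x ^ 2) := ENNReal.tsum_le_tsum hcell
    _ = ∫⁻ x in ⋃ K, 𝒯.cell K, ENNReal.ofReal (g x ^ 2) :=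
        (lintegral_iUnion₀ 𝒯.nullMeasurableSet_cell hdisj _).symm
    _ ≤ ∫⁻ x, ENNReal.ofReal (g x ^ 2) := setLIntegral_le_lintegral _ _
    _ = ENNReal.ofReal (‖g‖ ^ 2) := by
        rw [← eLpNorm_two_sq, ENNReal.ofReal_pow (norm_nonneg _), Lp.norm_def,
          ENNReal.ofReal_toReal hg.2.ne]

theorem initial_estimates (hd : 1 ≤ d)
    {u₀ : Ω → Lp ℝ 2 (volume : Measure (EuclideanSpace ℝ (Fin d)))}
    (hu₀_meas : StronglyMeasurable[ℱ 0] u₀) (hu₀ : MemLp u₀ 2 P) {w : ι → Ω → ℝ}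
    (hw : ∀ K, ∀ᵐ ω ∂P, w K ω = 1 / 𝒯.vol K * ∫ x in 𝒯.cell K, u₀ ω x) :
    (∀ K, AEStronglyMeasurable[ℱ 0] (w K) P) ∧ (∀ K, MemLp (w K) 2 P) ∧
      energy 𝒯 P w ≤ ENNReal.ofReal (∫ ω, ‖u₀ ω‖ ^ 2 ∂P) := by
  have hcount := 𝒯.countable_index hd
  have hmeas : ∀ K, AEStronglyMeasurable[ℱ 0] (w K) P := by
    intro K
    obtain ⟨φ, hφ⟩ := exists_inner_eq_setIntegral 𝒯 K
    -- A continuous functional of `u₀` inherits its measurability; the integral over the cell is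
    -- such a functional.
    refine ⟨fun ω => 1 / 𝒯.vol K * inner ℝ φ (u₀ ω), ?_, ?_⟩
    · have hc : Continuous fun g : Lp ℝ 2 (volume : Measure (EuclideanSpace ℝ (Fin d))) =>
          1 / 𝒯.vol K * inner ℝ φ g := by fun_prop
      exact hc.comp_stronglyMeasurable hu₀_meas
    · filter_upwards [hw K] with ω hω
      rw [hω, hφ]
  have hmem : ∀ K, MemLp (w K) 2 P := by
    intro K
    obtain ⟨φ, hφ⟩ := exists_inner_eq_setIntegral 𝒯 K
    refine hu₀.of_le_mul (c := 1 / 𝒯.vol K * ‖φ‖) ((hmeas K).mono (ℱ.le 0)) ?_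
    filter_upwards [hw K] with ω hω
    rw [hω, hφ, norm_mul, Real.norm_of_nonneg (one_div_nonneg.2 (𝒯.vol_pos K).le), mul_assoc]
    exact mul_le_mul_of_nonneg_left (abs_real_inner_le_norm _ _)
      (one_div_nonneg.2 (𝒯.vol_pos K).le)
  refine ⟨hmeas, hmem, ?_⟩
  rw [energy_eq_lintegral_tsum 𝒯 hd fun K => (hmem K).1]
  have hint : Integrable (fun ω => ‖u₀ ω‖ ^ 2) P :=
    (memLp_two_iff_integrable_sq_norm hu₀.1).1 hu₀
  rw [ofReal_integral_eq_lintegral_ofReal hint (ae_of_all _ fun _ => sq_nonneg _)]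
  refine lintegral_mono_ae ?_
  filter_upwards [ae_all_iff.2 hw] with ω hω
  simp_rw [hω]
  exact tsum_mean_sq_le 𝒯 hd (u₀ ω)

/-- Bound on the second moment of the noise term. -/
theorem noise_estimate [SigmaFinite m] [IsFiniteMeasure P] (hNm : IsFiltrationPoisson P ℱ m Nm)
    {η : ℝ → E → ℝ} (hη_meas : ∀ a, Measurable (η a)) {lam : ℝ} {h₁ : E → ℝ} (hlam' : lam < 1)
    (hh₁ : MemLp h₁ 2 m) (hh₁_bdd : ∀ z, 0 ≤ h₁ z ∧ h₁ z ≤ 1)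
    (hη_lip : ∀ a b z, |η a z - η b z| ≤ lam * |a - b| * h₁ z) (hη0 : ∀ z, η 0 z = 0)
    {w I : Ω → ℝ} (hw : MemLp w 2 P) {a b : ℝ≥0}
    (hI : IsStochIntegral P ℱ m Nm a b (fun ω _ z => η (w ω) z) I) :
    eLpNorm I 2 P ^ 2 ≤ ENNReal.ofReal (((b : ℝ) - a) * ∫ z, h₁ z ^ 2 ∂m) *
      ∫⁻ ω, ENNReal.ofReal (w ω ^ 2) ∂P := by
  -- Measurability in `z` and the Lipschitz bound in `a` make `η` a Carathéodory function, hence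
  -- jointly measurable.
  have hηc : ∀ z, Continuous fun a => η a z := by
    intro z
    refine continuous_iff_continuousAt.2 fun a => ?_
    rw [ContinuousAt, tendsto_iff_dist_tendsto_zero]
    have hlim : Tendsto (fun b => lam * |b - a| * h₁ z) (𝓝 a) (𝓝 0) := by
      have : Continuous fun b => lam * |b - a| * h₁ z := by fun_prop
      simpa using this.tendsto a
    exact squeeze_zero (fun _ => dist_nonneg) (fun b => hη_lip b a z) hlim
  have hηm : Measurable (Function.uncurry η) :=
    measurable_uncurry_of_continuous_of_measurable hηc hη_meas
  set ρ := (volume.restrict (Set.Ioc (a : ℝ) b)).prod m with hρ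
  have hwm : AEMeasurable (fun y : Ω × (ℝ × E) => w y.1) (P.prod ρ) :=
    hw.1.aemeasurable.comp_quasiMeasurePreserving Measure.quasiMeasurePreserving_fst
  have hζ : AEStronglyMeasurable (fun y : Ω × (ℝ × E) => η (w y.1) y.2.2) (P.prod ρ) := by
    have : AEMeasurable (fun y : Ω × (ℝ × E) => (w y.1, y.2.2)) (P.prod ρ) :=
      hwm.prodMk (by fun_prop)
    exact (hηm.comp_aemeasurable this).aestronglyMeasurable
  have hle := hI.eLpNorm_le hNm hζ
  have hhm : AEMeasurable (fun z => ENNReal.ofReal (h₁ z ^ 2)) m :=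
    (hh₁.1.aemeasurable.pow_const 2).ennreal_ofReal
  have hhm' : AEMeasurable (fun q : ℝ × E => ENNReal.ofReal (h₁ q.2 ^ 2)) ρ :=
    hhm.comp_quasiMeasurePreserving Measure.quasiMeasurePreserving_snd
  have hhint : ∫⁻ q : ℝ × E, ENNReal.ofReal (h₁ q.2 ^ 2) ∂ρ =
      ENNReal.ofReal ((b : ℝ) - a) * ENNReal.ofReal (∫ z, h₁ z ^ 2 ∂m) := by
    have h := lintegral_prod_mul (μ := volume.restrict (Set.Ioc (a : ℝ) b)) (ν := m)
      (f := fun _ => 1) aemeasurable_const hhm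
    simp only [one_mul, lintegral_const, Measure.restrict_apply MeasurableSet.univ,
      Set.univ_inter, Real.volume_Ioc] at h
    rw [hρ, h, ofReal_integral_eq_lintegral_ofReal hh₁.integrable_sq
      (ae_of_all _ fun _ => sq_nonneg _)]
  calc eLpNorm I 2 P ^ 2 ≤ eLpNorm (fun y : Ω × (ℝ × E) => η (w y.1) y.2.2) 2 (P.prod ρ) ^ 2 :=
        pow_le_pow_left₀ zero_le hle 2
    _ = ∫⁻ y, ENNReal.ofReal (η (w y.1) y.2.2 ^ 2) ∂(P.prod ρ) := eLpNorm_two_sq _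
    _ ≤ ∫⁻ y, ENNReal.ofReal (w y.1 ^ 2) * ENNReal.ofReal (h₁ y.2.2 ^ 2) ∂(P.prod ρ) := by
        refine lintegral_mono fun y => ?_
        rw [← ENNReal.ofReal_mul (sq_nonneg _)]
        refine ENNReal.ofReal_le_ofReal ?_
        have h1 := hη_lip (w y.1) 0 y.2.2
        rw [hη0, sub_zero, sub_zero] at h1
        have h2 : lam * |w y.1| * h₁ y.2.2 ≤ |w y.1| * h₁ y.2.2 :=
          mul_le_mul_of_nonneg_right (mul_le_of_le_one_left (abs_nonneg _) hlam'.le)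
            (hh₁_bdd _).1
        rw [← mul_pow, ← sq_abs]
        rw [← sq_abs (w y.1 * h₁ y.2.2), abs_mul, abs_of_nonneg (hh₁_bdd y.2.2).1]
        exact pow_le_pow_left₀ (abs_nonneg _) (h1.trans h2) 2
    _ = (∫⁻ ω, ENNReal.ofReal (w ω ^ 2) ∂P) *
          ∫⁻ q : ℝ × E, ENNReal.ofReal (h₁ q.2 ^ 2) ∂ρ :=
        lintegral_prod_mul (hw.1.aemeasurable.pow_const 2).ennreal_ofReal hhm'
    _ = _ := by
        rw [hhint, mul_comm, ← ENNReal.ofReal_mul' (integral_nonneg fun _ => sq_nonneg _)]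

/-- One step of the scheme. -/
theorem step_estimates [SigmaFinite m] [IsProbabilityMeasure P] (hd : 1 ≤ d)
    (hNm : IsFiltrationPoisson P ℱ m Nm)
    {f : ℝ → ℝ} {c : ℝ≥0} (hf : ContDiff ℝ 1 f) (hlip : LipschitzWith c f) (hf0 : f 0 = 0)
    (hmono : Monotone f)
    {η : ℝ → E → ℝ} (hη_meas : ∀ a, Measurable (η a)) {lam : ℝ} {h₁ : E → ℝ} (hlam' : lam < 1)
    (hh₁ : MemLp h₁ 2 m) (hh₁_bdd : ∀ z, 0 ≤ h₁ z ∧ h₁ z ≤ 1)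
    (hη_lip : ∀ a b z, |η a z - η b z| ≤ lam * |a - b| * h₁ z) (hη0 : ∀ z, η 0 z = 0)
    {s : ℝ≥0} {Δt : ℝ≥0} (hΔt : 0 < Δt) {b : ι → ι → ℝ}
    (hb : ∀ K, ∀ L ∈ 𝒯.neighborFinset hd K, 0 ≤ b K L)
    (hcons : ∀ K, ∑ L ∈ 𝒯.neighborFinset hd K, b K L = ∑ L ∈ 𝒯.neighborFinset hd K, b L K)
    (hcfl : ∀ K, Δt * c * ∑ L ∈ 𝒯.neighborFinset hd K, b K L ≤ 𝒯.vol K)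
    {F : ι → ι → ℝ → ℝ → ℝ}
    (hF : ∀ K, ∀ L ∈ 𝒯.neighborFinset hd K, ∀ x y, F K L x y = b L K * f x - b K L * f y)
    {w w' : ι → Ω → ℝ} (hwm : ∀ K, AEStronglyMeasurable[ℱ s] (w K) P)
    (hw : ∀ K, MemLp (w K) 2 P)
    (hstep : ∀ K, ∃ I : Ω → ℝ,
      IsStochIntegral P ℱ m Nm s (s + Δt) (fun ω _ z => η (w K ω) z) I ∧
      ∀ᵐ ω ∂P, 𝒯.vol K / Δt * (w' K ω - w K ω)
          + ∑ᶠ L ∈ 𝒯.neighbors K, F K L (w K ω) (w L ω)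
        = 𝒯.vol K / Δt * I ω) :
    (∀ K, AEStronglyMeasurable[ℱ (s + Δt)] (w' K) P) ∧ (∀ K, MemLp (w' K) 2 P) ∧
      energy 𝒯 P w' ≤ ENNReal.ofReal (1 + Δt * ∫ z, h₁ z ^ 2 ∂m) * energy 𝒯 P w := by
  choose I hI hIeq using hstep
  have hΔt' : (0 : ℝ) < Δt := hΔt
  -- The deterministic update in difference form: conservativity replaces the outflow coefficient of
  -- `f (w K)` by the inflow.
  set D : ι → Ω → ℝ := fun K ω => w K ω - Δt / 𝒯.vol K *
    ∑ L ∈ 𝒯.neighborFinset hd K, b K L * (f (w K ω) - f (w L ω)) with hD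
  have heq : ∀ K, ∀ᵐ ω ∂P, w' K ω = D K ω + I K ω := by
    intro K
    filter_upwards [hIeq K] with ω hω
    have hvol := 𝒯.vol_pos K
    have hsum : ∑ᶠ L ∈ 𝒯.neighbors K, F K L (w K ω) (w L ω) =
        ∑ L ∈ 𝒯.neighborFinset hd K, b K L * (f (w K ω) - f (w L ω)) := by
      rw [finsum_mem_eq_finite_toFinset_sum _ (𝒯.finite_neighbors hd K)]
      change ∑ L ∈ 𝒯.neighborFinset hd K, _ = _
      rw [Finset.sum_congr rfl fun L hL => hF K L hL (w K ω) (w L ω)]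
      simp only [mul_sub, Finset.sum_sub_distrib, ← Finset.sum_mul]
      rw [hcons K]
    rw [hsum] at hω
    simp only [hD]
    field_simp at hω ⊢
    linarith
  have hfw : ∀ K, MemLp (fun ω => f (w K ω)) 2 P := by
    intro K
    refine (hw K).of_le_mul (c := c) (hf.continuous.comp_aestronglyMeasurable (hw K).1)
      (ae_of_all _ fun ω => ?_)
    have := hlip.dist_le_mul (w K ω) 0
    simpa [dist_eq_norm, hf0] using this
  have hDmem : ∀ K, MemLp (D K) 2 P := fun K =>
    (hw K).sub ((memLp_finsetSum _ fun L _ =>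
      ((hfw K).sub (hfw L)).const_mul (b K L)).const_mul _)
  have hDmeas : ∀ K, AEStronglyMeasurable[ℱ s] (D K) P := by
    intro K
    have h1 : ∀ L, AEStronglyMeasurable[ℱ s] (fun ω => f (w L ω)) P := fun L =>
      hf.continuous.comp_aestronglyMeasurable (hwm L)
    have h2 : AEStronglyMeasurable[ℱ s] (fun ω =>
        ∑ L ∈ 𝒯.neighborFinset hd K, b K L * (f (w K ω) - f (w L ω))) P := by
      induction 𝒯.neighborFinset hd K using Finset.cons_induction with
      | empty => simpa using aestronglyMeasurable_const
      | cons L s hL ih =>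
        simp only [Finset.sum_cons]
        exact (((h1 K).sub (h1 L)).const_mul (b K L)).add ih
    exact (hwm K).sub (h2.const_mul _)
  have hw'mem : ∀ K, MemLp (w' K) 2 P := fun K =>
    ((hDmem K).add (hI K).1).ae_eq ((heq K).mono fun ω h => h.symm)
  have hw'meas : ∀ K, AEStronglyMeasurable[ℱ (s + Δt)] (w' K) P := fun K =>
    (((hDmeas K).mono (ℱ.mono (le_add_of_nonneg_right zero_le))).add
      ((hI K).aestronglyMeasurable hNm)).congr ((heq K).mono fun ω h => h.symm)
  refine ⟨hw'meas, hw'mem, ?_⟩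
  set q := ∫ z, h₁ z ^ 2 ∂m with hq
  have hq0 : 0 ≤ q := integral_nonneg fun _ => sq_nonneg _
  have hsecond : ∀ K, ∫⁻ ω, ENNReal.ofReal (w' K ω ^ 2) ∂P ≤
      ∫⁻ ω, ENNReal.ofReal (D K ω ^ 2) ∂P +
        ENNReal.ofReal (Δt * q) * ∫⁻ ω, ENNReal.ofReal (w K ω ^ 2) ∂P := by
    intro K
    have hnoise := noise_estimate hNm hη_meas hlam' hh₁ hh₁_bdd hη_lip hη0 (hw K) (hI K)
    have hlen : (((s + Δt : ℝ≥0) : ℝ) - s) = Δt := by push_cast; ring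
    rw [hlen] at hnoise
    refine le_trans (le_of_eq ?_) (add_le_add_right hnoise _)
    rw [← eLpNorm_two_sq, ← eLpNorm_two_sq, eLpNorm_two_sq_eq_integral (hw'mem K),
      eLpNorm_two_sq_eq_integral (hDmem K), eLpNorm_two_sq_eq_integral (hI K).1,
      ← ENNReal.ofReal_add (integral_nonneg fun _ => sq_nonneg _)
        (integral_nonneg fun _ => sq_nonneg _)]
    congr 1
    -- The mixed term of `(D + I)²` vanishes because `D K` belongs to the past at time `s`.
    have horth := (hI K).integral_mul_eq_zero hNm (hDmem K) (hDmeas K)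
    have i1 := (hDmem K).integrable_sq
    have i2 : Integrable (fun ω => D K ω * I K ω) P := (hDmem K).integrable_mul (hI K).1
    have i3 := (hI K).1.integrable_sq
    have i12 : Integrable (fun ω => D K ω ^ 2 + 2 * (D K ω * I K ω)) P :=
      i1.add (i2.const_mul 2)
    have : ∫ ω, w' K ω ^ 2 ∂P = ∫ ω, (D K ω ^ 2 + 2 * (D K ω * I K ω) + I K ω ^ 2) ∂P := by
      refine integral_congr_ae ?_
      filter_upwards [heq K] with ω hω
      rw [hω]; ring
    rw [this, integral_add i12 i3, integral_add i1 (i2.const_mul 2),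
      integral_const_mul, horth]
    ring
  have hdet : energy 𝒯 P D ≤ energy 𝒯 P w := by
    rw [energy_eq_lintegral_tsum 𝒯 hd fun K => (hDmem K).1,
      energy_eq_lintegral_tsum 𝒯 hd fun K => (hw K).1]
    refine lintegral_mono fun ω => ?_
    refine tsum_energy_le hf hmono hlip hf0 hΔt'.le 𝒯.vol_pos (𝒯.neighborFinset hd) ?_ hb hcons
      hcfl fun K => w K ω
    intro K L
    rw [𝒯.mem_neighborFinset, 𝒯.mem_neighborFinset]
    exact ⟨𝒯.mem_neighbors_symm, 𝒯.mem_neighbors_symm⟩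
  calc energy 𝒯 P w' ≤ ∑' K, (ENNReal.ofReal (𝒯.vol K) * ∫⁻ ω, ENNReal.ofReal (D K ω ^ 2) ∂P +
        ENNReal.ofReal (Δt * q) *
          (ENNReal.ofReal (𝒯.vol K) * ∫⁻ ω, ENNReal.ofReal (w K ω ^ 2) ∂P)) := by
        refine ENNReal.tsum_le_tsum fun K => ?_
        refine (mul_le_mul_right (hsecond K) _).trans (le_of_eq ?_)
        ring
    _ = energy 𝒯 P D + ENNReal.ofReal (Δt * q) * energy 𝒯 P w := by
        rw [ENNReal.tsum_add, ENNReal.tsum_mul_left]; rfl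
    _ ≤ energy 𝒯 P w + ENNReal.ofReal (Δt * q) * energy 𝒯 P w := add_le_add_left hdet _
    _ = ENNReal.ofReal (1 + Δt * q) * energy 𝒯 P w := by
        rw [ENNReal.ofReal_add zero_le_one (by positivity), ENNReal.ofReal_one, add_mul, one_mul]

end Energy

/-! ### Norms of piecewise constant functions -/

section PiecewiseConstant

variable {Ω ι X : Type*} {mΩ : MeasurableSpace Ω} [MeasurableSpace X] {d : ℕ}
  {P : Measure Ω} {μ : Measure X} (𝒯 : AdmissibleMesh d ι)

/-- Disjoint cells leave at most one nonzero term; `φ 0 = 0` takes care of points in no cell, such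
as excluded boundary points. -/
theorem apply_finsum_indicator_cell {φ : ℝ → ℝ≥0∞} (hφ : φ 0 = 0) (g : ι → ℝ)
    (x : EuclideanSpace ℝ (Fin d)) :
    φ (∑ᶠ K, (𝒯.cell K).indicator (fun _ => g K) x) =
      ∑' K, (𝒯.cell K).indicator (fun _ => φ (g K)) x := by
  by_cases h : ∃ K, x ∈ 𝒯.cell K
  · obtain ⟨K, hK⟩ := h
    have hne : ∀ L, L ≠ K → x ∉ 𝒯.cell L := fun L hL hx =>
      Set.disjoint_left.1 (𝒯.disjoint hL) hx hK
    rw [finsum_eq_single _ K fun L hL => Set.indicator_of_notMem (hne L hL) _,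
      tsum_eq_single K fun L hL => Set.indicator_of_notMem (hne L hL) _,
      Set.indicator_of_mem hK, Set.indicator_of_mem hK]
  · push Not at h
    simp [Set.indicator_of_notMem (h _), hφ]

theorem aemeasurable_indicator_comp {s : Set (EuclideanSpace ℝ (Fin d))}
    {p : X → EuclideanSpace ℝ (Fin d)} (hp : Measure.QuasiMeasurePreserving p μ volume)
    (hs : NullMeasurableSet s) {g : X → ℝ≥0∞} (hg : AEMeasurable g μ) :
    AEMeasurable (fun y => s.indicator (fun _ => g y) (p y)) μ :=
  hg.indicator₀ (hs.preimage hp)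

theorem aemeasurable_finsum_indicator_cell (hd : 1 ≤ d)
    {p : X → EuclideanSpace ℝ (Fin d)} (hp : Measure.QuasiMeasurePreserving p μ volume)
    {g : ι → X → ℝ} (hg : ∀ K, AEMeasurable (g K) μ) :
    AEMeasurable (fun y => ∑ᶠ K, (𝒯.cell K).indicator (fun _ => g K y) (p y)) μ := by
  have := 𝒯.countable_index hd
  -- The positive and negative parts are countable sums in `ℝ≥0∞`, where measurability is automatic;
  -- the function is their difference.
  have h1 : AEMeasurable (fun y => ∑' K, (𝒯.cell K).indicator
      (fun _ => ENNReal.ofReal (g K y)) (p y)) μ :=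
    AEMeasurable.tsum fun K =>
      aemeasurable_indicator_comp hp (𝒯.nullMeasurableSet_cell K) (hg K).ennreal_ofReal
  have h2 : AEMeasurable (fun y => ∑' K, (𝒯.cell K).indicator
      (fun _ => ENNReal.ofReal (-g K y)) (p y)) μ :=
    AEMeasurable.tsum fun K =>
      aemeasurable_indicator_comp hp (𝒯.nullMeasurableSet_cell K) (hg K).neg.ennreal_ofReal
  refine (h1.ennreal_toReal.sub h2.ennreal_toReal).congr (ae_of_all _ fun y => ?_)
  have e1 := apply_finsum_indicator_cell 𝒯 (φ := ENNReal.ofReal) (by simp) (fun K => g K y) (p y)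
  have e2 := apply_finsum_indicator_cell 𝒯 (φ := fun r => ENNReal.ofReal (-r)) (by simp)
    (fun K => g K y) (p y)
  simp only [Pi.sub_apply] at e1 e2 ⊢
  rw [← e1, ← e2, ENNReal.toReal_ofReal', ENNReal.toReal_ofReal', max_zero_sub_eq_self]

theorem eLpNorm_sq_finsum_indicator_cell (hd : 1 ≤ d)
    {p : X → EuclideanSpace ℝ (Fin d)} (hp : Measure.QuasiMeasurePreserving p μ volume)
    {g : ι → X → ℝ} (hg : ∀ K, AEMeasurable (g K) μ) :
    eLpNorm (fun y => ∑ᶠ K, (𝒯.cell K).indicator (fun _ => g K y) (p y)) 2 μ ^ 2 =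
      ∑' K, ∫⁻ y, ENNReal.ofReal (g K y ^ 2) * (𝒯.cell K).indicator 1 (p y) ∂μ := by
  have := 𝒯.countable_index hd
  rw [eLpNorm_two_sq]
  simp_rw [fun y => apply_finsum_indicator_cell 𝒯 (φ := fun r => ENNReal.ofReal (r ^ 2)) (by simp)
    (fun K => g K y) (p y)]
  rw [lintegral_tsum fun K => aemeasurable_indicator_comp hp (𝒯.nullMeasurableSet_cell K)
    ((hg K).pow_const 2).ennreal_ofReal]
  refine tsum_congr fun K => lintegral_congr fun y => ?_
  by_cases h : p y ∈ 𝒯.cell K <;> simp [h]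

theorem eLpNorm_sq_prod_eq_energy [SFinite P] (hd : 1 ≤ d) {w : ι → Ω → ℝ}
    (hw : ∀ K, AEMeasurable (w K) P) :
    eLpNorm (fun y : Ω × EuclideanSpace ℝ (Fin d) =>
      ∑ᶠ K, (𝒯.cell K).indicator (fun _ => w K y.1) y.2) 2 (P.prod volume) ^ 2 =
      energy 𝒯 P w := by
  rw [eLpNorm_sq_finsum_indicator_cell 𝒯 hd Measure.quasiMeasurePreserving_snd
    (g := fun K y => w K y.1)
    fun K => (hw K).comp_quasiMeasurePreserving Measure.quasiMeasurePreserving_fst]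
  refine tsum_congr fun K => ?_
  have hcm : AEMeasurable ((𝒯.cell K).indicator (1 : EuclideanSpace ℝ (Fin d) → ℝ≥0∞)) volume :=
    aemeasurable_const.indicator₀ (𝒯.nullMeasurableSet_cell K)
  rw [lintegral_prod_mul ((hw K).pow_const 2).ennreal_ofReal hcm,
    lintegral_indicator_one₀ (𝒯.nullMeasurableSet_cell K), ofReal_vol, mul_comm]

theorem floor_div_lt {T Δt t : ℝ} {N : ℕ} (hΔt : 0 < Δt) (hT : T = N * Δt)
    (ht : t ∈ Set.Ico 0 T) : ⌊t / Δt⌋₊ < N := by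
  rw [Nat.floor_lt (div_nonneg ht.1 hΔt.le), div_lt_iff₀ hΔt, ← hT]
  exact ht.2

theorem volume_floor_div_eq_le {T Δt : ℝ} (hΔt : 0 < Δt) (n : ℕ) :
    volume.restrict (Set.Ico 0 T) {t | ⌊t / Δt⌋₊ = n} ≤ ENNReal.ofReal Δt := by
  -- The restriction to `t ≥ 0` matters for `n = 0`, since the natural floor of every negative
  -- number is `0`.
  have hsub : {t | ⌊t / Δt⌋₊ = n} ∩ Set.Ico 0 T ⊆ Set.Ico (n * Δt) ((n + 1) * Δt) := by
    rintro t ⟨rfl, ht⟩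
    rw [Set.mem_Ico, ← le_div_iff₀ hΔt, ← div_lt_iff₀ hΔt]
    exact ⟨Nat.floor_le (div_nonneg ht.1 hΔt.le), Nat.lt_floor_add_one _⟩
  rw [Measure.restrict_apply' measurableSet_Ico]
  refine (measure_mono hsub).trans ?_
  rw [Real.volume_Ico]
  exact ENNReal.ofReal_le_ofReal (by linarith)

theorem measurableSet_floor_div_eq (Δt : ℝ) (n : ℕ) :
    MeasurableSet {t : ℝ | ⌊t / Δt⌋₊ = n} :=
  (Nat.measurable_floor.comp (measurable_id.div_const Δt)) (measurableSet_singleton n)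

/-- The space-time norm of a function that is constant in time on each time step. -/
theorem aestronglyMeasurable_approx_and_eLpNorm_sq_le [SFinite P] (hd : 1 ≤ d) {T Δt : ℝ} {N : ℕ}
    (hΔt : 0 < Δt) (hT : T = N * Δt) {u : ℕ → ι → Ω → ℝ}
    (hu : ∀ n < N, ∀ K, AEMeasurable (u n K) P) :
    AEStronglyMeasurable
      (fun y : Ω × (ℝ × EuclideanSpace ℝ (Fin d)) => 𝒯.approx Δt u y.2.1 y.2.2 y.1)
      (P.prod ((volume.restrict (Set.Ico 0 T)).prod volume)) ∧
    eLpNorm (fun y : Ω × (ℝ × EuclideanSpace ℝ (Fin d)) => 𝒯.approx Δt u y.2.1 y.2.2 y.1) 2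
      (P.prod ((volume.restrict (Set.Ico 0 T)).prod volume)) ^ 2 ≤
      ∑ n ∈ Finset.range N, ENNReal.ofReal Δt * energy 𝒯 P (u n) := by
  set ν := volume.restrict (Set.Ico 0 T) with hν
  set J : ℕ → Set ℝ := fun n => {t | ⌊t / Δt⌋₊ = n} with hJ
  have hJm : ∀ n, MeasurableSet (J n) := measurableSet_floor_div_eq Δt
  have hqt : Measure.QuasiMeasurePreserving
      (fun y : Ω × (ℝ × EuclideanSpace ℝ (Fin d)) => y.2.1) (P.prod (ν.prod volume)) ν :=
    Measure.quasiMeasurePreserving_fst.comp Measure.quasiMeasurePreserving_snd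
  have hqx : Measure.QuasiMeasurePreserving
      (fun y : Ω × (ℝ × EuclideanSpace ℝ (Fin d)) => y.2.2) (P.prod (ν.prod volume)) volume :=
    Measure.quasiMeasurePreserving_snd.comp Measure.quasiMeasurePreserving_snd
  -- On `[0, T)` the value with random index `⌊t / Δt⌋₊` becomes a finite sum of products of
  -- functions of `t` and of `ω`, which is jointly measurable.
  set g : ι → Ω × (ℝ × EuclideanSpace ℝ (Fin d)) → ℝ := fun K y =>
    ∑ n ∈ Finset.range N, (J n).indicator 1 y.2.1 * u n K y.1 with hg
  have hgm : ∀ K, AEMeasurable (g K) (P.prod (ν.prod volume)) := by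
    intro K
    refine Finset.aemeasurable_fun_sum _ fun n hn => ?_
    refine AEMeasurable.mul ?_ ((hu n (Finset.mem_range.1 hn) K).comp_quasiMeasurePreserving
      Measure.quasiMeasurePreserving_fst)
    exact ((measurable_one.indicator (hJm n)).comp (by fun_prop)).aemeasurable
  have hind : ∀ t ∈ Set.Ico 0 T, ∀ a : ℕ → ℝ,
      ∑ n ∈ Finset.range N, (J n).indicator 1 t * a n = a ⌊t / Δt⌋₊ := by
    intro t ht a
    rw [Finset.sum_eq_single_of_mem _ (Finset.mem_range.2 (floor_div_lt hΔt hT ht))]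
    · simp [hJ]
    · intro n _ hn
      simp [hJ, hn.symm]
  have hind' : ∀ t ∈ Set.Ico 0 T, ∀ a : ℕ → ℝ≥0∞,
      ∑ n ∈ Finset.range N, (J n).indicator 1 t * a n = a ⌊t / Δt⌋₊ := by
    intro t ht a
    rw [Finset.sum_eq_single_of_mem _ (Finset.mem_range.2 (floor_div_lt hΔt hT ht))]
    · simp [hJ]
    · intro n _ hn
      simp [hJ, hn.symm]
  have htae : ∀ᵐ y : Ω × (ℝ × EuclideanSpace ℝ (Fin d)) ∂(P.prod (ν.prod volume)),
      y.2.1 ∈ Set.Ico 0 T := hqt.ae (ae_restrict_mem measurableSet_Ico)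
  have hae : (fun y : Ω × (ℝ × EuclideanSpace ℝ (Fin d)) => 𝒯.approx Δt u y.2.1 y.2.2 y.1)
      =ᵐ[P.prod (ν.prod volume)]
      fun y => ∑ᶠ K, (𝒯.cell K).indicator (fun _ => g K y) y.2.2 := by
    filter_upwards [htae] with y hy
    simp only [hg, hind _ hy, AdmissibleMesh.approx]
  refine ⟨(aemeasurable_finsum_indicator_cell 𝒯 hd hqx hgm).aestronglyMeasurable.congr hae.symm, ?_⟩
  rw [eLpNorm_congr_ae hae, eLpNorm_sq_finsum_indicator_cell 𝒯 hd hqx hgm]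
  have hcell : ∀ K, ∫⁻ y, ENNReal.ofReal (g K y ^ 2) * (𝒯.cell K).indicator 1 y.2.2
        ∂(P.prod (ν.prod volume)) ≤
      ∑ n ∈ Finset.range N, ENNReal.ofReal Δt *
        (ENNReal.ofReal (𝒯.vol K) * ∫⁻ ω, ENNReal.ofReal (u n K ω ^ 2) ∂P) := by
    intro K
    have hcm : AEMeasurable ((𝒯.cell K).indicator (1 : EuclideanSpace ℝ (Fin d) → ℝ≥0∞)) volume :=
      aemeasurable_const.indicator₀ (𝒯.nullMeasurableSet_cell K)
    have hJc : ∀ n, AEMeasurable (fun r : ℝ × EuclideanSpace ℝ (Fin d) =>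
        (J n).indicator (1 : ℝ → ℝ≥0∞) r.1 * (𝒯.cell K).indicator 1 r.2) (ν.prod volume) :=
      fun n => ((measurable_one.indicator (hJm n)).comp measurable_fst).aemeasurable.mul
        (hcm.comp_quasiMeasurePreserving Measure.quasiMeasurePreserving_snd)
    have hum : ∀ n ∈ Finset.range N, AEMeasurable (fun ω => ENNReal.ofReal (u n K ω ^ 2)) P :=
      fun n hn => ((hu n (Finset.mem_range.1 hn) K).pow_const 2).ennreal_ofReal
    calc ∫⁻ y, ENNReal.ofReal (g K y ^ 2) * (𝒯.cell K).indicator 1 y.2.2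
          ∂(P.prod (ν.prod volume))
        = ∫⁻ y, ∑ n ∈ Finset.range N, ENNReal.ofReal (u n K y.1 ^ 2) *
            ((J n).indicator 1 y.2.1 * (𝒯.cell K).indicator 1 y.2.2)
            ∂(P.prod (ν.prod volume)) := by
          refine lintegral_congr_ae ?_
          filter_upwards [htae] with y hy
          have h := hind' y.2.1 hy fun n =>
            ENNReal.ofReal (u n K y.1 ^ 2) * (𝒯.cell K).indicator 1 y.2.2
          simp only [hg, hind _ hy]
          rw [← h]
          exact Finset.sum_congr rfl fun n _ => by ring
      _ = ∑ n ∈ Finset.range N, ∫⁻ y, ENNReal.ofReal (u n K y.1 ^ 2) *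
            ((J n).indicator 1 y.2.1 * (𝒯.cell K).indicator 1 y.2.2)
            ∂(P.prod (ν.prod volume)) := by
          refine lintegral_finsetSum' _ fun n hn => ?_
          exact ((hum n hn).comp_quasiMeasurePreserving Measure.quasiMeasurePreserving_fst).mul
            ((hJc n).comp_quasiMeasurePreserving Measure.quasiMeasurePreserving_snd)
      _ ≤ _ := by
          refine Finset.sum_le_sum fun n hn => ?_
          rw [lintegral_prod_mul (hum n hn) (hJc n),
            lintegral_prod_mul (measurable_one.indicator (hJm n)).aemeasurable hcm,
            lintegral_indicator_one₀ (𝒯.nullMeasurableSet_cell K),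
            lintegral_indicator_one (hJm n), ofReal_vol]
          calc _ = ν (J n) * (volume (𝒯.cell K) * ∫⁻ ω, ENNReal.ofReal (u n K ω ^ 2) ∂P) := by
                ring
            _ ≤ _ := by gcongr; exact volume_floor_div_eq_le hΔt n
  refine (ENNReal.tsum_le_tsum hcell).trans (le_of_eq ?_)
  rw [Summable.tsum_finsetSum fun _ _ => ENNReal.summable]
  exact Finset.sum_congr rfl fun n _ => ENNReal.tsum_mul_left

end PiecewiseConstant

/-! ### The estimate for all time levels -/

section Main

variable {Ω E ι : Type*} {mΩ : MeasurableSpace Ω} [MeasurableSpace E] {d : ℕ}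

/-- Induction on the time level. Measurability at `t_n` and square integrability are carried along
because the orthogonality in the next step requires them. -/
theorem scheme_estimates (hd : 1 ≤ d)
    {P : Measure Ω} [IsProbabilityMeasure P] {ℱ : Filtration ℝ≥0 mΩ}
    {m : Measure E} [SigmaFinite m] {Nm : Ω → Measure (ℝ × E)}
    (hNm : IsFiltrationPoisson P ℱ m Nm) {T : ℝ≥0} (hT : 0 < T)
    {f : ℝ → ℝ} {c_f : ℝ≥0} (hf : ContDiff ℝ 1 f) (hf_lip : LipschitzWith c_f f) (hf0 : f 0 = 0)
    (hf_mono : Monotone f)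
    {v : ℝ → EuclideanSpace ℝ (Fin d) → EuclideanSpace ℝ (Fin d)} {V : ℝ}
    (hv : ContDiffOn ℝ 1 (Function.uncurry v) (Set.Icc 0 (T : ℝ) ×ˢ Set.univ))
    (hv_div : ∀ t ∈ Set.Ico 0 (T : ℝ), ∀ x, divergence (v t) x = 0)
    (hv_bdd : ∀ t ∈ Set.Ico 0 (T : ℝ), ∀ x, ‖v t x‖ ≤ V)
    {η : ℝ → E → ℝ} (hη_meas : ∀ a, Measurable (η a))
    {lam : ℝ} {h₁ : E → ℝ} (hlam' : lam < 1)
    (hh₁ : MemLp h₁ 2 m) (hh₁_bdd : ∀ z, 0 ≤ h₁ z ∧ h₁ z ≤ 1)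
    (hη_lip : ∀ a b z, |η a z - η b z| ≤ lam * |a - b| * h₁ z) (hη0 : ∀ z, η 0 z = 0)
    {u₀ : Ω → Lp ℝ 2 (volume : Measure (EuclideanSpace ℝ (Fin d)))}
    (hu₀_meas : StronglyMeasurable[ℱ 0] u₀) (hu₀ : MemLp u₀ 2 P)
    {𝒯 : AdmissibleMesh d ι} {N : ℕ} {Δt : ℝ≥0} (hΔt : 0 < Δt) (hTN : (T : ℝ) = N * Δt)
    (hCFL : (Δt : ℝ) * (c_f * V) ≤ 𝒯.α ^ 2 * 𝒯.size)
    {F : ℕ → ι → ι → ℝ → ℝ → ℝ} (hF : F = 𝒯.upwindFlux v Δt f ∨ F = 𝒯.splitUpwindFlux v Δt f)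
    {u : ℕ → ι → Ω → ℝ} (hu : IsSchemeSolution P ℱ m Nm 𝒯 Δt N F η u₀ u) {n : ℕ} (hn : n ≤ N) :
    (∀ K, AEStronglyMeasurable[ℱ (n * Δt)] (u n K) P) ∧ (∀ K, MemLp (u n K) 2 P) ∧
      energy 𝒯 P (u n) ≤
        ENNReal.ofReal ((1 + Δt * ∫ z, h₁ z ^ 2 ∂m) ^ n * ∫ ω, ‖u₀ ω‖ ^ 2 ∂P) := by
  have hV : 0 ≤ V := (norm_nonneg _).trans (hv_bdd 0 ⟨le_rfl, hT⟩ 0)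
  have hq0 : 0 ≤ ∫ z, h₁ z ^ 2 ∂m := integral_nonneg fun _ => sq_nonneg _
  induction n with
  | zero =>
    have h := initial_estimates 𝒯 hd hu₀_meas hu₀ hu.initial
    rw [show ((0 : ℕ) : ℝ≥0) * Δt = 0 by simp]
    simpa using h
  | succ n ih =>
    obtain ⟨hm, hL, hE⟩ := ih (Nat.le_of_succ_le hn)
    have hnT : ((n : ℝ) + 1) * Δt ≤ T := by
      rw [hTN]
      have : ((n : ℝ) + 1) ≤ N := by exact_mod_cast hn
      gcongr
    obtain ⟨b, hb0, hbV, hcons, hFb⟩ := 𝒯.exists_flux_coefficients hd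
      (NNReal.coe_pos.2 hΔt) hnT hv hv_div hv_bdd f hF
    have htime : ((n + 1 : ℕ) : ℝ≥0) * Δt = n * Δt + Δt := by push_cast; ring
    have hstep := hu.step n (Nat.lt_of_succ_le hn)
    rw [show ((n : ℝ≥0) + 1) * Δt = n * Δt + Δt by ring] at hstep
    obtain ⟨hm', hL', hE'⟩ := step_estimates 𝒯 hd hNm hf hf_lip hf0 hf_mono hη_meas hlam' hh₁
      hh₁_bdd hη_lip hη0 hΔt hb0 hcons
      (fun K => 𝒯.cfl_cell hd Δt.2 hV hCFL K (hbV K)) hFb hm hL hstep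
    rw [htime]
    refine ⟨hm', hL', hE'.trans ((mul_le_mul_right hE _).trans (le_of_eq ?_))⟩
    rw [← ENNReal.ofReal_mul (by positivity), pow_succ']
    ring_nf

end Main

end UpwindFV

/-! ### From the energy at the time levels to the norms of the approximate solution -/

theorem mainTheorem6
    {Ω E ι : Type*} {mΩ : MeasurableSpace Ω} [MeasurableSpace E] {d : ℕ} (hd : 1 ≤ d)
    -- filtered probability space and Poisson random measure
    (P : Measure Ω) [IsProbabilityMeasure P] (ℱ : Filtration ℝ≥0 mΩ)
    (hℱ : UpwindFV.UsualHypotheses P ℱ)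
    (m : Measure E) [SigmaFinite m] (Nm : Ω → Measure (ℝ × E))
    (hNm : UpwindFV.IsFiltrationPoisson P ℱ m Nm)
    (T : ℝ≥0) (hT : 0 < T)
    -- the flux function
    (f : ℝ → ℝ) (c_f : ℝ≥0) (hf : ContDiff ℝ 2 f) (hf_lip : LipschitzWith c_f f) (hf0 : f 0 = 0)
    (hf_mono : Monotone f)
    -- the velocity field
    (v : ℝ → EuclideanSpace ℝ (Fin d) → EuclideanSpace ℝ (Fin d)) (V : ℝ)
    (hv : ContDiffOn ℝ 1 (Function.uncurry v) (Set.Icc 0 (T : ℝ) ×ˢ Set.univ))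
    (hv_div : ∀ t ∈ Set.Ico 0 (T : ℝ), ∀ x, UpwindFV.divergence (v t) x = 0)
    (hv_bdd : ∀ t ∈ Set.Ico 0 (T : ℝ), ∀ x, ‖v t x‖ ≤ V)
    -- the noise coefficient
    (η : ℝ → E → ℝ) (hη_meas : ∀ a, Measurable (η a))
    (lam C : ℝ) (h₁ : E → ℝ) (hlam : 0 < lam) (hlam' : lam < 1) (hC : 0 < C)
    (hh₁ : MemLp h₁ 2 m) (hh₁_bdd : ∀ z, 0 ≤ h₁ z ∧ h₁ z ≤ 1)
    (hη_lip : ∀ a b z, |η a z - η b z| ≤ lam * |a - b| * h₁ z)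
    (hη_bdd : ∀ a z, |η a z| ≤ C * h₁ z) (hη0 : ∀ z, η 0 z = 0)
    -- the initial value
    (u₀ : Ω → Lp ℝ 2 (volume : Measure (EuclideanSpace ℝ (Fin d))))
    (hu₀_meas : StronglyMeasurable[ℱ 0] u₀) (hu₀ : MemLp u₀ 2 P)
    -- the mesh, the time step and the CFL condition `Δt ≤ α² h / (c_f V)`
    (𝒯 : UpwindFV.AdmissibleMesh d ι) (N : ℕ) (hN : 0 < N) (Δt : ℝ≥0) (hΔt : Δt = T / N)
    (hCFL : (Δt : ℝ) * (c_f * V) ≤ 𝒯.α ^ 2 * 𝒯.size)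
    -- the upwind finite volume scheme
    (F : ℕ → ι → ι → ℝ → ℝ → ℝ) (hF : F = 𝒯.upwindFlux v Δt f ∨ F = 𝒯.splitUpwindFlux v Δt f)
    (u : ℕ → ι → Ω → ℝ)
    (hu : UpwindFV.IsSchemeSolution P ℱ m Nm 𝒯 Δt N F η u₀ u) :
    ((∀ t ∈ Set.Ico 0 (T : ℝ),
        MemLp (fun y : Ω × EuclideanSpace ℝ (Fin d) => 𝒯.approx Δt u t y.2 y.1) 2
          (P.prod volume)) ∧
      UpwindFV.normLinftyL2 P T (𝒯.approx Δt u) ^ 2 ≤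
        ENNReal.ofReal (Real.exp ((∫ z, h₁ z ^ 2 ∂m) * T) * ∫ ω, ‖u₀ ω‖ ^ 2 ∂P)) ∧
    (MemLp (fun y : Ω × (ℝ × EuclideanSpace ℝ (Fin d)) => 𝒯.approx Δt u y.2.1 y.2.2 y.1) 2
        (P.prod ((volume.restrict (Set.Ico 0 (T : ℝ))).prod volume)) ∧
      eLpNorm (fun y : Ω × (ℝ × EuclideanSpace ℝ (Fin d)) => 𝒯.approx Δt u y.2.1 y.2.2 y.1) 2
        (P.prod ((volume.restrict (Set.Ico 0 (T : ℝ))).prod volume)) ^ 2 ≤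
        ENNReal.ofReal (T * Real.exp ((∫ z, h₁ z ^ 2 ∂m) * T) * ∫ ω, ‖u₀ ω‖ ^ 2 ∂P)) := by
  have hN' : (0 : ℝ) < N := Nat.cast_pos.2 hN
  have hT' : (0 : ℝ) < T := hT
  have hTN : (T : ℝ) = N * Δt := by
    rw [hΔt]
    push_cast
    field_simp
  have hΔt0 : (0 : ℝ) < Δt := by
    rw [hTN] at hT'
    exact pos_of_mul_pos_right hT' hN'.le
  set q := ∫ z, h₁ z ^ 2 ∂m with hq
  have hq0 : 0 ≤ q := integral_nonneg fun _ => sq_nonneg _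
  set M := ∫ ω, ‖u₀ ω‖ ^ 2 ∂P with hM
  have hM0 : 0 ≤ M := integral_nonneg fun _ => sq_nonneg _
  have hest : ∀ n ≤ N, (∀ K, MemLp (u n K) 2 P) ∧
      UpwindFV.energy 𝒯 P (u n) ≤ ENNReal.ofReal (Real.exp (q * T) * M) := by
    intro n hn
    obtain ⟨-, h2, h3⟩ := UpwindFV.scheme_estimates hd hNm hT (hf.of_le one_le_two) hf_lip hf0
      hf_mono hv hv_div hv_bdd hη_meas hlam' hh₁ hh₁_bdd hη_lip hη0 hu₀_meas hu₀
      (NNReal.coe_pos.1 hΔt0) hTN hCFL hF hu hn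
    refine ⟨h2, h3.trans (ENNReal.ofReal_le_ofReal (mul_le_mul_of_nonneg_right ?_ hM0))⟩
    calc (1 + Δt * q) ^ n ≤ Real.exp (Δt * q) ^ n := by
          refine pow_le_pow_left₀ (by positivity) ?_ n
          linarith [Real.add_one_le_exp ((Δt : ℝ) * q)]
      _ = Real.exp (n * (Δt * q)) := (Real.exp_nat_mul _ _).symm
      _ ≤ Real.exp (q * T) := by
          refine Real.exp_le_exp.2 ?_
          have hnN : (n : ℝ) ≤ N := by exact_mod_cast hn
          calc (n : ℝ) * (Δt * q) ≤ N * (Δt * q) := by gcongr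
            _ = q * T := by rw [hTN]; ring
  have htime : ∀ t ∈ Set.Ico 0 (T : ℝ),
      AEStronglyMeasurable (fun y : Ω × EuclideanSpace ℝ (Fin d) => 𝒯.approx Δt u t y.2 y.1)
        (P.prod volume) ∧
      eLpNorm (fun y : Ω × EuclideanSpace ℝ (Fin d) => 𝒯.approx Δt u t y.2 y.1) 2
        (P.prod volume) ^ 2 ≤ ENNReal.ofReal (Real.exp (q * T) * M) := by
    intro t ht
    obtain ⟨h1, h2⟩ := hest _ (UpwindFV.floor_div_lt hΔt0 hTN ht).le
    have hm : ∀ K, AEMeasurable (u ⌊t / Δt⌋₊ K) P := fun K => (h1 K).1.aemeasurable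
    exact ⟨(UpwindFV.aemeasurable_finsum_indicator_cell 𝒯 hd Measure.quasiMeasurePreserving_snd
      (g := fun K y => u ⌊t / Δt⌋₊ K y.1) fun K => (hm K).comp_quasiMeasurePreserving
        Measure.quasiMeasurePreserving_fst).aestronglyMeasurable,
      (UpwindFV.eLpNorm_sq_prod_eq_energy 𝒯 hd hm).trans_le h2⟩
  have hfin : ∀ {a : ℝ≥0∞} {r : ℝ}, a ^ 2 ≤ ENNReal.ofReal r → a < ∞ := by
    intro a r h
    refine lt_top_iff_ne_top.2 ?_
    rintro rfl
    simp at h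
  refine ⟨⟨fun t ht => ⟨(htime t ht).1, hfin (htime t ht).2⟩, ?_⟩, ?_⟩
  · have hB : 0 ≤ Real.exp (q * T) * M := by positivity
    -- Written as a square, the bound can be compared before squaring, where it is a constant bound
    -- for the essential supremum.
    rw [← Real.sq_sqrt hB, ENNReal.ofReal_pow (Real.sqrt_nonneg _)] at htime ⊢
    refine pow_le_pow_left₀ zero_le (essSup_le_of_ae_le _ ?_) 2
    filter_upwards [ae_restrict_mem measurableSet_Ioo] with t ht
    exact (ENNReal.pow_le_pow_left_iff two_ne_zero).1
      (htime t (Set.Ioo_subset_Ico_self ht)).2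
  · obtain ⟨h1, h2⟩ := UpwindFV.aestronglyMeasurable_approx_and_eLpNorm_sq_le 𝒯 hd hΔt0 hTN
      (P := P) (u := u) fun n hn K => ((hest n hn.le).1 K).1.aemeasurable
    -- The `N` time steps of length `Δt` add up to the factor `T`.
    have h3 := h2.trans (Finset.sum_le_sum fun n hn =>
      mul_le_mul_right (hest n (Finset.mem_range.1 hn).le).2 (ENNReal.ofReal Δt))
    rw [Finset.sum_const, Finset.card_range, nsmul_eq_mul, ← ENNReal.ofReal_mul hΔt0.le,
      ← ENNReal.ofReal_natCast, ← ENNReal.ofReal_mul hN'.le, ← mul_assoc, ← mul_assoc,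
      ← hTN] at h3
    exact ⟨⟨h1, hfin h3⟩, h3⟩
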